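/- Let $k\ge 1$ and let $S$ be a non-empty set of positive integers with $S\neq\{1\}$. **Partitions.** A partition with $n$ vertices is a set partition $P$ of $n$ points on the unit circle, labelled counterclockwise by $0,\dots,n-1$. Two chords cross when their relative interiors intersect. A crossing of $P$ is an unordered pair of crossing chords $u_1u_2$, $v_1v_2$ with $u_1,u_2\in U$ and $v_1,v_2\in V$ for two distinct blocks $U,V$ of $P$ (so crossings are counted with multiplicity). Let $P^S_k(n)$ be the number of partitions with $n$ vertices and exactly $k$ crossings all of whose block sizes belong to $S$. **Cores.** A $k$-core partition is a partition with exactly $k$ crossings in which each block is involved in a crossing; there are finitely many of them. For such a $K$, let $n(K)$ be its number of vertices. Draw each block as the convex hull of its points; the regions of $K$ are the connected components of the complement of $K$ in the closed unit disk, and a region has $i$ boundary arcs if its intersection with the unit circle has $i$ connected components. Let $n_i(K)$ be the number of regions with $i$ boundary arcs, and let $\varphi(K)=\sum_{i>1}(2i-3)\,n_i(K)$ be the potential of $K$. Let $\Phi_{k,S}$ be the maximum of $\varphi(K)$ over all $k$-core partitions $K$ with block sizes in $S$ (with $\Phi_{k,S}=0$ if there are none). **Constants.** Let $\tau_S$ be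 the unique positive real number with $\sum_{s\in S}(s-1)\tau_S^s=1$, and let $$\rho_S=\frac{\tau_S}{\sum_{s\in S}s\,\tau_S^s},\qquad \beta_S=\sqrt{\frac{2\big(\sum_{s\in S}s\,\tau_S^s\big)^3}{\sum_{s\in S}s(s-1)\,\tau_S^s}},$$ $$\Lambda_S=\frac{\gcd(S)\,\Phi_{k,S}}{2\,\Gamma\big(\frac{\Phi_{k,S}}2+1\big)}\sum_K\frac{\tau_S^{n_1(K)}}{n(K)}\prod_{i>1}\bigg(\frac{\rho_S^i\,\beta_S\,(2i-5)!!}{2^{i-1}\,(i-1)!}\bigg)^{n_i(K)},$$ where $K$ ranges over the $k$-core partitions with block sizes in $S$ and $\varphi(K)=\Phi_{k,S}$, and where $(-1)!!=1$. **Proposition.** If $n$ is not a multiple of $\gcd(S)$, then $P^S_k(n)=0$. As $n\to\infty$ along the multiples of $\gcd(S)$, $$P^S_k(n)=\big(\Lambda_S+o(1)\big)\,n^{\Phi_{k,S}/2}\,\rho_S^{-n}.$$ If moreover $\Phi_{k,S}>0$ (that is, if some $k$-core partition with block sizes in $S$ has a region with at least two boundary arcs), then $\Lambda_S>0$, and hence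 $$P^S_k(n)=\Lambda_S\,n^{\Phi_{k,S}/2}\,\rho_S^{-n}\,(1+o(1)).$$ -/

import Mathlib

noncomputable section

namespace CirclePartition

/-! ### Partitions of points on the unit circle -/

/-- The `j`-th of `n` points on the unit circle of `ℂ`, numbered counterclockwise. -/
def vertex (n : ℕ) (j : Fin n) : ℂ :=
  Complex.exp (2 * Real.pi * Complex.I * ((j : ℕ) : ℂ) / (n : ℂ))

/-- A (rooted) partition of `n` points on the unit circle; the root is the mark on the arc just
before the vertex `0`, so that the vertices are labelled. -/
abbrev Partition (n : ℕ) : Type := Finpartition (Finset.univ : Finset (Fin n))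

variable {n : ℕ}

/-- The chords `u₁u₂` and `v₁v₂` cross: their relative interiors intersect. -/
def ChordsCross (u₁ u₂ v₁ v₂ : Fin n) : Prop :=
  (openSegment ℝ (vertex n u₁) (vertex n u₂) ∩
    openSegment ℝ (vertex n v₁) (vertex n v₂)).Nonempty

/-- The crossings of a partition: the pairs of crossing chords `u₁u₂`, `v₁v₂` with endpoints in two
different blocks `U`, `V`. The inequalities select one representative `((u₁, u₂), (v₁, v₂))` of
each unordered pair of unordered chords. -/
def crossings (P : Partition n) : Set ((Fin n × Fin n) × (Fin n × Fin n)) :=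
  {c | c.1.1 < c.1.2 ∧ c.2.1 < c.2.2 ∧ c.1.1 < c.2.1 ∧
    ChordsCross c.1.1 c.1.2 c.2.1 c.2.2 ∧
    ∃ U ∈ P.parts, ∃ V ∈ P.parts, U ≠ V ∧
      c.1.1 ∈ U ∧ c.1.2 ∈ U ∧ c.2.1 ∈ V ∧ c.2.2 ∈ V}

/-- The number of crossings, counted with multiplicity. -/
def crossingNumber (P : Partition n) : ℕ := (crossings P).ncard

/-- All block sizes belong to `S`. -/
def HasBlockSizesIn (S : Set ℕ) (P : Partition n) : Prop := ∀ B ∈ P.parts, B.card ∈ S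

/-- A core partition: each block is involved in a crossing. -/
def IsCore (P : Partition n) : Prop :=
  ∀ B ∈ P.parts, ∃ c ∈ crossings P, c.1.1 ∈ B ∨ c.2.1 ∈ B

/-- The number of partitions with `n` vertices, `k` crossings and block sizes in `S`. -/
def partitionCount (S : Set ℕ) (k n : ℕ) : ℕ :=
  {P : Partition n | HasBlockSizesIn S P ∧ crossingNumber P = k}.ncard

/-! ### Regions and boundary arcs -/

/-- The complement, in the unit disk, of the partition, each block being drawn as the convex hull
of its vertices. -/
def diskComplement (P : Partition n) : Set ℂ :=
  Metric.closedBall 0 1 \ ⋃ B ∈ P.parts, convexHull ℝ (vertex n '' (B : Set (Fin n)))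

/-- The regions of a partition: the connected components of its complement in the unit disk. -/
def regions (P : Partition n) : Set (Set ℂ) :=
  {R | ∃ x ∈ diskComplement P, R = connectedComponentIn (diskComplement P) x}

/-- The boundary arcs of a region: the connected components of its intersection with the unit
circle. -/
def boundaryArcs (R : Set ℂ) : Set (Set ℂ) :=
  {A | ∃ x ∈ R ∩ Metric.sphere 0 1, A = connectedComponentIn (R ∩ Metric.sphere 0 1) x}

/-- `n_i(P)`, the number of regions with exactly `i` boundary arcs (used for `i ≥ 1`). -/
def regionCount (i : ℕ) (P : Partition n) : ℕ :=
  {R ∈ regions P | (boundaryArcs R).ncard = i}.ncard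

/-- The potential `φ(P) = ∑_{i > 1} (2 i - 3) n_i(P)`. A region has at most `n` boundary arcs. -/
def potential (P : Partition n) : ℕ :=
  ∑ i ∈ Finset.Icc 2 n, (2 * i - 3) * regionCount i P

/-- The `k`-core partitions (with any number of vertices) whose block sizes belong to `S`. -/
def cores (S : Set ℕ) (k : ℕ) : Set (Σ n : ℕ, Partition n) :=
  {K | IsCore K.2 ∧ crossingNumber K.2 = k ∧ HasBlockSizesIn S K.2}

/-- `Φ_{k,S}`, the maximal potential of a `k`-core partition with block sizes in `S` (it is `0`
when there is no such core). -/
def maxPotential (S : Set ℕ) (k : ℕ) : ℕ := sSup ((fun K => potential K.2) '' cores S k)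

/-- The `k`-core partitions with block sizes in `S` that maximize the potential. -/
def maximalCores (S : Set ℕ) (k : ℕ) : Set (Σ n : ℕ, Partition n) :=
  {K ∈ cores S k | potential K.2 = maxPotential S k}

/-! ### The constants -/

/-- `t` is a positive real number with `∑_{s ∈ S} (s - 1) t ^ s = 1`. -/
def IsTau (S : Set ℕ) (t : ℝ) : Prop :=
  0 < t ∧ HasSum (fun s : S => (((s : ℕ) : ℝ) - 1) * t ^ (s : ℕ)) 1

/-- The constant `τ_S` is well defined. -/
theorem existsUnique_isTau {S : Set ℕ} (h0 : 0 ∉ S) (hne : S.Nonempty) (h1 : S ≠ {1}) :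
    ∃! t : ℝ, IsTau S t := by
  have hpos : ∀ s : S, (1 : ℝ) ≤ ((s : ℕ) : ℝ) := fun s => by
    have h : (s : ℕ) ≠ 0 := fun h => h0 (h ▸ s.2)
    exact_mod_cast Nat.one_le_iff_ne_zero.2 h
  obtain ⟨a, haS, ha⟩ : ∃ a ∈ S, 2 ≤ a := by
    by_contra! hcon
    refine h1 (Set.eq_singleton_iff_nonempty_unique_mem.2 ⟨hne, fun s hs => ?_⟩)
    have h2 := hcon s hs
    have h3 : s ≠ 0 := fun h => h0 (h ▸ hs)
    omega
  -- a radius at which the series converges and is at least one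
  obtain ⟨r, hr0, hsum, b, hb⟩ : ∃ r : ℝ, 0 < r ∧
      Summable (fun s : S => (((s : ℕ) : ℝ) - 1) * r ^ (s : ℕ)) ∧
      ∃ b : S, 1 ≤ (((b : ℕ) : ℝ) - 1) * r ^ (b : ℕ) := by
    rcases S.finite_or_infinite with hf | hf
    · have := hf.to_subtype
      refine ⟨1, one_pos, Summable.of_finite, ⟨a, haS⟩, ?_⟩
      have : (2 : ℝ) ≤ (a : ℝ) := by exact_mod_cast ha
      simp only [one_pow, mul_one]
      linarith
    · obtain ⟨b, hbS, hb⟩ := hf.exists_gt 2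
      have hb3 : (3 : ℝ) ≤ (b : ℝ) := by exact_mod_cast hb
      have hc : Filter.Tendsto (fun r : ℝ => ((b : ℝ) - 1) * r ^ b) (nhdsWithin 1 (Set.Iio 1))
          (nhds (((b : ℝ) - 1) * 1 ^ b)) :=
        (Continuous.tendsto (by fun_prop) 1).mono_left nhdsWithin_le_nhds
      have h1lt : (1 : ℝ) < ((b : ℝ) - 1) * 1 ^ b := by
        rw [one_pow, mul_one]; linarith
      have hev := (hc.eventually (lt_mem_nhds h1lt)).and
        (Ioo_mem_nhdsLT (show (0 : ℝ) < 1 by norm_num))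
      obtain ⟨r, hr, hr0, hr1⟩ := hev.exists
      refine ⟨r, hr0, ?_, ⟨b, hbS⟩, hr.le⟩
      have hn : ‖r‖ < 1 := by rwa [Real.norm_of_nonneg hr0.le]
      have hs : Summable (fun s : ℕ => ((s : ℝ) - 1) * r ^ s) := by
        have h := (summable_pow_mul_geometric_of_norm_lt_one 1 hn).sub
          (summable_geometric_of_norm_lt_one hn)
        refine h.congr fun s => ?_
        rw [pow_one]; ring
      exact hs.comp_injective Subtype.val_injective
  have hbound : ∀ (s : S) (x : ℝ), x ∈ Set.Icc 0 r →
      ‖(((s : ℕ) : ℝ) - 1) * x ^ (s : ℕ)‖ ≤ (((s : ℕ) : ℝ) - 1) * r ^ (s : ℕ) := by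
    intro s x hx
    have hs := hpos s
    rw [Real.norm_of_nonneg (mul_nonneg (by linarith) (pow_nonneg hx.1 _))]
    exact mul_le_mul_of_nonneg_left (pow_le_pow_left₀ hx.1 hx.2 _) (by linarith)
  have hcont : ContinuousOn (fun x : ℝ => ∑' s : S, (((s : ℕ) : ℝ) - 1) * x ^ (s : ℕ))
      (Set.Icc 0 r) := by
    refine continuousOn_tsum (fun s => ?_) hsum hbound
    fun_prop
  have hzero : ∑' s : S, (((s : ℕ) : ℝ) - 1) * (0 : ℝ) ^ (s : ℕ) = 0 := by
    have : ∀ s : S, (((s : ℕ) : ℝ) - 1) * (0 : ℝ) ^ (s : ℕ) = 0 := fun s => by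
      rw [zero_pow (fun h => h0 (h ▸ s.2)), mul_zero]
    simp only [this, tsum_zero]
  have hge : 1 ≤ ∑' s : S, (((s : ℕ) : ℝ) - 1) * r ^ (s : ℕ) :=
    hb.trans (hsum.le_tsum b fun s _ =>
      mul_nonneg (by linarith [hpos s]) (pow_nonneg hr0.le _))
  obtain ⟨t, ht, hte⟩ := intermediate_value_Icc hr0.le hcont
    (show (1 : ℝ) ∈ Set.Icc _ _ from ⟨by rw [hzero]; exact zero_le_one, hge⟩)
  have hte' : ∑' s : S, (((s : ℕ) : ℝ) - 1) * t ^ (s : ℕ) = 1 := hte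
  have ht0 : 0 < t := by
    rcases ht.1.lt_or_eq with h | h
    · exact h
    · rw [← h, hzero] at hte'
      exact absurd hte' zero_ne_one
  have hts : Summable (fun s : S => (((s : ℕ) : ℝ) - 1) * t ^ (s : ℕ)) :=
    Summable.of_norm_bounded hsum fun s => hbound s t ht
  have hmono : ∀ x y : ℝ, IsTau S x → IsTau S y → ¬ x < y := by
    intro x y hx hy hxy
    have ha1 : (2 : ℝ) ≤ (a : ℝ) := by exact_mod_cast ha
    refine lt_irrefl (1 : ℝ) (hasSum_lt (i := (⟨a, haS⟩ : S)) (fun s => ?_) ?_ hx.2 hy.2)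
    · exact mul_le_mul_of_nonneg_left (pow_le_pow_left₀ hx.1.le hxy.le _)
        (by linarith [hpos s])
    · exact mul_lt_mul_of_pos_left (pow_lt_pow_left₀ hxy hx.1.le (by show a ≠ 0; omega))
        (by show (0 : ℝ) < (a : ℝ) - 1; linarith)
  have hsumt := hts.hasSum
  rw [hte'] at hsumt
  have hT : IsTau S t := ⟨ht0, hsumt⟩
  refine ⟨t, hT, fun y hy => ?_⟩
  exact le_antisymm (not_lt.1 (hmono t y hT hy)) (not_lt.1 (hmono y t hy hT))

/-- `τ_S`, the unique positive real number with `∑_{s ∈ S} (s - 1) τ_S ^ s = 1`. -/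
def tau (S : Set ℕ) : ℝ := Classical.epsilon (IsTau S)

/-- `τ_S` has its defining property. -/
theorem isTau_tau {S : Set ℕ} (h0 : 0 ∉ S) (hne : S.Nonempty) (h1 : S ≠ {1}) :
    IsTau S (tau S) :=
  Classical.epsilon_spec (existsUnique_isTau h0 hne h1).exists

/-- `ρ_S = τ_S / ∑_{s ∈ S} s τ_S ^ s`. -/
def rho (S : Set ℕ) : ℝ := tau S / ∑' s : S, ((s : ℕ) : ℝ) * tau S ^ (s : ℕ)

/-- `β_S = √(2 (∑_{s ∈ S} s τ_S ^ s)³ / ∑_{s ∈ S} s (s - 1) τ_S ^ s)`. -/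
def beta (S : Set ℕ) : ℝ :=
  Real.sqrt (2 * (∑' s : S, ((s : ℕ) : ℝ) * tau S ^ (s : ℕ)) ^ 3 /
    ∑' s : S, ((s : ℕ) : ℝ) * (((s : ℕ) : ℝ) - 1) * tau S ^ (s : ℕ))

/-- The weight of a core `K` in `Λ_S`. For `i = 2` the double factorial `(2 i - 5)‼` is
`(-1)‼ = 1`, which agrees with `0‼ = 1` for the truncated subtraction. -/
def weight (S : Set ℕ) (K : Σ n : ℕ, Partition n) : ℝ :=
  tau S ^ regionCount 1 K.2 / (K.1 : ℝ) *
    ∏ i ∈ Finset.Icc 2 K.1,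
      (rho S ^ i * beta S * (Nat.doubleFactorial (2 * i - 5) : ℝ) /
        (2 ^ (i - 1) * (Nat.factorial (i - 1) : ℝ))) ^ regionCount i K.2

/-- The constant `Λ_S` (it depends on `k` as well). The sum is over a finite set. -/
def Lam (S : Set ℕ) (k : ℕ) : ℝ :=
  (Nat.setGcd S : ℝ) * (maxPotential S k : ℝ) /
      (2 * Real.Gamma ((maxPotential S k : ℝ) / 2 + 1)) *
    ∑ᶠ K ∈ maximalCores S k, weight S K

/-- The filter of the limits `n → ∞`, `gcd(S) ∣ n`. -/
def atTopDvd (S : Set ℕ) : Filter ℕ := Filter.atTop ⊓ Filter.principal {n | Nat.setGcd S ∣ n}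

end CirclePartition

end

open Filter Topology

noncomputable section

namespace CirclePartition

/-! ### Convolutions of regularly varying sequences -/

/-! The blocks involved in crossings form a core with at most `4 * k` points. The other blocks cross
nothing, so each of them stays inside one region of the core, and the blocks in a region form an
arbitrary noncrossing partition of the points there, independently of the other regions
(`ncard_extensions`). Among partitions whose core contains the vertex `0`, placing the core amounts
to choosing the sizes of its gaps. Since `N` points are spread over the `i` boundary arcs of a
region in `(i + N - 1).choose N` ways, the count for a core `K` with `m` points is the coefficient
of order `n - m` of a product of one `regionSeries` per region (`sum_ncard_extensions`). Rotation
and double counting remove the condition on `0` at the cost of a factor `n / m`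
(`mul_ncard_withCoreSize`). Hence the number of partitions is a finite sum over cores
(`partitionCount_eq_sum`).

The noncrossing partitions are a special case of the same insertion: the block of `0` plays the role
of the core, which gives `B = f (x B)` with `f = 1 + ∑ w ^ s`, and `lagrange_inversion` turns this
into `(N + 1) nc N = [w ^ N] f ^ (N + 1)`. Weighting `w ^ s` by `τ ^ s / f(τ)` makes `f` a
probability law; the equation of `τ` says exactly that its mean is `1`, so the coefficient is the
probability that a sum of `N + 1` independent variables takes a value within bounded distance of its
mean. The local limit theorem `IsLatticeLaw.tendsto_sqrt_mul_coeff`, applied after division by `d =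
gcd(S)`, gives `nc N` of order `ρ ^ (-N) N ^ (-3/2)` along the multiples of `d`.

A region with `i ≥ 2` arcs therefore has rescaled coefficients of order `M ^ (i - 5/2)`, like `(1 -
x) ^ (-(i - 3/2))`. A region with one arc has summable coefficients of size `o(1/M)`, and only their
sum `f(τ)` matters (`hasSum_scaledRegionSeries_one`). In a product the exponents `i - 3/2` add up to
half the potential and the constants multiply; this is proved by real convolution estimates
(`tendsto_coeff_mul_div`, `IsSmall.tendsto_coeff_mul_div`), without complex singularity analysis.
With the factor `n / m` a core of potential `φ` contributes at order `n ^ (φ / 2) ρ ^ (-n)`, so only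
the maximal potential survives. When that maximum is `0`, the coefficients are `o(1/n)`, the limit
is `0`, and this agrees with the factor `Φ` in `Λ`.

What remains is to match the geometry with this combinatorics: chords cross exactly when their ends
interleave (`chordsCross_iff`), and two arcs bound the same region exactly when no chord inside a
block separates them (`regionOf_eq_iff`, `regionCount_eq`). -/

/-- A Toeplitz lemma: vanishing columns kill any finite part of the sum, and bounded row sums
control the tail, where `z` is small. The convolution errors below are reduced to it. -/
theorem tendsto_sum_mul_of_tendsto_zero {w : ℕ → ℕ → ℝ} {z : ℕ → ℝ} {C : ℝ}
    (hw0 : ∀ n i, 0 ≤ w n i) (hwC : ∀ᶠ n in atTop, ∑ i ∈ Finset.range (n + 1), w n i ≤ C)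
    (hw : ∀ i, Tendsto (fun n => w n i) atTop (𝓝 0)) (hz : Tendsto z atTop (𝓝 0)) :
    Tendsto (fun n => ∑ i ∈ Finset.range (n + 1), w n i * z i) atTop (𝓝 0) := by
  rw [Metric.tendsto_atTop]
  intro ε hε
  have hC : 0 ≤ C := by
    obtain ⟨n, hn⟩ := hwC.exists
    exact (Finset.sum_nonneg fun i _ => hw0 n i).trans hn
  -- `C + 1` instead of `C`, since `C` may be `0`.
  obtain ⟨N, hN⟩ := Metric.tendsto_atTop.1 hz (ε / (2 * (C + 1))) (by positivity)
  have h1 : Tendsto (fun n => ∑ i ∈ Finset.range N, w n i * |z i|) atTop (𝓝 0) := by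
    have := tendsto_finsetSum (Finset.range N) fun i _ => (hw i).mul_const (|z i|)
    simpa using this
  obtain ⟨N1, hN1⟩ := Metric.tendsto_atTop.1 h1 (ε / 2) (by positivity)
  obtain ⟨N2, hN2⟩ := eventually_atTop.1 hwC
  refine ⟨max N1 (max N N2), fun n hn => ?_⟩
  have hn1 := hN1 n (le_trans (le_max_left _ _) hn)
  have hn2 : N ≤ n := le_trans (le_trans (le_max_left _ _) (le_max_right _ _)) hn
  have hn3 := hN2 n (le_trans (le_trans (le_max_right _ _) (le_max_right _ _)) hn)
  rw [Real.dist_eq, sub_zero] at hn1 ⊢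
  have hb : ∀ i ∈ Finset.range (n + 1), |w n i * z i| ≤
      (if i ∈ Finset.range N then w n i * |z i| else 0) + w n i * (ε / (2 * (C + 1))) := by
    intro i _
    rw [abs_mul, abs_of_nonneg (hw0 n i)]
    split_ifs with hi
    · have := mul_nonneg (hw0 n i) (show 0 ≤ ε / (2 * (C + 1)) by positivity)
      linarith
    · rw [zero_add]
      refine mul_le_mul_of_nonneg_left ?_ (hw0 n i)
      have := hN i (by simpa using hi)
      rw [Real.dist_eq, sub_zero] at this
      exact this.le
  calc |∑ i ∈ Finset.range (n + 1), w n i * z i|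
      ≤ ∑ i ∈ Finset.range (n + 1), |w n i * z i| := Finset.abs_sum_le_sum_abs _ _
    _ ≤ _ := Finset.sum_le_sum hb
    _ = ∑ i ∈ Finset.range N, w n i * |z i| +
        (∑ i ∈ Finset.range (n + 1), w n i) * (ε / (2 * (C + 1))) := by
        rw [Finset.sum_add_distrib, Finset.sum_mul, ← Finset.sum_filter]
        congr 2
        ext i
        simp only [Finset.mem_filter, Finset.mem_range]
        omega
    _ ≤ abs (∑ i ∈ Finset.range N, w n i * |z i|) + C * (ε / (2 * (C + 1))) := by
        gcongr
        exact le_abs_self _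
    _ < ε / 2 + ε / 2 := by
        refine add_lt_add_of_lt_of_le hn1 ?_
        rw [mul_div_assoc', div_le_div_iff₀ (by positivity) (by positivity)]
        nlinarith
    _ = ε := by ring

/-! ### The comparison sequences: coefficients of `(1 - x) ^ (-α)` -/

/-- The coefficient of `x ^ n` in `(1 - x) ^ (-α)`. -/
def risingCoeff (α : ℝ) (n : ℕ) : ℝ := ∏ i ∈ Finset.range n, (α + i) / (i + 1)

theorem risingCoeff_zero (α : ℝ) : risingCoeff α 0 = 1 := by simp [risingCoeff]

theorem risingCoeff_succ (α : ℝ) (n : ℕ) :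
    risingCoeff α (n + 1) = risingCoeff α n * ((α + n) / (n + 1)) := by
  exact Finset.prod_range_succ _ _

theorem risingCoeff_pos {α : ℝ} (hα : 0 < α) (n : ℕ) : 0 < risingCoeff α n :=
  Finset.prod_pos fun i _ => by positivity

theorem succ_mul_risingCoeff_succ (α : ℝ) (n : ℕ) :
    ((n : ℝ) + 1) * risingCoeff α (n + 1) = (α + n) * risingCoeff α n := by
  rw [risingCoeff_succ]; field_simp

theorem mul_risingCoeff_add_one (α : ℝ) (n : ℕ) :
    α * risingCoeff (α + 1) n = (α + n) * risingCoeff α n := by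
  induction n with
  | zero => simp [risingCoeff_zero]
  | succ n ih =>
    rw [risingCoeff_succ, ← mul_assoc, ih, risingCoeff_succ]
    push_cast; ring

theorem risingCoeff_one (n : ℕ) : risingCoeff 1 n = 1 := by
  induction n with
  | zero => exact risingCoeff_zero _
  | succ n ih => rw [risingCoeff_succ, ih]; field_simp; ring

/-- For `α < 1` the coefficients themselves decrease. The factor `n` restores monotonicity for every
`α > 0`, which is what domination arguments need. -/
theorem natCast_mul_risingCoeff_mono {α : ℝ} (hα : 0 < α) {m n : ℕ} (h : m ≤ n) :
    (m : ℝ) * risingCoeff α m ≤ n * risingCoeff α n := by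
  refine monotone_nat_of_le_succ (f := fun n : ℕ => (n : ℝ) * risingCoeff α n) (fun k => ?_) h
  have := succ_mul_risingCoeff_succ α k
  have := risingCoeff_pos hα k
  push_cast
  nlinarith

theorem le_natCast_mul_risingCoeff {α : ℝ} (hα : 0 < α) {n : ℕ} (h : n ≠ 0) :
    α ≤ n * risingCoeff α n := by
  have := natCast_mul_risingCoeff_mono hα (Nat.one_le_iff_ne_zero.2 h)
  simpa [risingCoeff] using this

/-- Each series solves `(1 - x) U' = α U`. The product then solves the same equation with `α + β`,
and this equation determines all coefficients from the constant one. -/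
theorem mk_risingCoeff_mul (α β : ℝ) :
    PowerSeries.mk (risingCoeff α) * PowerSeries.mk (risingCoeff β) =
      PowerSeries.mk (risingCoeff (α + β)) := by
  have key : ∀ α : ℝ, (1 - PowerSeries.X) *
      PowerSeries.derivative ℝ (PowerSeries.mk (risingCoeff α)) =
        PowerSeries.C α * PowerSeries.mk (risingCoeff α) := by
    intro α
    ext n
    rw [sub_mul, one_mul, map_sub, PowerSeries.coeff_C_mul]
    cases n with
    | zero => simp [PowerSeries.coeff_derivative, risingCoeff]
    | succ n =>
      rw [PowerSeries.coeff_succ_X_mul]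
      simp only [PowerSeries.coeff_derivative, PowerSeries.coeff_mk]
      have := succ_mul_risingCoeff_succ α (n + 1)
      push_cast at this ⊢
      linarith
  set P := PowerSeries.mk (risingCoeff α) * PowerSeries.mk (risingCoeff β) with hP
  have hd : (1 - PowerSeries.X) * PowerSeries.derivative ℝ P = PowerSeries.C (α + β) * P := by
    rw [hP, Derivation.leibniz, smul_eq_mul, smul_eq_mul, map_add]
    linear_combination PowerSeries.mk (risingCoeff α) * key β +
      PowerSeries.mk (risingCoeff β) * key α
  ext n
  rw [PowerSeries.coeff_mk]
  induction n with
  | zero => simp [hP, risingCoeff]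
  | succ n ih =>
    have h := congrArg (PowerSeries.coeff n) hd
    have h2 : PowerSeries.coeff n ((1 - PowerSeries.X) * PowerSeries.derivative ℝ P) =
        PowerSeries.coeff (n + 1) P * (n + 1) - n * PowerSeries.coeff n P := by
      rw [sub_mul, one_mul, map_sub]
      cases n with
      | zero => simp [PowerSeries.coeff_derivative]
      | succ n =>
        rw [PowerSeries.coeff_succ_X_mul]
        simp only [PowerSeries.coeff_derivative]
        push_cast; ring
    rw [h2, PowerSeries.coeff_C_mul, ih] at h
    rw [risingCoeff_succ, mul_div_assoc', eq_div_iff (by positivity)]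
    linarith

theorem sum_risingCoeff_mul (α β : ℝ) (n : ℕ) :
    ∑ i ∈ Finset.range (n + 1), risingCoeff α i * risingCoeff β (n - i) =
      risingCoeff (α + β) n := by
  have := congrArg (PowerSeries.coeff n) (mk_risingCoeff_mul α β)
  rw [PowerSeries.coeff_mul, Finset.Nat.sum_antidiagonal_eq_sum_range_succ
    (fun i j => PowerSeries.coeff i (PowerSeries.mk (risingCoeff α)) *
      PowerSeries.coeff j (PowerSeries.mk (risingCoeff β)))] at this
  simpa using this

/-- Euler's limit for the Gamma function. `Real.GammaSeq` has one more factor `α + n` in its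
denominator, whence the correction `n / (n + α)`. -/
theorem tendsto_risingCoeff_div_rpow {α : ℝ} (hα : 0 < α) :
    Tendsto (fun n : ℕ => risingCoeff α n / (n : ℝ) ^ (α - 1)) atTop (𝓝 (Real.Gamma α)⁻¹) := by
  have h := (Real.GammaSeq_tendsto_Gamma α).inv₀ (Real.Gamma_pos_of_pos hα).ne'
  have h2 : Tendsto (fun n : ℕ => ((n : ℝ) / ((n : ℝ) + α))) atTop (𝓝 1) :=
    tendsto_natCast_div_add_atTop α
  have h3 := h.mul h2
  rw [mul_one] at h3
  refine h3.congr' ?_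
  filter_upwards [eventually_gt_atTop 0] with n hn
  have hn' : (0 : ℝ) < n := by exact_mod_cast hn
  have hr : risingCoeff α n = (∏ j ∈ Finset.range n, (α + j)) / n.factorial := by
    rw [risingCoeff, Finset.prod_div_distrib, ← Finset.prod_range_add_one_eq_factorial]
    push_cast; rfl
  rw [Real.GammaSeq, Finset.prod_range_succ, hr, Real.rpow_sub_one hn'.ne']
  have : (0 : ℝ) < (n : ℝ) ^ α := Real.rpow_pos_of_pos hn' _
  have : (0 : ℝ) < n.factorial := by positivity
  field_simp
  rw [add_comm α]

theorem tendsto_risingCoeff_sub_div {α : ℝ} (hα : 0 < α) (i : ℕ) :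
    Tendsto (fun n : ℕ => risingCoeff α (n - i) / risingCoeff α n) atTop (𝓝 1) := by
  induction i with
  | zero =>
    refine tendsto_const_nhds.congr fun n => ?_
    simp [(risingCoeff_pos hα n).ne']
  | succ i ih =>
    have h1 : Tendsto (fun n : ℕ => ((n : ℝ) + 1) / (α + n)) atTop (𝓝 1) := by
      have h2 : Tendsto (fun n : ℕ => (n : ℝ) / (n + α) + 1 / (n + α)) atTop (𝓝 (1 + 0)) := by
        refine (tendsto_natCast_div_add_atTop α).add (tendsto_const_nhds.div_atTop ?_)
        exact tendsto_atTop_add_const_right _ _ tendsto_natCast_atTop_atTop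
      rw [add_zero] at h2
      refine h2.congr fun n => ?_
      rw [← add_div, add_comm α]
    have h3 : Tendsto (fun n : ℕ => n - (i + 1)) atTop atTop := tendsto_sub_atTop_nat _
    have h4 := ih.mul (h1.comp h3)
    rw [one_mul] at h4
    refine h4.congr' ?_
    filter_upwards [eventually_gt_atTop i] with n hn
    have h5 : n - i = (n - (i + 1)) + 1 := by omega
    have h6 := risingCoeff_pos hα n
    have h7 := risingCoeff_pos hα (n - (i + 1))
    simp only [Function.comp_apply]
    rw [h5, risingCoeff_succ]
    field_simp

theorem tendsto_risingCoeff_div_add {α β : ℝ} (hα : 0 < α) (hβ : 0 < β) :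
    Tendsto (fun n : ℕ => risingCoeff β n / risingCoeff (α + β) n) atTop (𝓝 0) := by
  have h1 := (tendsto_risingCoeff_div_rpow hβ).div
    (tendsto_risingCoeff_div_rpow (add_pos hα hβ))
    (inv_ne_zero (Real.Gamma_pos_of_pos (add_pos hα hβ)).ne')
  have h2 := h1.mul ((tendsto_rpow_neg_atTop hα).comp tendsto_natCast_atTop_atTop)
  rw [mul_zero] at h2
  refine h2.congr' ?_
  filter_upwards [eventually_gt_atTop 0] with n hn
  have hn' : (0 : ℝ) < n := by exact_mod_cast hn
  have h6 := risingCoeff_pos (add_pos hα hβ) n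
  simp only [Pi.div_apply, Function.comp_apply]
  have h7 : (n : ℝ) ^ (α + β - 1) = (n : ℝ) ^ α * (n : ℝ) ^ (β - 1) := by
    rw [← Real.rpow_add hn']; ring_nf
  have := Real.rpow_pos_of_pos hn' (β - 1)
  have := Real.rpow_pos_of_pos hn' α
  rw [h7, Real.rpow_neg hn'.le]
  field_simp

theorem coeff_mul_range (U V : PowerSeries ℝ) (n : ℕ) : PowerSeries.coeff n (U * V) =
    ∑ i ∈ Finset.range (n + 1), PowerSeries.coeff i U * PowerSeries.coeff (n - i) V := by
  rw [PowerSeries.coeff_mul, Finset.Nat.sum_antidiagonal_eq_sum_range_succ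
    (fun i j => PowerSeries.coeff i U * PowerSeries.coeff j V)]

/-- By `sum_risingCoeff_mul` the kernel is a probability vector in `i`, and the mass of each fixed
`i` tends to `0`. So a null sequence averages to `0`, while `y` only has to be bounded. -/
theorem tendsto_coeff_mul_div_aux {α β : ℝ} (hα : 0 < α) (hβ : 0 < β) {z y : ℕ → ℝ} {B : ℝ}
    (hz : Tendsto z atTop (𝓝 0)) (hy : Tendsto y atTop (𝓝 B)) :
    Tendsto (fun n => ∑ i ∈ Finset.range (n + 1),
      (risingCoeff α i * risingCoeff β (n - i) / risingCoeff (α + β) n) * (z i * y (n - i)))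
      atTop (𝓝 0) := by
  obtain ⟨Y, hY⟩ := hy.abs.bddAbove_range
  have hY' : ∀ n, |y n| ≤ Y := fun n => hY ⟨n, rfl⟩
  have hp : ∀ n i, 0 ≤ risingCoeff α i * risingCoeff β (n - i) / risingCoeff (α + β) n :=
    fun n i => (div_pos (mul_pos (risingCoeff_pos hα _) (risingCoeff_pos hβ _))
      (risingCoeff_pos (add_pos hα hβ) _)).le
  have h := tendsto_sum_mul_of_tendsto_zero (C := 1) (z := fun i => |z i|) hp
    (Eventually.of_forall fun n => ?_) (fun i => ?_) (by simpa using hz.abs)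
  · have h' := h.mul_const Y
    rw [zero_mul] at h'
    refine squeeze_zero_norm (fun n => ?_) h'
    rw [Finset.sum_mul]
    refine (norm_sum_le _ _).trans (Finset.sum_le_sum fun i _ => ?_)
    rw [norm_mul, Real.norm_of_nonneg (hp n i), mul_assoc, norm_mul]
    exact mul_le_mul_of_nonneg_left
      (mul_le_mul_of_nonneg_left (hY' _) (abs_nonneg _)) (hp n i)
  · rw [← Finset.sum_div, sum_risingCoeff_mul, div_self (risingCoeff_pos (add_pos hα hβ) _).ne']
  · have h1 := ((tendsto_risingCoeff_sub_div hβ i).mul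
      (tendsto_risingCoeff_div_add hα hβ)).const_mul (risingCoeff α i)
    rw [mul_zero, mul_zero] at h1
    refine h1.congr fun n => ?_
    have := risingCoeff_pos hβ n
    field_simp

/-- With normalized coefficients, `x y = (x - A) y + A (y - B) + A B`. The first two terms are null
averages, the second after reversing the order of summation, and the kernel gives `A B` total mass
`1`. -/
theorem tendsto_coeff_mul_div {α β : ℝ} (hα : 0 < α) (hβ : 0 < β) {U V : PowerSeries ℝ} {A B : ℝ}
    (hU : Tendsto (fun n => PowerSeries.coeff n U / risingCoeff α n) atTop (𝓝 A))
    (hV : Tendsto (fun n => PowerSeries.coeff n V / risingCoeff β n) atTop (𝓝 B)) :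
    Tendsto (fun n => PowerSeries.coeff n (U * V) / risingCoeff (α + β) n) atTop (𝓝 (A * B)) := by
  set x := fun n => PowerSeries.coeff n U / risingCoeff α n
  set y := fun n => PowerSeries.coeff n V / risingCoeff β n
  have hx0 : Tendsto (fun n => x n - A) atTop (𝓝 0) := by simpa using hU.sub_const A
  have hy0 : Tendsto (fun n => y n - B) atTop (𝓝 0) := by simpa using hV.sub_const B
  have h1 := tendsto_coeff_mul_div_aux hα hβ hx0 hV
  have h2 := tendsto_coeff_mul_div_aux (y := fun _ => A) hβ hα hy0 tendsto_const_nhds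
  have h3 := (h1.add h2).add_const (A * B)
  simp only [add_zero, zero_add] at h3
  refine h3.congr fun n => ?_
  have hne := (risingCoeff_pos (add_pos hα hβ) n).ne'
  rw [coeff_mul_range, ← Finset.sum_range_reflect (fun i => risingCoeff β i *
    risingCoeff α (n - i) / risingCoeff (β + α) n * ((y i - B) * A)), ← Finset.sum_add_distrib]
  have hAB : A * B = ∑ i ∈ Finset.range (n + 1),
      (risingCoeff α i * risingCoeff β (n - i) / risingCoeff (α + β) n) * (A * B) := by
    rw [← Finset.sum_mul, ← Finset.sum_div, sum_risingCoeff_mul, div_self hne, one_mul]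
  conv_lhs => rw [hAB]
  rw [← Finset.sum_add_distrib, Finset.sum_div]
  refine Finset.sum_congr rfl fun i hi => ?_
  have hi' : i ≤ n := by simpa [Nat.lt_succ_iff] using hi
  have e1 : n + 1 - 1 - i = n - i := by omega
  have e2 : n - (n - i) = i := by omega
  have hU' : PowerSeries.coeff i U = x i * risingCoeff α i := by
    simp [x, (risingCoeff_pos hα i).ne']
  have hV' : PowerSeries.coeff (n - i) V = y (n - i) * risingCoeff β (n - i) := by
    simp [y, (risingCoeff_pos hβ (n - i)).ne']
  rw [e1, e2, hU', hV', add_comm β α]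
  ring

/-! ### Products with summable series whose coefficients are `o(1/n)` -/

/-- Nonnegative summable sequences of size `o(1/n)`. -/
structure IsSmall (U : PowerSeries ℝ) : Prop where
  nonneg : ∀ n, 0 ≤ PowerSeries.coeff n U
  summable : Summable fun n => PowerSeries.coeff n U
  tendsto : Tendsto (fun n : ℕ => (n : ℝ) * PowerSeries.coeff n U) atTop (𝓝 0)

theorem tendsto_natCast_mul_sum_aux {U V : PowerSeries ℝ} (hU : IsSmall U) (hV : IsSmall V) :
    Tendsto (fun n => ∑ i ∈ Finset.range (n + 1),
      PowerSeries.coeff (n - i) V * ((i : ℝ) * PowerSeries.coeff i U)) atTop (𝓝 0) := by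
  refine tendsto_sum_mul_of_tendsto_zero (C := ∑' n, PowerSeries.coeff n V)
    (fun n i => hV.nonneg _) (Eventually.of_forall fun n => ?_) (fun i => ?_) hU.tendsto
  · rw [← Finset.sum_range_reflect]
    refine le_trans (le_of_eq (Finset.sum_congr rfl fun i hi => ?_))
      (hV.summable.sum_le_tsum (Finset.range (n + 1)) fun i _ => hV.nonneg i)
    rw [Finset.mem_range] at hi
    congr 2; omega
  · exact hV.summable.tendsto_atTop_zero.comp (tendsto_sub_atTop_nat i)

/-- The splitting `n = i + (n - i)` gives the factor `n` to one series at a time; each half averages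
a null sequence against a summable one. -/
theorem IsSmall.mul {U V : PowerSeries ℝ} (hU : IsSmall U) (hV : IsSmall V) :
    IsSmall (U * V) := by
  refine ⟨fun n => ?_, ?_, ?_⟩
  · rw [PowerSeries.coeff_mul]
    exact Finset.sum_nonneg fun p _ => mul_nonneg (hU.nonneg _) (hV.nonneg _)
  · have h := (summable_norm_sum_mul_antidiagonal_of_summable_norm hU.summable.norm
      hV.summable.norm).of_norm
    exact h.congr fun n => (PowerSeries.coeff_mul n U V).symm
  · have h := (tendsto_natCast_mul_sum_aux hU hV).add (tendsto_natCast_mul_sum_aux hV hU)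
    rw [add_zero] at h
    refine h.congr fun n => ?_
    rw [coeff_mul_range, ← Finset.sum_range_reflect (fun i => PowerSeries.coeff (n - i) U *
      ((i : ℝ) * PowerSeries.coeff i V)), ← Finset.sum_add_distrib, Finset.mul_sum]
    refine Finset.sum_congr rfl fun i hi => ?_
    have hi' : i ≤ n := by simpa [Nat.lt_succ_iff] using hi
    have e1 : n + 1 - 1 - i = n - i := by omega
    have e2 : n - (n - i) = i := by omega
    rw [e1, e2, Nat.cast_sub hi']
    ring

theorem IsSmall.tsum_mul {U V : PowerSeries ℝ} (hU : IsSmall U) (hV : IsSmall V) :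
    ∑' n, PowerSeries.coeff n (U * V) =
      (∑' n, PowerSeries.coeff n U) * ∑' n, PowerSeries.coeff n V := by
  rw [tsum_mul_tsum_eq_tsum_sum_antidiagonal_of_summable_norm hU.summable.norm hV.summable.norm]
  exact tsum_congr fun n => PowerSeries.coeff_mul n U V

theorem isSmall_one : IsSmall 1 := by
  refine ⟨fun n => ?_, ?_, ?_⟩
  · rw [PowerSeries.coeff_one]; split_ifs <;> norm_num
  · exact summable_of_ne_finset_zero (s := {0}) fun n hn => by
      rw [PowerSeries.coeff_one, if_neg (by simpa using hn)]
  · refine tendsto_const_nhds.congr' ?_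
    filter_upwards [eventually_ne_atTop 0] with n hn
    rw [PowerSeries.coeff_one, if_neg hn, mul_zero]

/-- The ratio of coefficients is not uniformly bounded when `β < 1`, so dominated convergence fails
as such. Insert `1 = (n - i) / n + i / n`: the first part is dominated by
`natCast_mul_risingCoeff_mono`, and the second averages the null sequence `i * coeff i U`. -/
theorem IsSmall.tendsto_coeff_mul_risingCoeff {β : ℝ} (hβ : 0 < β) {U : PowerSeries ℝ}
    (hU : IsSmall U) :
    Tendsto (fun n => ∑ i ∈ Finset.range (n + 1), PowerSeries.coeff i U *
      risingCoeff β (n - i) / risingCoeff β n) atTop (𝓝 (∑' n, PowerSeries.coeff n U)) := by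
  have hpos := fun n => risingCoeff_pos hβ n
  have hratio : ∀ i : ℕ, Tendsto (fun n : ℕ => ((n - i : ℕ) : ℝ) / n) atTop (𝓝 1) := by
    intro i
    have h1 : Tendsto (fun n : ℕ => 1 - (i : ℝ) / n) atTop (𝓝 (1 - 0)) :=
      tendsto_const_nhds.sub (tendsto_const_div_atTop_nhds_zero_nat _)
    rw [sub_zero] at h1
    refine h1.congr' ?_
    filter_upwards [eventually_ge_atTop i, eventually_gt_atTop 0] with n hn hn0
    rw [Nat.cast_sub hn, sub_div, div_self (by positivity)]
  -- the part weighted by `n - i`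
  have hA : Tendsto (fun n => ∑' i, (if i ∈ Finset.range (n + 1) then PowerSeries.coeff i U *
      ((((n - i : ℕ) : ℝ) * risingCoeff β (n - i)) / (n * risingCoeff β n)) else 0)) atTop
      (𝓝 (∑' n, PowerSeries.coeff n U)) := by
    refine tendsto_tsum_of_dominated_convergence (bound := fun n => PowerSeries.coeff n U)
      hU.summable (fun i => ?_) (Eventually.of_forall fun n i => ?_)
    · have h := ((hratio i).mul (tendsto_risingCoeff_sub_div hβ i)).const_mul
        (PowerSeries.coeff i U)
      rw [mul_one, mul_one] at h
      refine h.congr' ?_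
      filter_upwards [eventually_ge_atTop i] with n hn
      rw [if_pos (by simpa [Nat.lt_succ_iff] using hn), div_mul_div_comm]
    · split_ifs with hi
      · have h0 : 0 ≤ (((n - i : ℕ) : ℝ) * risingCoeff β (n - i)) / (n * risingCoeff β n) :=
          div_nonneg (mul_nonneg (by positivity) (hpos _).le)
            (mul_nonneg (by positivity) (hpos _).le)
        rw [Real.norm_of_nonneg (mul_nonneg (hU.nonneg _) h0)]
        refine mul_le_of_le_one_right (hU.nonneg _) (div_le_one_of_le₀ ?_ ?_)
        · exact natCast_mul_risingCoeff_mono hβ (Nat.sub_le _ _)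
        · exact mul_nonneg (by positivity) (hpos _).le
      · rw [norm_zero]; exact hU.nonneg _
  -- the part weighted by `i`
  have hB : Tendsto (fun n => ∑ i ∈ Finset.range (n + 1),
      (risingCoeff β (n - i) / (n * risingCoeff β n)) * ((i : ℝ) * PowerSeries.coeff i U))
      atTop (𝓝 0) := by
    -- The row sum is `risingCoeff (1 + β) n / (n * risingCoeff β n) = 1 / n + 1 / β`.
    refine tendsto_sum_mul_of_tendsto_zero (C := 1 + 1 / β)
      (fun n i => div_nonneg (hpos _).le (mul_nonneg (by positivity) (hpos _).le))
      ?_ (fun i => ?_) hU.tendsto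
    · filter_upwards [eventually_gt_atTop 0] with n hn
      have hn' : (1 : ℝ) ≤ n := by exact_mod_cast hn
      have h1 := sum_risingCoeff_mul 1 β n
      simp only [risingCoeff_one, one_mul] at h1
      rw [← Finset.sum_div, h1, div_le_iff₀ (mul_pos (by linarith) (hpos _))]
      have h2 := mul_risingCoeff_add_one β n
      have h3 : risingCoeff (1 + β) n = (β + n) * risingCoeff β n / β := by
        rw [← h2, add_comm]; field_simp
      rw [h3, div_le_iff₀ hβ]
      have h4 : (1 + 1 / β) * (n * risingCoeff β n) * β = (β * n + n) * risingCoeff β n := by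
        field_simp
      rw [h4]
      exact mul_le_mul_of_nonneg_right (by nlinarith) (hpos _).le
    · have h := (tendsto_risingCoeff_sub_div hβ i).mul
        (tendsto_const_div_atTop_nhds_zero_nat (1 : ℝ))
      rw [mul_zero] at h
      refine h.congr fun n => ?_
      rw [div_mul_div_comm, mul_one, mul_comm (n : ℝ)]
  have hS := hA.add hB
  rw [add_zero] at hS
  refine hS.congr' ?_
  filter_upwards [eventually_gt_atTop 0] with n hn
  have hn' : (n : ℝ) ≠ 0 := by positivity
  rw [tsum_eq_sum (s := Finset.range (n + 1)) fun i hi => if_neg hi, ← Finset.sum_add_distrib]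
  refine Finset.sum_congr rfl fun i hi => ?_
  rw [if_pos hi]
  have hi' : i ≤ n := by simpa [Nat.lt_succ_iff] using hi
  have := (hpos n).ne'
  rw [Nat.cast_sub hi']
  field_simp
  ring

theorem IsSmall.tendsto_coeff_mul_div {β : ℝ} (hβ : 0 < β) {U V : PowerSeries ℝ} {B : ℝ}
    (hU : IsSmall U)
    (hV : Tendsto (fun n => PowerSeries.coeff n V / risingCoeff β n) atTop (𝓝 B)) :
    Tendsto (fun n => PowerSeries.coeff n (U * V) / risingCoeff β n) atTop
      (𝓝 ((∑' n, PowerSeries.coeff n U) * B)) := by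
  have hpos := fun n => risingCoeff_pos hβ n
  have h1 := hU.tendsto_coeff_mul_risingCoeff hβ
  obtain ⟨C, hC⟩ := h1.bddAbove_range
  set y := fun n => PowerSeries.coeff n V / risingCoeff β n
  have hy0 : Tendsto (fun n => y n - B) atTop (𝓝 0) := by simpa using hV.sub_const B
  have h2 : Tendsto (fun n => ∑ i ∈ Finset.range (n + 1),
      (risingCoeff β i * PowerSeries.coeff (n - i) U / risingCoeff β n) * (y i - B))
      atTop (𝓝 0) := by
    refine tendsto_sum_mul_of_tendsto_zero (C := C)
      (fun n i => div_nonneg (mul_nonneg (hpos _).le (hU.nonneg _)) (hpos _).le)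
      (Eventually.of_forall fun n => ?_) (fun i => ?_) hy0
    · refine le_trans (le_of_eq ?_) (hC ⟨n, rfl⟩)
      rw [← Finset.sum_range_reflect]
      refine Finset.sum_congr rfl fun i hi => ?_
      have hi' : i ≤ n := by simpa [Nat.lt_succ_iff] using hi
      have e1 : n + 1 - 1 - i = n - i := by omega
      have e2 : n - (n - i) = i := by omega
      rw [e1, e2, mul_comm (risingCoeff β _)]
    -- The size `o(1/n)` of `U` is essential here: dividing by `risingCoeff β n` can cost a factor
    -- of order `n`, because only `n * risingCoeff β n ≥ β` is available.
    · have h3 : Tendsto (fun n : ℕ => ((n - i : ℕ) : ℝ) * PowerSeries.coeff (n - i) U +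
          i * PowerSeries.coeff (n - i) U) atTop (𝓝 (0 + i * 0)) :=
        (hU.tendsto.comp (tendsto_sub_atTop_nat i)).add
          ((hU.summable.tendsto_atTop_zero.comp (tendsto_sub_atTop_nat i)).const_mul _)
      have h4 := (h3.mul_const (risingCoeff β i)).mul_const β⁻¹
      simp only [mul_zero, add_zero, zero_mul] at h4
      refine squeeze_zero' (Eventually.of_forall fun n =>
        div_nonneg (mul_nonneg (hpos _).le (hU.nonneg _)) (hpos _).le) ?_ h4
      filter_upwards [eventually_ge_atTop i, eventually_gt_atTop 0] with n hn hn0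
      rw [Nat.cast_sub hn, div_le_iff₀ (hpos _)]
      have h5 := le_natCast_mul_risingCoeff hβ hn0.ne'
      have h6 : 1 ≤ β⁻¹ * (n * risingCoeff β n) := by
        rw [inv_mul_eq_div, one_le_div hβ]; exact h5
      have h7 := mul_nonneg (hpos i).le (hU.nonneg (n - i))
      calc _ ≤ risingCoeff β i * PowerSeries.coeff (n - i) U * (β⁻¹ * (n * risingCoeff β n)) :=
            le_mul_of_one_le_right h7 h6
        _ = _ := by ring
  have h3 := (h1.mul_const B).add h2
  rw [add_zero] at h3
  refine h3.congr fun n => ?_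
  rw [coeff_mul_range, ← Finset.sum_range_reflect (fun i => risingCoeff β i *
    PowerSeries.coeff (n - i) U / risingCoeff β n * (y i - B)), Finset.sum_mul,
    ← Finset.sum_add_distrib, Finset.sum_div]
  refine Finset.sum_congr rfl fun i hi => ?_
  have hi' : i ≤ n := by simpa [Nat.lt_succ_iff] using hi
  have e1 : n + 1 - 1 - i = n - i := by omega
  have e2 : n - (n - i) = i := by omega
  have hV' : PowerSeries.coeff (n - i) V = y (n - i) * risingCoeff β (n - i) := by
    simp [y, (hpos (n - i)).ne']
  rw [e1, e2, hV']
  ring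


/-! ### Lagrange inversion -/

theorem coeff_X_mul_pow_of_lt {B : PowerSeries ℝ} {n k : ℕ} (h : n < k) :
    PowerSeries.coeff n ((PowerSeries.X * B) ^ k) = 0 := by
  rw [mul_pow]
  exact PowerSeries.X_pow_dvd_iff.1 (Dvd.intro _ rfl) n h

/-- With `T = X * B` the hypothesis reads `B = f(T)`, as a finite sum because `T ^ s` starts in
degree `s`. The conclusion is the coefficient of `T ^ (k + 1) = X f(T) T ^ k`. -/
theorem coeff_succ_X_mul_pow_succ {B f : PowerSeries ℝ}
    (h : ∀ n, PowerSeries.coeff n B = ∑ s ∈ Finset.range (n + 1),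
      PowerSeries.coeff s f * PowerSeries.coeff n ((PowerSeries.X * B) ^ s)) (n k : ℕ) :
    PowerSeries.coeff (n + 1) ((PowerSeries.X * B) ^ (k + 1)) =
      ∑ s ∈ Finset.range (n + 1),
        PowerSeries.coeff s f * PowerSeries.coeff n ((PowerSeries.X * B) ^ (k + s)) := by
  have h' : ∀ i ≤ n, PowerSeries.coeff i B = ∑ s ∈ Finset.range (n + 1),
      PowerSeries.coeff s f * PowerSeries.coeff i ((PowerSeries.X * B) ^ s) := by
    intro i hi
    rw [h i]
    refine Finset.sum_subset (Finset.range_subset_range.2 (by omega)) fun s _ hs => ?_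
    rw [coeff_X_mul_pow_of_lt (by simpa using hs), mul_zero]
  rw [pow_succ', mul_assoc, PowerSeries.coeff_succ_X_mul, PowerSeries.coeff_mul]
  have : ∀ p ∈ Finset.HasAntidiagonal.antidiagonal n, PowerSeries.coeff p.1 B *
      PowerSeries.coeff p.2 ((PowerSeries.X * B) ^ k) = ∑ s ∈ Finset.range (n + 1),
        PowerSeries.coeff s f * (PowerSeries.coeff p.1 ((PowerSeries.X * B) ^ s) *
          PowerSeries.coeff p.2 ((PowerSeries.X * B) ^ k)) := by
    intro p hp
    rw [h' p.1 (Finset.HasAntidiagonal.antidiagonal.fst_le hp), Finset.sum_mul]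
    simp only [mul_assoc]
  rw [Finset.sum_congr rfl this, Finset.sum_comm]
  refine Finset.sum_congr rfl fun s _ => ?_
  rw [← Finset.mul_sum, ← PowerSeries.coeff_mul, ← pow_add, add_comm s k]

/-- Induction on `n`. Expanding `T ^ (k + 1) = X f(T) T ^ k` and using the induction hypothesis
gives the sum of `(k + s) f_s [w ^ (n - k - s)] f ^ n` over `s`. This equals `k [w ^ (n - k)] f ^ (n
+ 1) + [w ^ (n - k)] (w f' f ^ n)`, and `(n + 1) w f' f ^ n = w (f ^ (n + 1))'`. -/
theorem lagrange_inversion {B f : PowerSeries ℝ}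
    (h : ∀ n, PowerSeries.coeff n B = ∑ s ∈ Finset.range (n + 1),
      PowerSeries.coeff s f * PowerSeries.coeff n ((PowerSeries.X * B) ^ s)) (n k : ℕ) :
    (n : ℝ) * PowerSeries.coeff n ((PowerSeries.X * B) ^ k) =
      k * (if k ≤ n then PowerSeries.coeff (n - k) (f ^ n) else 0) := by
  induction n generalizing k with
  | zero => cases k <;> simp
  | succ n ih =>
    cases k with
    | zero => simp [PowerSeries.coeff_one]
    | succ k =>
      rcases lt_or_ge n k with hkn | hkn
      · rw [coeff_X_mul_pow_of_lt (by omega), if_neg (by omega), mul_zero, mul_zero]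
      rw [coeff_succ_X_mul_pow_succ h, if_pos (by omega), Nat.add_sub_add_right]
      rcases Nat.eq_zero_or_pos n with rfl | hn
      · have : k = 0 := by omega
        subst this
        simp
      -- The induction hypothesis only knows `n` times each coefficient, so the identity is proved
      -- after multiplication by `n`; this is why `n = 0` was treated apart.
      have hn' : (n : ℝ) ≠ 0 := by positivity
      apply mul_left_cancel₀ hn'
      have e1 : (n : ℝ) * ∑ s ∈ Finset.range (n + 1),
          PowerSeries.coeff s f * PowerSeries.coeff n ((PowerSeries.X * B) ^ (k + s)) =
          ∑ s ∈ Finset.range (n - k + 1), ((k : ℝ) + s) * (PowerSeries.coeff s f *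
            PowerSeries.coeff (n - k - s) (f ^ n)) := by
        rw [Finset.mul_sum]
        symm
        have hsub : Finset.range (n - k + 1) ⊆ Finset.range (n + 1) :=
          Finset.range_subset_range.2 (by omega)
        rw [← Finset.sum_subset hsub]
        · refine Finset.sum_congr rfl fun s hs => ?_
          have hs' : k + s ≤ n := by have := Finset.mem_range.1 hs; omega
          rw [mul_left_comm (n : ℝ), ih, if_pos hs', Nat.sub_sub]
          push_cast; ring
        · intro s _ hs
          have hs' : ¬ k + s ≤ n := by
            intro h; exact hs (Finset.mem_range.2 (by omega))
          rw [mul_left_comm (n : ℝ), ih, if_neg hs', mul_zero, mul_zero]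
      have e2 : ∑ s ∈ Finset.range (n - k + 1), ((k : ℝ) + s) * (PowerSeries.coeff s f *
          PowerSeries.coeff (n - k - s) (f ^ n)) = k * PowerSeries.coeff (n - k) (f ^ (n + 1)) +
          PowerSeries.coeff (n - k) (PowerSeries.X * PowerSeries.derivative ℝ f * f ^ n) := by
        rw [pow_succ', coeff_mul_range, coeff_mul_range, Finset.mul_sum,
          ← Finset.sum_add_distrib]
        refine Finset.sum_congr rfl fun s _ => ?_
        have : PowerSeries.coeff s (PowerSeries.X * PowerSeries.derivative ℝ f) =
            s * PowerSeries.coeff s f := by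
          cases s with
          | zero => simp
          | succ s =>
            rw [PowerSeries.coeff_succ_X_mul, PowerSeries.coeff_derivative]
            push_cast; ring
        rw [this]; ring
      have e3 : ((n : ℝ) + 1) *
          PowerSeries.coeff (n - k) (PowerSeries.X * PowerSeries.derivative ℝ f * f ^ n) =
          ((n : ℝ) - k) * PowerSeries.coeff (n - k) (f ^ (n + 1)) := by
        have hd : PowerSeries.C ((n : ℝ) + 1) * (PowerSeries.X * PowerSeries.derivative ℝ f * f ^ n)
            = PowerSeries.X * PowerSeries.derivative ℝ (f ^ (n + 1)) := by
          rw [Derivation.leibniz_pow, Nat.add_sub_cancel, nsmul_eq_mul, smul_eq_mul]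
          simp only [map_add, map_natCast, map_one]
          push_cast; ring
        rw [← PowerSeries.coeff_C_mul, hd, ← Nat.cast_sub hkn]
        cases n - k with
        | zero => simp
        | succ j =>
          rw [PowerSeries.coeff_succ_X_mul, PowerSeries.coeff_derivative]
          push_cast; ring
      rw [mul_left_comm, e1, e2, mul_add]
      push_cast
      rw [e3]; ring


/-! ### A local limit theorem -/

/-- The claims share one induction: the Cauchy product at a point of the unit circle needs the
summability of the previous power. -/
theorem hasSum_coeff_mk_pow {q : ℕ → ℝ} (h0 : ∀ t, 0 ≤ q t) (hq : Summable q) (L : ℕ) :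
    (∀ n, 0 ≤ PowerSeries.coeff n (PowerSeries.mk q ^ L)) ∧
    (Summable fun n => PowerSeries.coeff n (PowerSeries.mk q ^ L)) ∧
    ∀ z : ℂ, ‖z‖ = 1 → HasSum (fun n => ((PowerSeries.coeff n (PowerSeries.mk q ^ L) : ℝ) : ℂ) * z ^ n)
      ((∑' t, (q t : ℂ) * z ^ t) ^ L) := by
  induction L with
  | zero =>
    refine ⟨isSmall_one.nonneg, isSmall_one.summable, fun z _ => ?_⟩
    rw [pow_zero, pow_zero]
    convert! hasSum_single (f := fun n => ((PowerSeries.coeff n (1 : PowerSeries ℝ) : ℝ) : ℂ) * z ^ n)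
      0 fun n hn => ?_
    · simp
    · simp [PowerSeries.coeff_one, hn]
  | succ L ih =>
    obtain ⟨h1, h2, h3⟩ := ih
    refine ⟨fun n => ?_, ?_, fun z hz => ?_⟩
    · rw [pow_succ, PowerSeries.coeff_mul]
      exact Finset.sum_nonneg fun p _ => mul_nonneg (h1 _) (by simpa using h0 _)
    · have h := (summable_norm_sum_mul_antidiagonal_of_summable_norm h2.norm hq.norm).of_norm
      exact h.congr fun n => by simp [pow_succ, PowerSeries.coeff_mul]
    · have n1 : Summable fun n =>
          ‖((PowerSeries.coeff n (PowerSeries.mk q ^ L) : ℝ) : ℂ) * z ^ n‖ := by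
        simpa [hz] using h2.norm
      have n2 : Summable fun n => ‖(q n : ℂ) * z ^ n‖ := by simpa [hz] using hq.norm
      have h := hasSum_sum_range_mul_of_summable_norm n1 n2
      rw [(h3 z hz).tsum_eq, ← pow_succ] at h
      convert! h using 2 with n
      rw [pow_succ, coeff_mul_range]
      push_cast
      rw [Finset.sum_mul]
      refine Finset.sum_congr rfl fun i hi => ?_
      have hi' : i ≤ n := by simpa [Nat.lt_succ_iff] using hi
      rw [PowerSeries.coeff_mk, ← Nat.add_sub_cancel' hi', pow_add]
      simp only [Nat.add_sub_cancel_left]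
      ring

/-- The characteristic function of the distribution `q`. -/
def charSum (q : ℕ → ℝ) (θ : ℝ) : ℂ := ∑' t, (q t : ℂ) * Complex.exp (θ * Complex.I) ^ t

theorem continuous_charSum {q : ℕ → ℝ} (hq : Summable q) : Continuous (charSum q) := by
  refine continuous_tsum (u := fun t => ‖q t‖) (fun t => by fun_prop) hq.norm fun t θ => ?_
  simp [Complex.norm_exp_ofReal_mul_I]

theorem integral_exp_int (j : ℤ) :
    ∫ θ in -Real.pi..Real.pi, Complex.exp (j * Complex.I * θ) =
      if j = 0 then 2 * (Real.pi : ℂ) else 0 := by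
  split_ifs with h
  · subst h; simp; ring
  · have hj : (j : ℂ) * Complex.I ≠ 0 := mul_ne_zero (by exact_mod_cast h) Complex.I_ne_zero
    rw [integral_exp_mul_complex hj, div_eq_zero_iff]
    left
    rw [sub_eq_zero, Complex.exp_eq_exp_iff_exists_int]
    exact ⟨j, by push_cast; ring⟩

/-- Fourier inversion: expand the power, integrate term by term, and only the term `n = M` survives
by orthogonality. -/
theorem integral_charSum_pow {q : ℕ → ℝ} (h0 : ∀ t, 0 ≤ q t) (hq : Summable q) (L M : ℕ) :
    ∫ θ in -Real.pi..Real.pi, charSum q θ ^ L * Complex.exp (-(M * θ * Complex.I)) =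
      2 * Real.pi * ((PowerSeries.coeff M (PowerSeries.mk q ^ L) : ℝ) : ℂ) := by
  obtain ⟨h1, h2, h3⟩ := hasSum_coeff_mk_pow h0 hq L
  have h := intervalIntegral.hasSum_integral_of_dominated_convergence
    (μ := MeasureTheory.volume) (a := -Real.pi) (b := Real.pi)
    (F := fun (n : ℕ) (θ : ℝ) => ((PowerSeries.coeff n (PowerSeries.mk q ^ L) : ℝ) : ℂ) *
      Complex.exp (θ * Complex.I) ^ n * Complex.exp (-(M * θ * Complex.I)))
    (f := fun θ => charSum q θ ^ L * Complex.exp (-(M * θ * Complex.I)))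
    (bound := fun n _ => PowerSeries.coeff n (PowerSeries.mk q ^ L))
    (fun n => by
      refine Continuous.aestronglyMeasurable ?_
      fun_prop)
    (fun n => Eventually.of_forall fun θ _ => by
      have e : Complex.exp (-(M * θ * Complex.I)) =
        Complex.exp (((-(M * θ) : ℝ) : ℂ) * Complex.I) := by push_cast; ring_nf
      rw [e, norm_mul, norm_mul, norm_pow, Complex.norm_exp_ofReal_mul_I,
        Complex.norm_exp_ofReal_mul_I, one_pow, mul_one, mul_one, Complex.norm_real,
        Real.norm_of_nonneg (h1 n)])
    (Eventually.of_forall fun θ _ => h2)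
    (by simp)
    (Eventually.of_forall fun θ _ =>
      (h3 _ (Complex.norm_exp_ofReal_mul_I θ)).mul_right _)
  rw [← h.tsum_eq, tsum_eq_single M]
  · have e : ∀ θ : ℝ, ((PowerSeries.coeff M (PowerSeries.mk q ^ L) : ℝ) : ℂ) *
        Complex.exp (θ * Complex.I) ^ M * Complex.exp (-(M * θ * Complex.I)) =
        ((PowerSeries.coeff M (PowerSeries.mk q ^ L) : ℝ) : ℂ) := by
      intro θ
      rw [← Complex.exp_nat_mul, mul_assoc, ← Complex.exp_add]
      simp [mul_assoc]
    simp only [e, intervalIntegral.integral_const, sub_neg_eq_add, Complex.real_smul]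
    push_cast; ring
  · intro n hn
    have e : ∀ θ : ℝ, ((PowerSeries.coeff n (PowerSeries.mk q ^ L) : ℝ) : ℂ) *
        Complex.exp (θ * Complex.I) ^ n * Complex.exp (-(M * θ * Complex.I)) =
        ((PowerSeries.coeff n (PowerSeries.mk q ^ L) : ℝ) : ℂ) *
          Complex.exp ((((n : ℤ) - (M : ℤ) : ℤ) : ℂ) * Complex.I * θ) := by
      intro θ
      rw [← Complex.exp_nat_mul, mul_assoc, ← Complex.exp_add]
      congr 2
      push_cast; ring
    simp only [e]
    rw [intervalIntegral.integral_const_mul, integral_exp_int, if_neg (by omega), mul_zero]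

/-- A probability distribution `q` on `ℕ` with mean `1 / d` and positive variance `v`, whose support
contains `0` and generates `ℤ`. -/
structure IsLatticeLaw (q : ℕ → ℝ) (d : ℕ) (v : ℝ) : Prop where
  nonneg : ∀ t, 0 ≤ q t
  hasSum : HasSum q 1
  zero_pos : 0 < q 0
  d_pos : 0 < d
  mean : HasSum (fun t : ℕ => q t * ((t : ℝ) - 1 / d)) 0
  var : HasSum (fun t : ℕ => q t * ((t : ℝ) - 1 / d) ^ 2) v
  var_pos : 0 < v
  bezout : ∃ (s : Finset ℕ) (a : ℕ → ℤ), ∑ t ∈ s, a t * (t : ℤ) = 1 ∧ ∀ t ∈ s, 0 < q t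

namespace IsLatticeLaw

variable {q : ℕ → ℝ} {d : ℕ} {v : ℝ}

/-- Split off the atom at `0` as `q 0 + w`, with `‖w‖ ≤ 1 - q 0`. In `q 0 ^ 2 + 2 * q 0 * w.re + ‖w‖
^ 2` a deficit of the real part becomes a deficit of the modulus. Without such an atom a phase could
make the modulus equal to `1` away from `θ = 0`. -/
theorem norm_sq_charSum_le (h : IsLatticeLaw q d v) (θ : ℝ) :
    ‖charSum q θ‖ ^ 2 ≤ 1 - 2 * q 0 * ∑' t : ℕ, q t * (1 - Real.cos (t * θ)) := by
  set z := Complex.exp (θ * Complex.I) with hz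
  have hzn : ‖z‖ = 1 := Complex.norm_exp_ofReal_mul_I θ
  have hzre : ∀ t : ℕ, (z ^ t).re = Real.cos (t * θ) := by
    intro t
    rw [hz, ← Complex.exp_nat_mul, ← mul_assoc]
    have : (t : ℂ) * θ = ((t * θ : ℝ) : ℂ) := by push_cast; ring
    rw [this, Complex.exp_ofReal_mul_I_re]
  have hs : Summable fun t : ℕ => (q t : ℂ) * z ^ t :=
    Summable.of_norm (by simpa [hzn] using h.hasSum.summable.norm)
  have hcos : Summable fun t : ℕ => q t * (1 - Real.cos (t * θ)) := by
    refine Summable.of_nonneg_of_le (fun t => mul_nonneg (h.nonneg t) ?_) (fun t => ?_)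
      (h.hasSum.summable.mul_right 2)
    · linarith [Real.cos_le_one (t * θ)]
    · exact mul_le_mul_of_nonneg_left (by linarith [Real.neg_one_le_cos (t * θ)]) (h.nonneg t)
  have hre : (charSum q θ).re = 1 - ∑' t : ℕ, q t * (1 - Real.cos (t * θ)) := by
    have h1 := (Complex.hasSum_re hs.hasSum).add hcos.hasSum
    have h2 : (fun t : ℕ => ((q t : ℂ) * z ^ t).re + q t * (1 - Real.cos (t * θ))) = q := by
      funext t
      rw [Complex.re_ofReal_mul, hzre]; ring
    rw [h2] at h1
    rw [charSum]
    linarith [h1.unique h.hasSum]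
  have hw : charSum q θ = q 0 + ∑' t : ℕ, (q (t + 1) : ℂ) * z ^ (t + 1) := by
    rw [charSum, hs.tsum_eq_zero_add]; simp
  set w := ∑' t : ℕ, (q (t + 1) : ℂ) * z ^ (t + 1) with hwdef
  have hq1 : ∑' t : ℕ, q (t + 1) = 1 - q 0 := by
    have := h.hasSum.summable.tsum_eq_zero_add
    rw [h.hasSum.tsum_eq] at this; linarith
  have hwn : ‖w‖ ≤ 1 - q 0 := by
    rw [← hq1]
    refine (norm_tsum_le_tsum_norm ?_).trans (le_of_eq (tsum_congr fun t => ?_))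
    · simpa [hzn] using ((summable_nat_add_iff 1).2 h.hasSum.summable).norm
    · rw [norm_mul, norm_pow, hzn, one_pow, mul_one, Complex.norm_real,
        Real.norm_of_nonneg (h.nonneg _)]
  have hwre : w.re = 1 - q 0 - ∑' t : ℕ, q t * (1 - Real.cos (t * θ)) := by
    have := congrArg Complex.re hw
    rw [hre, Complex.add_re, Complex.ofReal_re] at this
    linarith
  have h3 : ‖charSum q θ‖ ^ 2 = q 0 ^ 2 + 2 * q 0 * w.re + ‖w‖ ^ 2 := by
    rw [hw, ← Complex.normSq_eq_norm_sq, ← Complex.normSq_eq_norm_sq, Complex.normSq_apply,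
      Complex.normSq_apply]
    simp; ring
  have h4 : ‖w‖ ^ 2 ≤ (1 - q 0) ^ 2 := pow_le_pow_left₀ (norm_nonneg _) hwn 2
  rw [h3, hwre]
  nlinarith

theorem abs_sin_add_le (x y : ℝ) : |Real.sin (x + y)| ≤ |Real.sin x| + |Real.sin y| := by
  rw [Real.sin_add]
  refine (abs_add_le _ _).trans (add_le_add ?_ ?_) <;> rw [abs_mul]
  · exact mul_le_of_le_one_right (abs_nonneg _) (Real.abs_cos_le_one y)
  · exact mul_le_of_le_one_left (abs_nonneg _) (Real.abs_cos_le_one x)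

theorem abs_sin_natCast_mul_le (n : ℕ) (x : ℝ) : |Real.sin (n * x)| ≤ n * |Real.sin x| := by
  induction n with
  | zero => simp
  | succ n ih =>
    push_cast
    rw [add_mul, add_mul, one_mul, one_mul]
    exact (abs_sin_add_le _ _).trans (by linarith)

theorem abs_sin_intCast_mul_le (a : ℤ) (x : ℝ) : |Real.sin (a * x)| ≤ |(a : ℝ)| * |Real.sin x| := by
  obtain ⟨n, rfl | rfl⟩ := a.eq_nat_or_neg
  · simpa using abs_sin_natCast_mul_le n x
  · simpa using abs_sin_natCast_mul_le n x

theorem abs_sin_sum_le {s : Finset ℕ} (f : ℕ → ℝ) :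
    |Real.sin (∑ t ∈ s, f t)| ≤ ∑ t ∈ s, |Real.sin (f t)| := by
  induction s using Finset.induction_on with
  | empty => simp
  | insert a s ha ih =>
    rw [Finset.sum_insert ha, Finset.sum_insert ha]
    exact (abs_sin_add_le _ _).trans (by linarith)

/-- Aperiodicity made quantitative. By Bézout `θ / 2 = ∑ a t * (t * (θ / 2))`, so `|sin (θ / 2)| ≤ ∑
|a t| |sin (t * (θ / 2))|`. Cauchy–Schwarz with the weights `q t` compares this with the sum of `1 -
cos = 2 sin ^ 2` terms, and Jordan's inequality bounds the left side from below. -/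
theorem exists_le_tsum_cos (h : IsLatticeLaw q d v) : ∃ c : ℝ, 0 < c ∧ ∀ θ : ℝ,
    |θ| ≤ Real.pi → c * θ ^ 2 ≤ ∑' t : ℕ, q t * (1 - Real.cos (t * θ)) := by
  obtain ⟨s, a, hsum, hs⟩ := h.bezout
  set A : ℝ := ∑ t ∈ s, (a t : ℝ) ^ 2 / q t with hA
  have hA0 : 0 ≤ A := Finset.sum_nonneg fun t ht => div_nonneg (sq_nonneg _) (hs t ht).le
  have hpi := Real.pi_pos
  refine ⟨2 / (Real.pi ^ 2 * (A + 1)), by positivity, fun θ hθ => ?_⟩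
  have hcos : Summable fun t : ℕ => q t * (1 - Real.cos (t * θ)) := by
    refine Summable.of_nonneg_of_le (fun t => mul_nonneg (h.nonneg t) ?_) (fun t => ?_)
      (h.hasSum.summable.mul_right 2)
    · linarith [Real.cos_le_one (t * θ)]
    · exact mul_le_mul_of_nonneg_left (by linarith [Real.neg_one_le_cos (t * θ)]) (h.nonneg t)
  have h1 : ∑ t ∈ s, q t * (1 - Real.cos (t * θ)) ≤ ∑' t : ℕ, q t * (1 - Real.cos (t * θ)) :=
    hcos.sum_le_tsum s fun t _ => mul_nonneg (h.nonneg t)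
      (by linarith [Real.cos_le_one (t * θ)])
  refine le_trans ?_ h1
  have h2 : ∀ t : ℕ, 1 - Real.cos (t * θ) = 2 * |Real.sin (t * (θ / 2))| ^ 2 := by
    intro t
    have : (t : ℝ) * θ = 2 * (t * (θ / 2)) := by ring
    rw [this, Real.cos_two_mul, sq_abs]
    have := Real.sin_sq_add_cos_sq ((t : ℝ) * (θ / 2))
    linarith
  have h3 : |Real.sin (θ / 2)| ≤ ∑ t ∈ s, |(a t : ℝ)| * |Real.sin (t * (θ / 2))| := by
    have : θ / 2 = ∑ t ∈ s, (a t : ℝ) * (t * (θ / 2)) := by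
      have h4 : (∑ t ∈ s, (a t : ℝ) * (t : ℝ)) = 1 := by exact_mod_cast hsum
      simp only [← mul_assoc]
      rw [← Finset.sum_mul, h4, one_mul]
    conv_lhs => rw [this]
    exact (abs_sin_sum_le _).trans (Finset.sum_le_sum fun t _ => abs_sin_intCast_mul_le _ _)
  have h4 : 2 / Real.pi * |θ / 2| ≤ |Real.sin (θ / 2)| := by
    apply Real.mul_abs_le_abs_sin
    rw [abs_div, abs_two]; linarith
  have h5 : (∑ t ∈ s, |(a t : ℝ)| * |Real.sin (t * (θ / 2))|) ^ 2 ≤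
      A * ∑ t ∈ s, q t * |Real.sin (t * (θ / 2))| ^ 2 := by
    have := Finset.sum_sq_le_sum_mul_sum_of_sq_le_mul s
      (r := fun t => |(a t : ℝ)| * |Real.sin (t * (θ / 2))|)
      (f := fun t => (a t : ℝ) ^ 2 / q t) (g := fun t => q t * |Real.sin (t * (θ / 2))| ^ 2)
      (fun t ht => div_nonneg (sq_nonneg _) (hs t ht).le)
      (fun t ht => mul_nonneg (hs t ht).le (sq_nonneg _))
      (fun t ht => le_of_eq (by
        have := (hs t ht).ne'
        rw [mul_pow, sq_abs (a t : ℝ)]; field_simp))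
    exact this
  have h6 : (2 / Real.pi * |θ / 2|) ^ 2 = θ ^ 2 / Real.pi ^ 2 := by
    rw [abs_div, abs_two, mul_pow, div_pow, div_pow, sq_abs]; field_simp
  have h7 : θ ^ 2 / Real.pi ^ 2 ≤ A * ∑ t ∈ s, q t * |Real.sin (t * (θ / 2))| ^ 2 := by
    rw [← h6]
    exact (pow_le_pow_left₀ (by positivity) (h4.trans h3) 2).trans h5
  have h8 : 0 ≤ ∑ t ∈ s, q t * |Real.sin (t * (θ / 2))| ^ 2 :=
    Finset.sum_nonneg fun t _ => mul_nonneg (h.nonneg t) (sq_nonneg _)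
  have h9 : ∑ t ∈ s, q t * (1 - Real.cos (t * θ)) =
      2 * ∑ t ∈ s, q t * |Real.sin (t * (θ / 2))| ^ 2 := by
    rw [Finset.mul_sum]
    exact Finset.sum_congr rfl fun t _ => by rw [h2]; ring
  rw [h9]
  have h10 : 2 / (Real.pi ^ 2 * (A + 1)) * θ ^ 2 = 2 * ((θ ^ 2 / Real.pi ^ 2) / (A + 1)) := by
    field_simp
  rw [h10]
  refine mul_le_mul_of_nonneg_left ?_ zero_le_two
  rw [div_le_iff₀ (by positivity)]
  nlinarith

/-- One Gaussian bound on the whole period, so that the local limit theorem needs no separate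
estimate away from `0`. -/
theorem exists_norm_charSum_le (h : IsLatticeLaw q d v) : ∃ c : ℝ, 0 < c ∧ ∀ θ : ℝ,
    |θ| ≤ Real.pi → ‖charSum q θ‖ ≤ Real.exp (-c * θ ^ 2) := by
  obtain ⟨c, hc, hle⟩ := h.exists_le_tsum_cos
  refine ⟨q 0 * c, mul_pos h.zero_pos hc, fun θ hθ => ?_⟩
  have h1 := h.norm_sq_charSum_le θ
  have h2 := mul_le_mul_of_nonneg_left (hle θ hθ) h.zero_pos.le
  have h3 := Real.add_one_le_exp (-(2 * (q 0 * c * θ ^ 2)))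
  have h4 : Real.exp (-(2 * (q 0 * c * θ ^ 2))) = Real.exp (-(q 0 * c) * θ ^ 2) ^ 2 := by
    rw [← Real.exp_nat_mul]; push_cast; ring_nf
  refine le_of_sq_le_sq ?_ (Real.exp_pos _).le
  rw [← h4]
  linarith

end IsLatticeLaw


/-! ### Taylor estimates and the Gaussian limit -/

/-- Taylor's bound for `|y| ≤ 1`, and `2 * |y| ≤ 2 * y ^ 2` beyond. Being valid for all `y`, it lets
the second moment alone dominate. -/
theorem norm_exp_I_mul_sub_le (y : ℝ) :
    ‖Complex.exp (Complex.I * y) - 1 - Complex.I * y‖ ≤ 2 * y ^ 2 := by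
  have hn : ‖Complex.I * (y : ℂ)‖ = |y| := by simp
  rcases le_total |y| 1 with h | h
  · have := Complex.norm_exp_sub_one_sub_id_le (x := Complex.I * y) (by rw [hn]; exact h)
    rw [hn, sq_abs] at this
    nlinarith [sq_nonneg y]
  · have h1 := norm_sub_le (Complex.exp (Complex.I * y) - 1) (Complex.I * y)
    have h2 := Real.norm_exp_I_mul_ofReal_sub_one_le (x := y)
    rw [Real.norm_eq_abs] at h2
    rw [hn] at h1
    nlinarith [sq_abs y]

theorem tendsto_natCast_mul_exp_sub (y : ℝ) :
    Tendsto (fun M : ℕ => (M : ℂ) * (Complex.exp (Complex.I * ((y / √M : ℝ) : ℂ)) - 1 -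
      Complex.I * ((y / √M : ℝ) : ℂ))) atTop (𝓝 (-(y ^ 2 / 2 : ℝ))) := by
  have hs : Tendsto (fun M : ℕ => √(M : ℝ)) atTop atTop :=
    Real.tendsto_sqrt_atTop.comp tendsto_natCast_atTop_atTop
  have h0 : Tendsto (fun M : ℕ => |y| / √M) atTop (𝓝 0) := tendsto_const_nhds.div_atTop hs
  have h1 : Tendsto (fun M : ℕ => y ^ 2 * ((|y| / √M) * Real.exp (|y| / √M))) atTop (𝓝 0) := by
    have := (h0.mul (Real.continuous_exp.tendsto 0 |>.comp h0)).const_mul (y ^ 2)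
    simpa using this
  rw [tendsto_iff_norm_sub_tendsto_zero]
  refine squeeze_zero' (Eventually.of_forall fun _ => norm_nonneg _) ?_ h1
  filter_upwards [eventually_gt_atTop 0] with M hM
  have hM' : (0 : ℝ) < M := by exact_mod_cast hM
  have hsq : (√(M : ℝ)) ^ 2 = M := Real.sq_sqrt hM'.le
  have hs0 : 0 < √(M : ℝ) := Real.sqrt_pos.2 hM'
  set x : ℂ := Complex.I * ((y / √M : ℝ) : ℂ) with hx
  have hxn : ‖x‖ = |y| / √M := by
    rw [hx, norm_mul, Complex.norm_I, one_mul, Complex.norm_real, Real.norm_eq_abs, abs_div,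
      abs_of_pos hs0]
  have hx2 : (M : ℂ) * (x ^ 2 / 2) = (-(y ^ 2 / 2 : ℝ) : ℂ) := by
    rw [hx, mul_pow, Complex.I_sq]
    have : (M : ℝ) * (-1 * (y / √M) ^ 2 / 2) = -(y ^ 2 / 2) := by
      rw [div_pow, hsq]; field_simp
    exact_mod_cast this
  have hb := Complex.norm_exp_sub_sum_le_norm_mul_exp x 3
  simp only [Finset.sum_range_succ, Finset.sum_range_zero, pow_zero, pow_one, Nat.factorial] at hb
  rw [← hx2, ← mul_sub, norm_mul, Complex.norm_natCast]
  have he : Complex.exp x - 1 - x - x ^ 2 / 2 = Complex.exp x - (0 + 1 / ((1 : ℕ) : ℂ) +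
      x / (((0 + 1) * 1 : ℕ) : ℂ) + x ^ 2 / (((1 + 1) * ((0 + 1) * 1) : ℕ) : ℂ)) := by
    push_cast; ring
  rw [he]
  refine (mul_le_mul_of_nonneg_left hb hM'.le).trans (le_of_eq ?_)
  rw [hxn]
  have : (M : ℝ) * (|y| / √M) ^ 3 = y ^ 2 * (|y| / √M) := by
    rw [pow_succ, div_pow, hsq, sq_abs]; field_simp
  rw [← mul_assoc, this, mul_assoc]

namespace IsLatticeLaw

variable {q : ℕ → ℝ} {d : ℕ} {v : ℝ}

/-- Total mass `1` and mean `1 / d` allow the constant and linear Taylor terms to be subtracted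
inside the sum. -/
theorem charSum_mul_exp_sub_one (h : IsLatticeLaw q d v) (θ : ℝ) :
    charSum q θ * Complex.exp (-(θ / d * Complex.I)) - 1 =
      ∑' t : ℕ, (q t : ℂ) * (Complex.exp (Complex.I * ((((t : ℝ) - 1 / d) * θ : ℝ) : ℂ)) - 1 -
        Complex.I * ((((t : ℝ) - 1 / d) * θ : ℝ) : ℂ)) := by
  have hs : HasSum (fun t : ℕ => (q t : ℂ) * Complex.exp (θ * Complex.I) ^ t) (charSum q θ) :=
    (Summable.of_norm
      (by simpa [Complex.norm_exp_ofReal_mul_I] using h.hasSum.summable.norm)).hasSum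
  have h1 := hs.mul_right (Complex.exp (-(θ / d * Complex.I)))
  have h2 : HasSum (fun t : ℕ => (q t : ℂ)) 1 := by
    rw [← Complex.ofReal_one]; exact Complex.hasSum_ofReal.2 h.hasSum
  have h3 : HasSum (fun t : ℕ => ((q t * ((t : ℝ) - 1 / d) : ℝ) : ℂ)) ((0 : ℝ) : ℂ) :=
    Complex.hasSum_ofReal.2 h.mean
  have h4 := (h1.sub h2).sub (h3.mul_right (Complex.I * θ))
  rw [Complex.ofReal_zero, zero_mul, sub_zero] at h4
  rw [← h4.tsum_eq]
  refine tsum_congr fun t => ?_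
  rw [← Complex.exp_nat_mul, mul_assoc, ← Complex.exp_add]
  have : (t : ℂ) * (θ * Complex.I) + -(θ / d * Complex.I) =
      Complex.I * ((((t : ℝ) - 1 / d) * θ : ℝ) : ℂ) := by push_cast; ring
  rw [this]
  push_cast; ring

theorem tendsto_natCast_mul_charSum (h : IsLatticeLaw q d v) (u : ℝ) :
    Tendsto (fun M : ℕ => (M : ℂ) * (charSum q (u / √M) *
      Complex.exp (-(((u / √M : ℝ) : ℂ) / d * Complex.I)) - 1)) atTop
      (𝓝 (-(v * u ^ 2 / 2 : ℝ))) := by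
  have h1 : Tendsto (fun M : ℕ => ∑' t : ℕ, (q t : ℂ) * ((M : ℂ) *
      (Complex.exp (Complex.I * (((((t : ℝ) - 1 / d) * u) / √M : ℝ) : ℂ)) - 1 -
        Complex.I * (((((t : ℝ) - 1 / d) * u) / √M : ℝ) : ℂ)))) atTop
      (𝓝 (∑' t : ℕ, (q t : ℂ) * (-((((t : ℝ) - 1 / d) * u) ^ 2 / 2 : ℝ)))) := by
    refine tendsto_tsum_of_dominated_convergence
      (bound := fun t => (q t * ((t : ℝ) - 1 / d) ^ 2) * (2 * u ^ 2))
      (h.var.summable.mul_right _) (fun t => (tendsto_natCast_mul_exp_sub _).const_mul _) ?_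
    filter_upwards [eventually_gt_atTop 0] with M hM t
    have hM' : (0 : ℝ) < M := by exact_mod_cast hM
    rw [norm_mul, norm_mul, Complex.norm_real, Real.norm_of_nonneg (h.nonneg t),
      Complex.norm_natCast, mul_assoc]
    refine mul_le_mul_of_nonneg_left ?_ (h.nonneg t)
    refine (mul_le_mul_of_nonneg_left (norm_exp_I_mul_sub_le _) hM'.le).trans (le_of_eq ?_)
    rw [div_pow, Real.sq_sqrt hM'.le]
    field_simp
  have h2 : ∑' t : ℕ, (q t : ℂ) * (-((((t : ℝ) - 1 / d) * u) ^ 2 / 2 : ℝ)) =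
      (-(v * u ^ 2 / 2 : ℝ) : ℂ) := by
    have := (Complex.hasSum_ofReal.2 h.var).mul_right (-(u ^ 2 / 2) : ℂ)
    have e : (-(v * u ^ 2 / 2 : ℝ) : ℂ) = v * (-(u ^ 2 / 2) : ℂ) := by push_cast; ring
    rw [e, ← this.tsum_eq]
    refine tsum_congr fun t => ?_
    push_cast; ring
  rw [h2] at h1
  refine h1.congr fun M => ?_
  rw [h.charSum_mul_exp_sub_one, ← tsum_mul_left]
  refine tsum_congr fun t => ?_
  rw [mul_left_comm, mul_div_assoc]

/-- The phase, shared among `d * M` of the factors, centers each of them, so they form `((1 + g M) ^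
M) ^ d` with `M * g M` convergent. The one remaining factor tends to `1`. -/
theorem tendsto_charSum_pow (h : IsLatticeLaw q d v) (u : ℝ) :
    Tendsto (fun M : ℕ => charSum q (u / √M) ^ (d * M + 1) *
      Complex.exp (-(M * ((u / √M : ℝ) : ℂ) * Complex.I))) atTop
      (𝓝 (Real.exp (-(d * v / 2) * u ^ 2))) := by
  have hd : (d : ℂ) ≠ 0 := by exact_mod_cast h.d_pos.ne'
  set g : ℕ → ℂ := fun M => charSum q (u / √M) *
      Complex.exp (-(((u / √M : ℝ) : ℂ) / d * Complex.I)) - 1 with hg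
  have h1 := h.tendsto_natCast_mul_charSum u
  have h2 := Complex.tendsto_one_add_pow_exp_of_tendsto (g := g) h1
  have hs : Tendsto (fun M : ℕ => u / √(M : ℝ)) atTop (𝓝 0) :=
    tendsto_const_nhds.div_atTop (Real.tendsto_sqrt_atTop.comp tendsto_natCast_atTop_atTop)
  have h3 : Tendsto (fun M : ℕ => charSum q (u / √M)) atTop (𝓝 1) := by
    have := ((continuous_charSum h.hasSum.summable).tendsto 0).comp hs
    have h0 : charSum q 0 = 1 := by
      rw [charSum]
      have := (Complex.hasSum_ofReal.2 h.hasSum).tsum_eq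
      simpa using this
    rwa [h0] at this
  have h4 := (h2.pow d).mul h3
  rw [mul_one, ← Complex.exp_nat_mul] at h4
  have e : Complex.exp (d * (-(v * u ^ 2 / 2 : ℝ) : ℂ)) =
      ((Real.exp (-(d * v / 2) * u ^ 2) : ℝ) : ℂ) := by
    push_cast; ring_nf
  rw [e] at h4
  refine h4.congr fun M => ?_
  have e2 : 1 + g M = charSum q (u / √M) *
      Complex.exp (-(((u / √M : ℝ) : ℂ) / d * Complex.I)) := by rw [hg]; ring
  rw [e2, ← pow_mul, mul_pow, ← Complex.exp_nat_mul, pow_succ, mul_comm M d]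
  have e3 : ((d * M : ℕ) : ℂ) * -(((u / √M : ℝ) : ℂ) / d * Complex.I) =
      -(M * ((u / √M : ℝ) : ℂ) * Complex.I) := by
    push_cast; field_simp
  rw [e3]; ring

/-- The local limit theorem. -/
theorem tendsto_sqrt_mul_coeff (h : IsLatticeLaw q d v) :
    Tendsto (fun M : ℕ => √M * PowerSeries.coeff M (PowerSeries.mk q ^ (d * M + 1))) atTop
      (𝓝 (1 / √(2 * Real.pi * d * v))) := by
  obtain ⟨c, hc, hle⟩ := h.exists_norm_charSum_le
  have hd : (0 : ℝ) < d := by exact_mod_cast h.d_pos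
  have hpi := Real.pi_pos
  have hv := h.var_pos
  set F : ℕ → ℝ → ℂ := fun M u => charSum q (u / √M) ^ (d * M + 1) *
      Complex.exp (-(M * ((u / √M : ℝ) : ℂ) * Complex.I)) with hF
  have hcont : ∀ M, Continuous (F M) := by
    intro M
    have := continuous_charSum h.hasSum.summable
    rw [hF]; fun_prop
  -- After the substitution `θ = u / √M` the interval grows to the whole line, the integrand tends
  -- to a Gaussian, and `exists_norm_charSum_le` dominates it.
  have hlim : Tendsto (fun M : ℕ => ∫ u : ℝ,
      (Set.Ioc (-Real.pi * √M) (Real.pi * √M)).indicator (F M) u) atTop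
      (𝓝 (∫ u : ℝ, ((Real.exp (-(d * v / 2) * u ^ 2) : ℝ) : ℂ))) := by
    refine MeasureTheory.tendsto_integral_of_dominated_convergence
      (fun u => Real.exp (-(c * d) * u ^ 2)) (fun M => ?_)
      (integrable_exp_neg_mul_sq (mul_pos hc hd)) (fun M => Eventually.of_forall fun u => ?_)
      (Eventually.of_forall fun u => ?_)
    · exact (hcont M).aestronglyMeasurable.indicator measurableSet_Ioc
    · by_cases hu : u ∈ Set.Ioc (-Real.pi * √M) (Real.pi * √M)
      · rw [Set.indicator_of_mem hu]
        -- For `M = 0` the interval of integration is empty.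
        have hM : 0 < √(M : ℝ) := by
          by_contra hcon
          have h0 : √(M : ℝ) = 0 := le_antisymm (not_lt.1 hcon) (Real.sqrt_nonneg _)
          rw [h0] at hu
          simp at hu
        have hM1 : (0 : ℝ) < M := Real.sqrt_pos.1 hM
        have hθ : |u / √M| ≤ Real.pi := by
          rw [abs_div, abs_of_pos hM, div_le_iff₀ hM, abs_le]
          exact ⟨by linarith [hu.1], hu.2⟩
        have e : Complex.exp (-(M * ((u / √M : ℝ) : ℂ) * Complex.I)) =
          Complex.exp (((-(M * (u / √M)) : ℝ) : ℂ) * Complex.I) := by push_cast; ring_nf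
        rw [hF]
        simp only
        rw [e, norm_mul, norm_pow, Complex.norm_exp_ofReal_mul_I, mul_one]
        refine (pow_le_pow_left₀ (norm_nonneg _) (hle _ hθ) _).trans ?_
        rw [← Real.exp_nat_mul, Real.exp_le_exp, div_pow, Real.sq_sqrt hM1.le]
        have e2 : ((d * M + 1 : ℕ) : ℝ) * (-c * (u ^ 2 / M)) =
            -(c * d) * u ^ 2 - c * (u ^ 2 / M) := by push_cast; field_simp; ring
        rw [e2]
        have : 0 ≤ c * (u ^ 2 / M) := by positivity
        linarith
      · rw [Set.indicator_of_notMem hu, norm_zero]; exact (Real.exp_pos _).le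
    · refine (h.tendsto_charSum_pow u).congr' ?_
      have hs : Tendsto (fun M : ℕ => Real.pi * √(M : ℝ)) atTop atTop :=
        (Real.tendsto_sqrt_atTop.comp tendsto_natCast_atTop_atTop).const_mul_atTop hpi
      filter_upwards [hs.eventually_gt_atTop |u|] with M hM
      rw [Set.indicator_of_mem]
      have := abs_lt.1 hM
      exact ⟨by linarith [this.1], this.2.le⟩
  have hI : ∀ᶠ M : ℕ in atTop, ∫ u : ℝ,
      (Set.Ioc (-Real.pi * √M) (Real.pi * √M)).indicator (F M) u =
      ((2 * Real.pi * (√M * PowerSeries.coeff M (PowerSeries.mk q ^ (d * M + 1))) : ℝ) : ℂ) := by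
    filter_upwards [eventually_gt_atTop 0] with M hM
    have hM' : (0 : ℝ) < M := by exact_mod_cast hM
    have hs0 : 0 < √(M : ℝ) := Real.sqrt_pos.2 hM'
    rw [MeasureTheory.integral_indicator measurableSet_Ioc,
      ← intervalIntegral.integral_of_le (by nlinarith)]
    have := intervalIntegral.integral_comp_div (a := -Real.pi * √M) (b := Real.pi * √M)
      (c := √(M : ℝ)) (fun θ : ℝ => charSum q θ ^ (d * M + 1) *
        Complex.exp (-(M * (θ : ℂ) * Complex.I))) hs0.ne'
    rw [hF]
    simp only
    rw [this, mul_div_cancel_right₀ _ hs0.ne', mul_div_cancel_right₀ _ hs0.ne',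
      integral_charSum_pow h.nonneg h.hasSum.summable, Complex.real_smul]
    push_cast; ring
  have hlim2 := (Complex.continuous_re.tendsto _).comp (hlim.congr' hI)
  have hgauss : ∫ u : ℝ, ((Real.exp (-(d * v / 2) * u ^ 2) : ℝ) : ℂ) =
      ((√(Real.pi / (d * v / 2)) : ℝ) : ℂ) := by
    rw [integral_complex_ofReal, integral_gaussian]
  rw [hgauss, Complex.ofReal_re] at hlim2
  have h5 := hlim2.const_mul (1 / (2 * Real.pi))
  have e : 1 / (2 * Real.pi) * √(Real.pi / (d * v / 2)) = 1 / √(2 * Real.pi * d * v) := by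
    have e1 : Real.pi / (d * v / 2) = (2 * Real.pi) ^ 2 / (2 * Real.pi * d * v) := by
      field_simp
    rw [e1, Real.sqrt_div (by positivity), Real.sqrt_sq (by positivity)]
    have : 0 < √(2 * Real.pi * d * v) := Real.sqrt_pos.2 (by positivity)
    field_simp
  rw [e] at h5
  refine h5.congr fun M => ?_
  simp only [Function.comp_apply, Complex.ofReal_re]
  field_simp

end IsLatticeLaw


/-! ### Cyclic order and crossings of equivalence relations -/

instance finite_setoid (α : Type*) [Finite α] : Finite (Setoid α) :=
  Finite.of_injective (fun (r : Setoid α) (a b : α) => r a b) fun r s h =>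
    Setoid.ext fun a b => by rw [show r a b = s a b from congrFun (congrFun h a) b]

section Cyc

variable {α : Type*} [LinearOrder α]

/-- The elements `a`, `b`, `c`, `d` are distinct and in this cyclic order. -/
def Cyc (a b c d : α) : Prop :=
  a < b ∧ b < c ∧ c < d ∨ b < c ∧ c < d ∧ d < a ∨ c < d ∧ d < a ∧ a < b ∨ d < a ∧ a < b ∧ b < c

theorem Cyc.rotate {a b c d : α} (h : Cyc a b c d) : Cyc b c d a := by
  unfold Cyc at h ⊢; tauto

/-- `p ≤ x ↔ q ≤ x` says that `x` is not between `p` and `q`. The hypothesis thus puts `x` and `y`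
on different sides of the chord `pq`; regions are encoded by this test throughout. -/
theorem cyc_of_separated {x y p q : α} (hx : p ≠ x) (hy : p ≠ y) (hx' : q ≠ x) (hy' : q ≠ y)
    (h : ¬ ((p ≤ x ↔ q ≤ x) ↔ (p ≤ y ↔ q ≤ y))) : Cyc x p y q ∨ Cyc x q y p := by
  unfold Cyc; grind

theorem Cyc.separated {a b c d : α} (h : Cyc a b c d) :
    ¬ ((b ≤ a ↔ d ≤ a) ↔ (b ≤ c ↔ d ≤ c)) := by
  unfold Cyc at h; grind

/-- If a chord `pq` had `a`, `c` on one side and `b`, `d` on the other, the chords `ac` and `bd`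
could not interleave. -/
theorem Cyc.not_separated {a b c d p q : α} (h : Cyc a b c d)
    (h1 : ((p ≤ a ↔ q ≤ a) ↔ (p ≤ c ↔ q ≤ c))) (h2 : ((p ≤ b ↔ q ≤ b) ↔ (p ≤ d ↔ q ≤ d))) :
    ((p ≤ a ↔ q ≤ a) ↔ (p ≤ b ↔ q ≤ b)) := by
  unfold Cyc at h
  by_cases p ≤ a <;> by_cases q ≤ a <;> by_cases p ≤ b <;> by_cases q ≤ b <;> grind

theorem Cyc.replace {a b c d x : α} (h : Cyc a b c d) (hb : x ≠ b) (hd : x ≠ d) :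
    Cyc x b c d ∨ Cyc x d a b := by
  unfold Cyc at h ⊢; grind

theorem OrderEmbedding.cyc_iff {β : Type*} [LinearOrder β] (e : β ↪o α) {a b c d : β} :
    Cyc (e a) (e b) (e c) (e d) ↔ Cyc a b c d := by
  simp only [Cyc, e.lt_iff_lt]

/-- The chords `ac` and `bd`, with ends in distinct classes, cross. -/
def CrossAt (r : Setoid α) (a b c d : α) : Prop := Cyc a b c d ∧ r a c ∧ r b d ∧ ¬ r a b

theorem CrossAt.rotate {r : Setoid α} {a b c d : α} (h : CrossAt r a b c d) :
    CrossAt r b c d a :=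
  ⟨h.1.rotate, h.2.2.1, r.symm h.2.1,
    fun h' => h.2.2.2 (r.trans h.2.1 (r.symm h'))⟩

/-- The points which belong to crossing chords. -/
def coreSet (r : Setoid α) : Set α := {x | ∃ b c d, CrossAt r x b c d}

/-- The chord `bd` has `a` and `c` on opposite sides, so joining `x` to one of them crosses `bd`.
Hence the core is a union of whole classes. -/
theorem CrossAt.mem_coreSet {r : Setoid α} {a b c d x : α} (h : CrossAt r a b c d) (hx : r x a) :
    x ∈ coreSet r := by
  have hb : x ≠ b := fun hb => h.2.2.2 (r.symm (hb ▸ hx))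
  have hd : x ≠ d := fun hd => h.2.2.2 (r.trans (r.symm (hd ▸ hx)) (r.symm h.2.2.1))
  rcases h.1.replace hb hd with h' | h'
  · exact ⟨b, c, d, h', r.trans hx h.2.1, h.2.2.1, fun h3 => h.2.2.2 (r.trans (r.symm hx) h3)⟩
  · exact ⟨d, a, b, h', hx, r.symm h.2.2.1, fun h3 => h.2.2.2
      (r.trans (r.symm hx) (r.trans h3 (r.symm h.2.2.1)))⟩

theorem mem_coreSet_of_rel {r : Setoid α} {x y : α} (h : r x y) (hx : x ∈ coreSet r) :
    y ∈ coreSet r := by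
  obtain ⟨b, c, d, hc⟩ := hx
  exact hc.mem_coreSet (r.symm h)

/-- No two classes cross. -/
def Noncrossing (r : Setoid α) : Prop := ∀ a b c d, ¬ CrossAt r a b c d

/-- All classes have sizes in `S`. -/
def SizesIn (S : Set ℕ) (r : Setoid α) : Prop := ∀ x, {y | r x y}.ncard ∈ S

/-- The noncrossing equivalence relations with class sizes in `S`. -/
def ncSetoids (S : Set ℕ) (α : Type*) [LinearOrder α] : Set (Setoid α) :=
  {r | Noncrossing r ∧ SizesIn S r}

/-- The number of noncrossing equivalence relations with class sizes in `S`. -/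
def ncCount (S : Set ℕ) (α : Type*) [LinearOrder α] : ℕ := (ncSetoids S α).ncard

/-- The number of noncrossing partitions of `n` points with block sizes in `S`. -/
def nc (S : Set ℕ) (n : ℕ) : ℕ := ncCount S (Fin n)

theorem ncCount_le_of_orderIso (S : Set ℕ) {β : Type*} [LinearOrder β] [Finite α]
    (e : α ≃o β) : ncCount S β ≤ ncCount S α := by
  refine Set.ncard_le_ncard_of_injOn (fun r => Setoid.comap e r) (fun r hr => ⟨?_, ?_⟩)
    (fun r _ s _ h => ?_) (Set.toFinite _)
  · intro a b c d h
    refine hr.1 (e a) (e b) (e c) (e d) ⟨(OrderEmbedding.cyc_iff e.toOrderEmbedding).2 h.1, ?_⟩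
    exact h.2
  · intro x
    have : {y | r (e x) y}.ncard = {y | Setoid.comap e r x y}.ncard := by
      rw [← Set.ncard_image_of_injective _ e.injective]
      congr 1
      ext y
      simp only [Set.mem_ofPred_eq, Set.mem_image, Setoid.comap_rel]
      exact ⟨fun h => ⟨e.symm y, by simpa using h, by simp⟩, by rintro ⟨z, h, rfl⟩; exact h⟩
    rw [← this]
    exact hr.2 _
  · refine Setoid.ext fun a b => ?_
    have := Setoid.ext_iff.1 h (e.symm a) (e.symm b)
    simpa [Setoid.comap_rel] using this

theorem ncCount_congr (S : Set ℕ) {β : Type*} [LinearOrder β] [Finite α] (e : α ≃o β) :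
    ncCount S α = ncCount S β := by
  have := Finite.of_equiv α e.toEquiv
  exact le_antisymm (ncCount_le_of_orderIso S e.symm) (ncCount_le_of_orderIso S e)

theorem ncCount_eq_nc (S : Set ℕ) [Finite α] : ncCount S α = nc S (Nat.card α) := by
  have := Fintype.ofFinite α
  exact (ncCount_congr S (Fintype.orderIsoFinOfCardEq α (Nat.card_eq_fintype_card.symm))).symm

end Cyc

/-! ### Inserting noncrossing partitions into the regions of a partition -/

section Insertion

variable {α β Q : Type*} [LinearOrder α] [LinearOrder β]

/-- The equivalence relations on `α` which extend the relation `K` on the image of `e` by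
noncrossing classes with sizes in `S`. -/
def extensions (S : Set ℕ) (e : β ↪o α) (K : Setoid β) : Set (Setoid α) :=
  {r | Setoid.comap e r = K ∧ (∀ u, ∀ x ∉ Set.range e, ¬ r (e u) x) ∧
    (∀ a b c d, CrossAt r a b c d → a ∈ Set.range e) ∧
    ∀ x ∉ Set.range e, {y | r x y}.ncard ∈ S}

/-- The points outside the image of `e` that `φ` sends to `R`. -/
abbrev Fiber (e : β ↪o α) (φ : α → Q) (R : Q) : Type _ := {x : α // x ∉ Set.range e ∧ φ x = R}

/-- The map `φ` classifies the points outside the image of `e` by the region of `K`. -/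
def IsRegionMap (e : β ↪o α) (K : Setoid β) (φ : α → Q) : Prop :=
  ∀ x ∉ Set.range e, ∀ y ∉ Set.range e, φ x = φ y ↔
    ∀ u v, K u v → ((e u ≤ x ↔ e v ≤ x) ↔ (e u ≤ y ↔ e v ≤ y))

variable {S : Set ℕ} {e : β ↪o α} {K : Setoid β} {φ : α → Q}

/-- A chord of `K` separating two related new points would cross the chord that joins them, but
crossings use old points only. -/
theorem map_eq_of_mem_extensions (hφ : IsRegionMap e K φ) {r : Setoid α}
    (hr : r ∈ extensions S e K) {x y : α} (hx : x ∉ Set.range e) (hy : y ∉ Set.range e)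
    (h : r x y) : φ x = φ y := by
  rw [hφ x hx y hy]
  intro u v huv
  by_contra hcon
  have huv' : r (e u) (e v) := by
    have := hr.1
    rw [← this] at huv
    exact huv
  have hne : ∀ w, ∀ z ∉ Set.range e, e w ≠ z := fun w z hz h => hz ⟨w, h⟩
  have hnot : ∀ w, ¬ r x (e w) := fun w h' => hr.2.1 w x hx (r.symm h')
  rcases cyc_of_separated (hne u x hx) (hne u y hy) (hne v x hx) (hne v y hy) hcon with hc | hc
  · exact hx (hr.2.2.1 _ _ _ _ ⟨hc, h, huv', hnot u⟩)
  · exact hx (hr.2.2.1 _ _ _ _ ⟨hc, h, r.symm huv', hnot v⟩)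

/-- The equivalence relation which is `K` on the image of `e` and `g R` on the fiber over `R`. -/
def glue (e : β ↪o α) (K : Setoid β) (φ : α → Q) (g : ∀ R, Setoid (Fiber e φ R)) : Setoid α where
  r x y := (∃ u v, x = e u ∧ y = e v ∧ K u v) ∨
    ∃ (R : Q) (hx : x ∉ Set.range e ∧ φ x = R) (hy : y ∉ Set.range e ∧ φ y = R),
      g R ⟨x, hx⟩ ⟨y, hy⟩
  iseqv :=
    { refl := fun x => by
        by_cases hx : x ∈ Set.range e
        · obtain ⟨u, rfl⟩ := hx
          exact Or.inl ⟨u, u, rfl, rfl, K.refl u⟩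
        · exact Or.inr ⟨φ x, ⟨hx, rfl⟩, ⟨hx, rfl⟩, (g _).refl _⟩
      symm := by
        rintro x y (⟨u, v, rfl, rfl, h⟩ | ⟨R, hx, hy, h⟩)
        · exact Or.inl ⟨v, u, rfl, rfl, K.symm h⟩
        · exact Or.inr ⟨R, hy, hx, (g R).symm h⟩
      trans := by
        rintro x y z (⟨u, v, rfl, rfl, h⟩ | ⟨R, hx, hy, h⟩)
          (⟨u', v', h1, rfl, h'⟩ | ⟨R', hx', hy', h'⟩)
        · have := e.injective h1
          subst this
          exact Or.inl ⟨u, v', rfl, rfl, K.trans h h'⟩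
        · exact absurd ⟨v, rfl⟩ hx'.1
        · exact absurd ⟨u', h1.symm⟩ hy.1
        · obtain rfl : R = R' := hy.2.symm.trans hx'.2
          exact Or.inr ⟨R, hx, hy', (g R).trans h h'⟩ }

theorem glue_apply_apply (g : ∀ R, Setoid (Fiber e φ R)) (u v : β) :
    glue e K φ g (e u) (e v) ↔ K u v := by
  constructor
  · rintro (⟨u', v', h1, h2, h⟩ | ⟨R, hx, -, -⟩)
    · rwa [e.injective h1, e.injective h2]
    · exact absurd ⟨u, rfl⟩ hx.1
  · exact fun h => Or.inl ⟨u, v, rfl, rfl, h⟩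

theorem not_glue_apply (g : ∀ R, Setoid (Fiber e φ R)) (u : β) {x : α} (hx : x ∉ Set.range e) :
    ¬ glue e K φ g (e u) x := by
  rintro (⟨u', v', h1, rfl, h⟩ | ⟨R, hx', -, -⟩)
  · exact hx ⟨v', rfl⟩
  · exact absurd ⟨u, rfl⟩ hx'.1

theorem glue_fiber (g : ∀ R, Setoid (Fiber e φ R)) {R : Q} (x y : Fiber e φ R) :
    glue e K φ g x y ↔ g R x y := by
  constructor
  · rintro (⟨u', v', h1, -, h⟩ | ⟨R', hx, hy, h⟩)
    · exact absurd ⟨u', h1.symm⟩ x.2.1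
    · obtain rfl : R = R' := x.2.2.symm.trans hx.2
      exact h
  · exact fun h => Or.inr ⟨R, x.2, y.2, h⟩

theorem map_eq_of_glue (g : ∀ R, Setoid (Fiber e φ R)) {x y : α} (hx : x ∉ Set.range e)
    (h : glue e K φ g x y) : y ∉ Set.range e ∧ φ y = φ x := by
  rcases h with ⟨u', v', h1, -, h⟩ | ⟨R', hx, hy, h⟩
  · exact absurd ⟨u', h1.symm⟩ hx
  · exact ⟨hy.1, hy.2.trans hx.2.symm⟩

theorem ncard_class_of_forall {r : Setoid α} {R : Q} (x : Fiber e φ R)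
    (h : ∀ y, r x y → y ∉ Set.range e ∧ φ y = R) :
    {y | r x y}.ncard = {y | Setoid.comap (Subtype.val : Fiber e φ R → α) r x y}.ncard := by
  rw [← Set.ncard_image_of_injective _ Subtype.val_injective]
  congr 1
  ext y
  simp only [Set.mem_ofPred_eq, Set.mem_image, Setoid.comap_rel]
  exact ⟨fun hy => ⟨⟨y, h y hy⟩, hy, rfl⟩, by rintro ⟨z, hz, rfl⟩; exact hz⟩

theorem comap_mem_ncSetoids (hφ : IsRegionMap e K φ) {r : Setoid α}
    (hr : r ∈ extensions S e K) (R : Q) :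
    Setoid.comap (Subtype.val : Fiber e φ R → α) r ∈ ncSetoids S (Fiber e φ R) := by
  refine ⟨fun a b c d h => a.2.1 (hr.2.2.1 a b c d h), fun x => ?_⟩
  rw [← ncard_class_of_forall x]
  · exact hr.2.2.2 _ x.2.1
  · intro y hy
    have hy' : y ∉ Set.range e := by
      rintro ⟨u, rfl⟩
      exact hr.2.1 u x x.2.1 (r.symm hy)
    exact ⟨hy', (map_eq_of_mem_extensions hφ hr x.2.1 hy' hy).symm.trans x.2.2⟩

theorem glue_mem_extensions (hφ : IsRegionMap e K φ) {g : ∀ R, Setoid (Fiber e φ R)}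
    (hg : ∀ R, g R ∈ ncSetoids S (Fiber e φ R)) : glue e K φ g ∈ extensions S e K := by
  have hcomap : ∀ R, Setoid.comap (Subtype.val : Fiber e φ R → α) (glue e K φ g) = g R :=
    fun R => Setoid.ext fun x y => glue_fiber g x y
  refine ⟨Setoid.ext fun u v => glue_apply_apply g u v, fun u x hx => not_glue_apply g u hx,
    fun a b c d h => ?_, fun x hx => ?_⟩
  · by_contra ha
    obtain ⟨hcyc, hac, hbd, hab⟩ := h
    obtain ⟨hc, hφc⟩ := map_eq_of_glue g ha hac
    have hsac := (hφ a ha c hc).1 hφc.symm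
    -- An old chord `bd` would separate `a` from `c`, which lie in one region. A new chord `bd`
    -- must, by `Cyc.not_separated`, lie in the region of `ac`, where the glued relation is
    -- noncrossing.
    by_cases hb : b ∈ Set.range e
    · obtain ⟨u, rfl⟩ := hb
      have hd : d ∈ Set.range e := by
        by_contra hd
        exact not_glue_apply g u hd hbd
      obtain ⟨v, rfl⟩ := hd
      exact hcyc.separated (hsac u v ((glue_apply_apply g u v).1 hbd))
    · obtain ⟨hd, hφd⟩ := map_eq_of_glue g hb hbd
      have hsbd := (hφ b hb d hd).1 hφd.symm
      have hφab : φ a = φ b := (hφ a ha b hb).2 fun u v huv =>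
        hcyc.not_separated (hsac u v huv) (hsbd u v huv)
      refine (hg (φ a)).1 ⟨a, ha, rfl⟩ ⟨b, hb, hφab.symm⟩ ⟨c, hc, hφc⟩
        ⟨d, hd, hφd.trans hφab.symm⟩ ⟨hcyc, ?_, ?_, ?_⟩
      · exact (glue_fiber g _ _).1 hac
      · exact (glue_fiber g _ _).1 hbd
      · exact fun h => hab ((glue_fiber g _ _).2 h)
  · have := (hg (φ x)).2 ⟨x, hx, rfl⟩
    rw [← hcomap, ← ncard_class_of_forall (⟨x, hx, rfl⟩ : Fiber e φ (φ x))] at this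
    · exact this
    · exact fun y hy => map_eq_of_glue g hx hy

/-- Restriction to the fibers and `glue` are mutually inverse, and the number of noncrossing
relations on a fiber depends only on its cardinality. -/
theorem ncard_extensions [Finite α] [Fintype Q] (hφ : IsRegionMap e K φ) :
    (extensions S e K).ncard = ∏ R, nc S (Nat.card (Fiber e φ R)) := by
  have : ∀ R, nc S (Nat.card (Fiber e φ R)) = Nat.card (ncSetoids S (Fiber e φ R)) := fun R => by
    rw [← ncCount_eq_nc, ncCount, Nat.card_coe_set_eq]
  simp only [this]
  rw [← Nat.card_pi, ← Nat.card_coe_set_eq]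
  refine Nat.card_congr (Equiv.ofBijective
    (fun r R => ⟨Setoid.comap Subtype.val r.1, comap_mem_ncSetoids hφ r.2 R⟩) ⟨?_, ?_⟩)
  · rintro ⟨r, hr⟩ ⟨s, hs⟩ h
    refine Subtype.ext (Setoid.ext fun x y => ?_)
    have hcomap : ∀ u v, r (e u) (e v) ↔ s (e u) (e v) := fun u v =>
      (Setoid.ext_iff.1 (hr.1.trans hs.1.symm)) u v
    have key : ∀ x ∉ Set.range e, ∀ y ∉ Set.range e, φ x = φ y → (r x y ↔ s x y) := by
      intro x hx y hy hxy
      have h1 := congrArg Subtype.val (congrFun h (φ x))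
      exact Setoid.ext_iff.1 h1 ⟨x, hx, rfl⟩ ⟨y, hy, hxy.symm⟩
    by_cases hx : x ∈ Set.range e <;> by_cases hy : y ∈ Set.range e
    · obtain ⟨u, rfl⟩ := hx
      obtain ⟨v, rfl⟩ := hy
      exact hcomap u v
    · obtain ⟨u, rfl⟩ := hx
      exact iff_of_false (hr.2.1 u y hy) (hs.2.1 u y hy)
    · obtain ⟨v, rfl⟩ := hy
      exact iff_of_false (fun h => hr.2.1 v x hx (r.symm h)) fun h => hs.2.1 v x hx (s.symm h)
    · exact ⟨fun h => (key x hx y hy (map_eq_of_mem_extensions hφ hr hx hy h)).1 h,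
        fun h => (key x hx y hy (map_eq_of_mem_extensions hφ hs hx hy h)).2 h⟩
  · intro g
    refine ⟨⟨glue e K φ fun R => (g R).1, glue_mem_extensions hφ fun R => (g R).2⟩, ?_⟩
    funext R
    exact Subtype.ext (Setoid.ext fun x y => glue_fiber _ x y)

end Insertion


/-! ### Gap sizes -/

section Gaps

variable {m n : ℕ}

/-- The position reached by the first `k` gaps of sizes `g`. -/
def partialSum (g : Fin m → ℕ) (k : ℕ) : ℕ :=
  ∑ i ∈ Finset.univ.filter fun i : Fin m => (i : ℕ) < k, (g i + 1)

theorem partialSum_succ (g : Fin m → ℕ) (j : Fin m) :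
    partialSum g (j + 1) = partialSum g j + (g j + 1) := by
  have : (Finset.univ.filter fun i : Fin m => (i : ℕ) < j + 1) =
      insert j (Finset.univ.filter fun i : Fin m => (i : ℕ) < j) := by
    ext i
    simp only [Finset.mem_filter, Finset.mem_univ, true_and, Finset.mem_insert, Fin.ext_iff]
    omega
  rw [partialSum, this, Finset.sum_insert (by simp), add_comm]
  rfl

theorem partialSum_zero (g : Fin m → ℕ) : partialSum g 0 = 0 := by simp [partialSum]

theorem partialSum_self (g : Fin m → ℕ) : partialSum g m = ∑ i, g i + m := by
  simp [partialSum, Finset.sum_add_distrib]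

theorem partialSum_mono (g : Fin m → ℕ) {k l : ℕ} (h : k ≤ l) :
    partialSum g k ≤ partialSum g l :=
  Finset.sum_le_sum_of_subset fun i hi => by
    simp only [Finset.mem_filter, Finset.mem_univ, true_and] at hi ⊢
    omega

theorem eq_of_partialSum_eq {g g' : Fin m → ℕ} (h : ∀ k ≤ m, partialSum g k = partialSum g' k) :
    g = g' := by
  funext j
  have h1 := h j j.2.le
  have h2 := h (j + 1) j.2
  rw [partialSum_succ, partialSum_succ] at h2
  omega

variable [NeZero m]

/-- The last `u` with `e u ≤ x`. -/
def gap (e : Fin m ↪o Fin n) (x : Fin n) : Fin m := (Finset.univ.filter fun u => e u ≤ x).sup id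

/-- `gap e` is the upper adjoint of `e`. The condition `e 0 = 0` puts every point after some value
of `e`, so the supremum is attained. -/
theorem le_gap_iff {e : Fin m ↪o Fin n} (he : (e 0 : ℕ) = 0) {u : Fin m} {x : Fin n} :
    u ≤ gap e x ↔ e u ≤ x := by
  constructor
  · intro h
    have hne : (Finset.univ.filter fun u => e u ≤ x).Nonempty :=
      ⟨0, by rw [Finset.mem_filter, Fin.le_def, he]; simp⟩
    obtain ⟨w, hw, hw'⟩ := Finset.exists_mem_eq_sup _ hne (id : Fin m → Fin m)
    rw [gap, hw'] at h
    exact (e.monotone h).trans (Finset.mem_filter.1 hw).2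
  · intro h
    exact Finset.le_sup (f := id) (Finset.mem_filter.2 ⟨Finset.mem_univ _, h⟩)

theorem gap_apply {e : Fin m ↪o Fin n} (he : (e 0 : ℕ) = 0) (u : Fin m) : gap e (e u) = u := by
  apply le_antisymm
  · rw [← e.le_iff_le]
    exact (le_gap_iff he).1 le_rfl
  · exact (le_gap_iff he).2 le_rfl

/-- The number of points in the `j`-th gap of `e`. -/
def gapSize (e : Fin m ↪o Fin n) (j : Fin m) : ℕ :=
  Nat.card {x : Fin n // x ∉ Set.range e ∧ gap e x = j}

theorem card_gap_eq {e : Fin m ↪o Fin n} (he : (e 0 : ℕ) = 0) (j : Fin m) :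
    (Finset.univ.filter fun x => gap e x = j).card = gapSize e j + 1 := by
  have h1 : (Finset.univ.filter fun x => gap e x = j) =
      insert (e j) (Finset.univ.filter fun x => x ∉ Set.range e ∧ gap e x = j) := by
    ext x
    simp only [Finset.mem_filter, Finset.mem_univ, true_and, Finset.mem_insert]
    constructor
    · intro h
      by_cases hx : x ∈ Set.range e
      · obtain ⟨u, rfl⟩ := hx
        rw [gap_apply he] at h
        exact Or.inl (by rw [h])
      · exact Or.inr ⟨hx, h⟩
    · rintro (rfl | h)
      · exact gap_apply he j
      · exact h.2
  rw [h1, Finset.card_insert_of_notMem (by simp), gapSize, Nat.card_eq_fintype_card,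
    Fintype.card_subtype]

theorem partialSum_gapSize {e : Fin m ↪o Fin n} (he : (e 0 : ℕ) = 0) (k : ℕ) :
    partialSum (gapSize e) k = (Finset.univ.filter fun x => (gap e x : ℕ) < k).card := by
  rw [partialSum, Finset.card_eq_sum_card_fiberwise (f := gap e)
    (t := Finset.univ.filter fun i : Fin m => (i : ℕ) < k)
    (fun x hx => by simpa using hx)]
  refine Finset.sum_congr rfl fun i hi => ?_
  rw [← card_gap_eq he, Finset.filter_filter]
  congr 1
  ext x
  simp only [Finset.mem_filter, Finset.mem_univ, true_and] at hi ⊢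
  constructor
  · rintro rfl; exact ⟨hi, rfl⟩
  · exact fun h => h.2

theorem partialSum_gapSize_val {e : Fin m ↪o Fin n} (he : (e 0 : ℕ) = 0) (j : Fin m) :
    partialSum (gapSize e) j = e j := by
  rw [partialSum_gapSize he]
  have : (Finset.univ.filter fun x => (gap e x : ℕ) < j) = Finset.Iio (e j) := by
    ext x
    simp only [Finset.mem_filter, Finset.mem_univ, true_and, Finset.mem_Iio]
    rw [← Fin.lt_def, ← not_le, le_gap_iff he, not_le]
  rw [this, Fin.card_Iio]

theorem partialSum_gapSize_self {e : Fin m ↪o Fin n} (he : (e 0 : ℕ) = 0) :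
    partialSum (gapSize e) m = n := by
  rw [partialSum_gapSize he]
  simp

theorem exists_gapSize_eq {g : Fin m → ℕ} (hg : partialSum g m = n) :
    ∃ e : Fin m ↪o Fin n, (e 0 : ℕ) = 0 ∧ gapSize e = g := by
  have hlt : ∀ j : Fin m, partialSum g j < n := by
    intro j
    have h1 := partialSum_succ g j
    have h2 := partialSum_mono g (show (j : ℕ) + 1 ≤ m from j.2)
    omega
  have hmono : StrictMono fun j : Fin m => (⟨partialSum g j, hlt j⟩ : Fin n) := by
    intro i j hij
    have h1 := partialSum_succ g i
    have h2 := partialSum_mono g (show (i : ℕ) + 1 ≤ j from hij)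
    rw [Fin.lt_def]
    simp only
    omega
  have he : ((OrderEmbedding.ofStrictMono _ hmono 0 : Fin n) : ℕ) = 0 := by
    simp [partialSum_zero]
  refine ⟨OrderEmbedding.ofStrictMono _ hmono, he, eq_of_partialSum_eq fun k hk => ?_⟩
  rcases hk.lt_or_eq with hk | rfl
  · exact partialSum_gapSize_val he ⟨k, hk⟩
  · rw [partialSum_gapSize_self he, hg]

theorem mem_piAntidiag_univ {ι : Type*} [Fintype ι] [DecidableEq ι] {N : ℕ} {g : ι → ℕ} :
    g ∈ Finset.piAntidiag Finset.univ N ↔ ∑ i, g i = N := by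
  simp [Finset.mem_piAntidiag]

-- An embedding with `e 0 = 0` is determined by its gap sizes, and any sizes with sum `n - m` occur.
-- Fixing `e 0` leaves no gap before the first point, so gaps correspond to cyclic arcs.
open Classical in
theorem sum_gapSize {M : Type*} [AddCommMonoid M] {N : ℕ} (hn : n = N + m)
    (F : (Fin m → ℕ) → M) :
    ∑ e : Fin m ↪o Fin n with (e 0 : ℕ) = 0, F (gapSize e) =
      ∑ g ∈ Finset.piAntidiag Finset.univ N, F g := by
  refine Finset.sum_bij (fun e _ => gapSize e) ?_ ?_ ?_ fun _ _ => rfl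
  · intro e he
    have := partialSum_gapSize_self (Finset.mem_filter.1 he).2
    rw [partialSum_self] at this
    rw [mem_piAntidiag_univ]; omega
  · intro e he e' he' h
    ext j
    rw [← partialSum_gapSize_val (Finset.mem_filter.1 he).2,
      ← partialSum_gapSize_val (Finset.mem_filter.1 he').2, h]
  · intro g hg
    rw [mem_piAntidiag_univ] at hg
    obtain ⟨e, he, h⟩ := exists_gapSize_eq (g := g) (n := n) (by rw [partialSum_self]; omega)
    exact ⟨e, by simpa using he, h⟩

end Gaps

/-! ### Regions -/

/-- Two gaps, just after `i` and `j`, are in the same region of `K`. -/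
def gapSetoid {β : Type*} [LinearOrder β] (K : Setoid β) : Setoid β where
  r i j := ∀ u v, K u v → ((u ≤ i ↔ v ≤ i) ↔ (u ≤ j ↔ v ≤ j))
  iseqv :=
    { refl := fun _ _ _ _ => Iff.rfl
      symm := fun h u v huv => (h u v huv).symm
      trans := fun h h' u v huv => (h u v huv).trans (h' u v huv) }

theorem isRegionMap_gap {m n : ℕ} [NeZero m] {e : Fin m ↪o Fin n} (he : (e 0 : ℕ) = 0)
    (K : Setoid (Fin m)) :
    IsRegionMap e K fun x => (Quotient.mk (gapSetoid K) (gap e x)) := by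
  intro x _ y _
  rw [Quotient.eq]
  simp only [← le_gap_iff he]
  exact Iff.rfl

open Classical in
theorem ncard_extensions_gap {m n : ℕ} [NeZero m] {e : Fin m ↪o Fin n} (he : (e 0 : ℕ) = 0)
    (S : Set ℕ) (K : Setoid (Fin m)) :
    (extensions S e K).ncard =
      ∏ R : Quotient (gapSetoid K), nc S (∑ j with Quotient.mk _ j = R, gapSize e j) := by
  rw [ncard_extensions (isRegionMap_gap he K)]
  refine Finset.prod_congr rfl fun R _ => ?_
  congr 1
  rw [Nat.card_eq_fintype_card, Fintype.card_subtype, Finset.card_eq_sum_card_fiberwise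
    (f := gap e) (t := Finset.univ.filter fun j => Quotient.mk _ j = R)
    (fun x hx => by
      simp only [Finset.coe_filter, Finset.mem_univ, true_and, Set.mem_ofPred_eq] at hx ⊢
      exact hx.2)]
  refine Finset.sum_congr rfl fun j hj => ?_
  rw [gapSize, Nat.card_eq_fintype_card, Fintype.card_subtype, Finset.filter_filter]
  congr 1
  ext x
  simp only [Finset.mem_filter, Finset.mem_univ, true_and] at hj ⊢
  constructor
  · rintro ⟨⟨h1, h2⟩, h3⟩; exact ⟨h1, h3⟩
  · rintro ⟨h1, h2⟩; exact ⟨⟨h1, by rw [h2, hj]⟩, h2⟩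

theorem card_sum_eq (ι : Type*) [Fintype ι] (N : ℕ) :
    Nat.card {g : ι → ℕ // ∑ i, g i = N} = (Fintype.card ι + N - 1).choose N := by
  classical
  rw [← Sym.card_sym_eq_choose, ← Nat.card_eq_fintype_card]
  refine Nat.card_congr (Equiv.trans ?_ (Sym.equivNatSum ι N).symm)
  refine (Finsupp.equivFunOnFinite.symm).subtypeEquiv fun g => ?_
  rw [Finsupp.sum_fintype _ _ (fun _ => rfl)]
  rfl

/-- The generating function of the noncrossing partitions inserted in a region with `i` boundary
arcs. -/
def regionSeries (S : Set ℕ) (i : ℕ) : PowerSeries ℝ :=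
  PowerSeries.mk fun N => ((i + N - 1).choose N : ℝ) * nc S N

-- Stars and bars, independently in each class of indices.
open Classical in
theorem card_pushforward_eq {ι Q : Type*} [Fintype ι] [Fintype Q] (c : ι → Q) (l : Q → ℕ) :
    (Finset.univ.piAntidiag (∑ R, l R) |>.filter
      fun g : ι → ℕ => (fun R => ∑ j with c j = R, g j) = l).card =
      ∏ R, ((Finset.univ.filter fun j => c j = R).card + l R - 1).choose (l R) := by
  have h : ∀ R, ((Finset.univ.filter fun j => c j = R).card + l R - 1).choose (l R) =
      Nat.card {g : {j // c j = R} → ℕ // ∑ i, g i = l R} := fun R => by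
    rw [card_sum_eq, Fintype.card_subtype]
  simp only [h]
  rw [← Nat.card_pi, ← Fintype.card_coe, ← Nat.card_eq_fintype_card]
  have hsub : ∀ (g : ι → ℕ) (R : Q), ∑ j : {j // c j = R}, g j = ∑ j with c j = R, g j :=
    fun g R => (Finset.sum_subtype _ (by simp) _).symm
  refine Nat.card_congr (Equiv.ofBijective
    (fun g R => ⟨fun j => g.1 j, by
      rw [hsub]
      exact congrFun (Finset.mem_filter.1 g.2).2 R⟩) ⟨?_, ?_⟩)
  · rintro ⟨g, hg⟩ ⟨g', hg'⟩ h
    refine Subtype.ext (funext fun j => ?_)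
    have := congrArg Subtype.val (congrFun h (c j))
    exact congrFun this ⟨j, rfl⟩
  · intro f
    have hf : ∀ R, ∑ j with c j = R, (f (c j)).1 ⟨j, rfl⟩ = l R := by
      intro R
      rw [← hsub (fun j => (f (c j)).1 ⟨j, rfl⟩) R, ← (f R).2]
      refine Finset.sum_congr rfl ?_
      rintro ⟨j, rfl⟩ _
      rfl
    refine ⟨⟨fun j => (f (c j)).1 ⟨j, rfl⟩, ?_⟩, ?_⟩
    · rw [Finset.mem_filter, mem_piAntidiag_univ]
      refine ⟨?_, funext hf⟩
      rw [← Finset.sum_fiberwise Finset.univ c]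
      exact Finset.sum_congr rfl fun R _ => hf R
    · funext R
      refine Subtype.ext (funext ?_)
      rintro ⟨j, rfl⟩
      rfl

-- Group the gap sizes by their totals in the regions. The product of the `nc` depends only on these
-- totals, and the number of gap vectors with given totals supplies the binomial factors of
-- `regionSeries`.
open Classical in
theorem sum_prod_nc_eq_coeff {ι Q : Type*} [Fintype ι] [Fintype Q] (S : Set ℕ) (c : ι → Q)
    (N : ℕ) :
    ((∑ g ∈ Finset.piAntidiag Finset.univ N, ∏ R, nc S (∑ j with c j = R, g j) : ℕ) : ℝ) =
      PowerSeries.coeff N (∏ R, regionSeries S (Finset.univ.filter fun j => c j = R).card) := by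
  rw [PowerSeries.coeff_prod]
  have h1 : ∑ l ∈ Finset.finsuppAntidiag Finset.univ N, ∏ R, PowerSeries.coeff (l R)
      (regionSeries S (Finset.univ.filter fun j => c j = R).card) =
      ∑ l ∈ Finset.piAntidiag Finset.univ N, ∏ R, PowerSeries.coeff (l R)
      (regionSeries S (Finset.univ.filter fun j => c j = R).card) := by
    refine Finset.sum_equiv Finsupp.equivFunOnFinite (fun l => ?_) fun l _ => rfl
    rw [mem_piAntidiag_univ, Finset.mem_finsuppAntidiag]
    simp
  rw [h1, ← Finset.sum_fiberwise_of_maps_to (t := Finset.piAntidiag Finset.univ N)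
    (g := fun g : ι → ℕ => fun R => ∑ j with c j = R, g j)]
  · push_cast
    refine Finset.sum_congr rfl fun l hl => ?_
    have hN := mem_piAntidiag_univ.1 hl
    have h2 : ∀ g ∈ (Finset.univ.piAntidiag N).filter
        (fun g : ι → ℕ => (fun R => ∑ j with c j = R, g j) = l),
        (∏ R, (nc S (∑ j with c j = R, g j) : ℝ)) = ∏ R, (nc S (l R) : ℝ) := by
      intro g hg
      have := (Finset.mem_filter.1 hg).2
      rw [← this]
    rw [Finset.sum_congr rfl h2, Finset.sum_const, ← hN, card_pushforward_eq, nsmul_eq_mul]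
    push_cast
    rw [← Finset.prod_mul_distrib]
    refine Finset.prod_congr rfl fun R _ => ?_
    rw [regionSeries, PowerSeries.coeff_mk]
  · intro g hg
    rw [mem_piAntidiag_univ] at hg ⊢
    rw [← hg]
    exact Finset.sum_fiberwise Finset.univ c g

open Classical in
/-- The generating function of the noncrossing partitions inserted in all regions of `K`. -/
def fillSeries (S : Set ℕ) {m : ℕ} (K : Setoid (Fin m)) : PowerSeries ℝ :=
  ∏ R : Quotient (gapSetoid K),
    regionSeries S (Finset.univ.filter fun j => Quotient.mk (gapSetoid K) j = R).card

open Classical in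
theorem sum_ncard_extensions {m n N : ℕ} [NeZero m] (hn : n = N + m) (S : Set ℕ)
    (K : Setoid (Fin m)) :
    ((∑ e : Fin m ↪o Fin n with (e 0 : ℕ) = 0, (extensions S e K).ncard : ℕ) : ℝ) =
      PowerSeries.coeff N (fillSeries S K) := by
  have h : ∀ e ∈ (Finset.univ.filter fun e : Fin m ↪o Fin n => (e 0 : ℕ) = 0),
      (extensions S e K).ncard = (fun g : Fin m → ℕ => ∏ R : Quotient (gapSetoid K),
        nc S (∑ j with Quotient.mk _ j = R, g j)) (gapSize e) := fun e he =>
    ncard_extensions_gap (Finset.mem_filter.1 he).2 S K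
  rw [Finset.sum_congr rfl h, sum_gapSize hn fun g : Fin m → ℕ => ∏ R : Quotient (gapSetoid K),
    nc S (∑ j with Quotient.mk _ j = R, g j)]
  convert! sum_prod_nc_eq_coeff S (Quotient.mk (gapSetoid K)) N
  unfold fillSeries
  congr!


/-! ### Counting crossings -/

section CrossNum

variable {α : Type*} [LinearOrder α]

/-- The crossings of an equivalence relation. -/
def crossSet (r : Setoid α) : Set ((α × α) × (α × α)) :=
  {c | c.1.1 < c.2.1 ∧ c.2.1 < c.1.2 ∧ c.1.2 < c.2.2 ∧
    r c.1.1 c.1.2 ∧ r c.2.1 c.2.2 ∧ ¬ r c.1.1 c.2.1}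

/-- The number of crossings of an equivalence relation. -/
def crossNum (r : Setoid α) : ℕ := (crossSet r).ncard

/-- The cyclically ordered quadruples of ends of crossing chords. -/
def cycSet (r : Setoid α) : Set (α × α × α × α) := {q | CrossAt r q.1 q.2.1 q.2.2.1 q.2.2.2}

/-- A crossing is counted once for each of its four possible first points. Unlike `crossSet`, the
set `cycSet` uses only the cyclic order, so it transports along rotations. -/
theorem ncard_cycSet [Finite α] (r : Setoid α) : (cycSet r).ncard = 4 * crossNum r := by
  let g0 : (α × α) × (α × α) → α × α × α × α := fun c => (c.1.1, c.2.1, c.1.2, c.2.2)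
  let g1 : (α × α) × (α × α) → α × α × α × α := fun c => (c.2.2, c.1.1, c.2.1, c.1.2)
  let g2 : (α × α) × (α × α) → α × α × α × α := fun c => (c.1.2, c.2.2, c.1.1, c.2.1)
  let g3 : (α × α) × (α × α) → α × α × α × α := fun c => (c.2.1, c.1.2, c.2.2, c.1.1)
  have h0 : g0.Injective := by
    rintro ⟨⟨a, b⟩, c, d⟩ ⟨⟨a', b'⟩, c', d'⟩ h; simp only [g0, Prod.mk.injEq] at h ⊢; tauto
  have h1 : g1.Injective := by
    rintro ⟨⟨a, b⟩, c, d⟩ ⟨⟨a', b'⟩, c', d'⟩ h; simp only [g1, Prod.mk.injEq] at h ⊢; tauto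
  have h2 : g2.Injective := by
    rintro ⟨⟨a, b⟩, c, d⟩ ⟨⟨a', b'⟩, c', d'⟩ h; simp only [g2, Prod.mk.injEq] at h ⊢; tauto
  have h3 : g3.Injective := by
    rintro ⟨⟨a, b⟩, c, d⟩ ⟨⟨a', b'⟩, c', d'⟩ h; simp only [g3, Prod.mk.injEq] at h ⊢; tauto
  have hcross : ∀ c ∈ crossSet r, CrossAt r c.1.1 c.2.1 c.1.2 c.2.2 := fun c hc =>
    ⟨Or.inl ⟨hc.1, hc.2.1, hc.2.2.1⟩, hc.2.2.2.1, hc.2.2.2.2.1, hc.2.2.2.2.2⟩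
  have hU : cycSet r = g0 '' crossSet r ∪ (g1 '' crossSet r ∪
      (g2 '' crossSet r ∪ g3 '' crossSet r)) := by
    ext ⟨a, b, c, d⟩
    constructor
    · intro h
      have h' : CrossAt r a b c d := h
      obtain ⟨hcyc, hr⟩ := id h'
      rcases hcyc with hc | hc | hc | hc
      · exact Or.inl ⟨((a, c), (b, d)), ⟨hc.1, hc.2.1, hc.2.2, hr⟩, rfl⟩
      · exact Or.inr (Or.inl ⟨((b, d), (c, a)), ⟨hc.1, hc.2.1, hc.2.2, h'.rotate.2⟩, rfl⟩)
      · exact Or.inr (Or.inr (Or.inl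
          ⟨((c, a), (d, b)), ⟨hc.1, hc.2.1, hc.2.2, h'.rotate.rotate.2⟩, rfl⟩))
      · exact Or.inr (Or.inr (Or.inr
          ⟨((d, b), (a, c)), ⟨hc.1, hc.2.1, hc.2.2, h'.rotate.rotate.rotate.2⟩, rfl⟩))
    · rintro (⟨x, hx, h⟩ | ⟨x, hx, h⟩ | ⟨x, hx, h⟩ | ⟨x, hx, h⟩) <;> rw [← h]
      · exact hcross x hx
      · exact (hcross x hx).rotate.rotate.rotate
      · exact (hcross x hx).rotate.rotate
      · exact (hcross x hx).rotate
  have hlt : ∀ c ∈ crossSet r, c.1.1 < c.2.1 ∧ c.2.1 < c.1.2 ∧ c.1.2 < c.2.2 :=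
    fun c hc => ⟨hc.1, hc.2.1, hc.2.2.1⟩
  -- The four images are disjoint because they differ in the position of the smallest of the four
  -- points.
  rw [hU, Set.ncard_union_eq ?_ (Set.toFinite _) (Set.toFinite _),
    Set.ncard_union_eq ?_ (Set.toFinite _) (Set.toFinite _),
    Set.ncard_union_eq ?_ (Set.toFinite _) (Set.toFinite _),
    Set.ncard_image_of_injective _ h0, Set.ncard_image_of_injective _ h1,
    Set.ncard_image_of_injective _ h2, Set.ncard_image_of_injective _ h3, crossNum]
  · ring
  · rw [Set.disjoint_left]
    rintro _ ⟨x, hx, rfl⟩ ⟨y, hy, h⟩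
    have := hlt x hx
    have := hlt y hy
    simp only [g2, g3, Prod.mk.injEq] at h
    grind
  · rw [Set.disjoint_left]
    rintro _ ⟨x, hx, rfl⟩ (⟨y, hy, h⟩ | ⟨y, hy, h⟩) <;>
    · have := hlt x hx
      have := hlt y hy
      simp only [g1, g2, g3, Prod.mk.injEq] at h
      grind
  · rw [Set.disjoint_left]
    rintro _ ⟨x, hx, rfl⟩ (⟨y, hy, h⟩ | ⟨y, hy, h⟩ | ⟨y, hy, h⟩) <;>
    · have := hlt x hx
      have := hlt y hy
      simp only [g0, g1, g2, g3, Prod.mk.injEq] at h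
      grind

theorem ncard_coreSet_le [Finite α] (r : Setoid α) : (coreSet r).ncard ≤ 4 * crossNum r := by
  rw [← ncard_cycSet]
  have : coreSet r = Prod.fst '' cycSet r := by
    ext x
    exact ⟨fun ⟨b, c, d, h⟩ => ⟨(x, b, c, d), h, rfl⟩, by rintro ⟨q, h, rfl⟩; exact ⟨_, _, _, h⟩⟩
  rw [this]
  exact Set.ncard_image_le (Set.toFinite _)

theorem coreSet_nonempty [Finite α] {r : Setoid α} (h : crossNum r ≠ 0) :
    (coreSet r).Nonempty := by
  have h1 : (cycSet r).ncard ≠ 0 := by rw [ncard_cycSet]; omega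
  obtain ⟨q, hq⟩ := Set.nonempty_of_ncard_ne_zero h1
  exact ⟨q.1, _, _, _, hq⟩

variable {β : Type*} [LinearOrder β] {S : Set ℕ} {e : β ↪o α} {K : Setoid β} {r : Setoid α}

theorem crossAt_comap_iff {a b c d : β} :
    CrossAt (Setoid.comap e r) a b c d ↔ CrossAt r (e a) (e b) (e c) (e d) := by
  rw [CrossAt, CrossAt, OrderEmbedding.cyc_iff]
  rfl

theorem exists_of_crossAt_of_mem_extensions (hr : r ∈ extensions S e K) {a b c d : α}
    (h : CrossAt r a b c d) :
    ∃ a' b' c' d', a = e a' ∧ b = e b' ∧ c = e c' ∧ d = e d' ∧ CrossAt K a' b' c' d' := by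
  obtain ⟨a', rfl⟩ := hr.2.2.1 _ _ _ _ h
  obtain ⟨b', rfl⟩ := hr.2.2.1 _ _ _ _ h.rotate
  obtain ⟨c', rfl⟩ := hr.2.2.1 _ _ _ _ h.rotate.rotate
  obtain ⟨d', rfl⟩ := hr.2.2.1 _ _ _ _ h.rotate.rotate.rotate
  refine ⟨a', b', c', d', rfl, rfl, rfl, rfl, ?_⟩
  rw [← hr.1, crossAt_comap_iff]
  exact h

theorem coreSet_of_mem_extensions (hr : r ∈ extensions S e K) : coreSet r = e '' coreSet K := by
  ext x
  constructor
  · rintro ⟨b, c, d, h⟩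
    obtain ⟨a', b', c', d', rfl, -, -, -, h'⟩ := exists_of_crossAt_of_mem_extensions hr h
    exact ⟨a', ⟨b', c', d', h'⟩, rfl⟩
  · rintro ⟨a, ⟨b, c, d, h⟩, rfl⟩
    rw [← hr.1, crossAt_comap_iff] at h
    exact ⟨_, _, _, h⟩

theorem crossNum_of_mem_extensions [Finite α] (hr : r ∈ extensions S e K) :
    crossNum r = crossNum K := by
  have : Finite β := Finite.of_injective e e.injective
  have h : cycSet r = (Prod.map e (Prod.map e (Prod.map e e))) '' cycSet K := by
    ext ⟨a, b, c, d⟩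
    constructor
    · intro h
      obtain ⟨a', b', c', d', rfl, rfl, rfl, rfl, h'⟩ := exists_of_crossAt_of_mem_extensions hr h
      exact ⟨(a', b', c', d'), h', rfl⟩
    · rintro ⟨⟨a', b', c', d'⟩, h, h'⟩
      rw [← h']
      have h : CrossAt K a' b' c' d' := h
      rw [← hr.1, crossAt_comap_iff] at h
      exact h
  have h2 : (cycSet r).ncard = (cycSet K).ncard := by
    rw [h, Set.ncard_image_of_injective]
    exact e.injective.prodMap (e.injective.prodMap (e.injective.prodMap e.injective))
  rw [ncard_cycSet, ncard_cycSet] at h2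
  omega

theorem sizesIn_of_mem_extensions (hr : r ∈ extensions S e K) (hK : SizesIn S K) :
    SizesIn S r := by
  intro x
  by_cases hx : x ∈ Set.range e
  · obtain ⟨u, rfl⟩ := hx
    have : {y | r (e u) y} = e '' {v | K u v} := by
      ext y
      simp only [Set.mem_ofPred_eq, Set.mem_image]
      constructor
      · intro h
        have hy : y ∈ Set.range e := by
          by_contra hy
          exact hr.2.1 u y hy h
        obtain ⟨v, rfl⟩ := hy
        exact ⟨v, by rw [← hr.1]; exact h, rfl⟩
      · rintro ⟨v, h, rfl⟩
        rw [← hr.1] at h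
        exact h
    rw [this, Set.ncard_image_of_injective _ e.injective]
    exact hK u
  · exact hr.2.2.2 x hx

theorem sizesIn_comap (hS : SizesIn S r) (h : ∀ u, ∀ x ∉ Set.range e, ¬ r (e u) x) :
    SizesIn S (Setoid.comap e r) := by
  intro u
  have : {y | r (e u) y} = e '' {v | Setoid.comap e r u v} := by
    ext y
    simp only [Set.mem_ofPred_eq, Set.mem_image, Setoid.comap_rel]
    constructor
    · intro h'
      have hy : y ∈ Set.range e := by
        by_contra hy
        exact h u y hy h'
      obtain ⟨v, rfl⟩ := hy
      exact ⟨v, h', rfl⟩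
    · rintro ⟨v, h, rfl⟩
      exact h
  rw [← Set.ncard_image_of_injective _ e.injective, ← this]
  exact hS _

end CrossNum

/-! ### Fibering over an embedded subset -/

section Fibering

-- A set of `m` points is the range of exactly one order embedding of `Fin m`, and `0` in the set
-- means `e 0 = 0`. Used for the block of `0` and for the core.
open Classical in
theorem ncard_eq_sum_orderEmbedding {m n : ℕ} [NeZero m] (A : Set (Setoid (Fin n)))
    (C : Setoid (Fin n) → Set (Fin n)) (hcard : ∀ r ∈ A, (C r).ncard = m)
    (hzero : ∀ r ∈ A, ∃ x ∈ C r, (x : ℕ) = 0) :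
    A.ncard = ∑ e : Fin m ↪o Fin n with (e 0 : ℕ) = 0, {r ∈ A | C r = Set.range e}.ncard := by
  have := Fintype.ofFinite (Setoid (Fin n))
  have hex : ∀ r ∈ A, ∃ e : Fin m ↪o Fin n, (e 0 : ℕ) = 0 ∧ C r = Set.range e := by
    intro r hr
    have hc : (C r).toFinset.card = m := by rw [← Set.ncard_eq_toFinset_card', hcard r hr]
    have hrange : C r = Set.range ((C r).toFinset.orderEmbOfFin hc) := by
      rw [Finset.range_orderEmbOfFin, Set.coe_toFinset]
    refine ⟨(C r).toFinset.orderEmbOfFin hc, ?_, hrange⟩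
    obtain ⟨x, hx, hx0⟩ := hzero r hr
    rw [hrange] at hx
    obtain ⟨j, hj⟩ := hx
    have h1 : (C r).toFinset.orderEmbOfFin hc 0 ≤ (C r).toFinset.orderEmbOfFin hc j :=
      OrderEmbedding.monotone _ (Fin.zero_le j)
    rw [hj, Fin.le_def] at h1
    omega
  rcases A.eq_empty_or_nonempty with rfl | ⟨r₀, hr₀⟩
  · simp
  have : Nonempty (Fin m ↪o Fin n) := ⟨(hex r₀ hr₀).choose⟩
  choose! f hf0 hf using hex
  have huniq : ∀ r ∈ A, ∀ e : Fin m ↪o Fin n, f r = e ↔ C r = Set.range e := by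
    intro r hr e
    rw [hf r hr]
    constructor
    · rintro rfl; rfl
    · intro h
      exact OrderEmbedding.range_inj.1 h
  rw [Set.ncard_eq_toFinset_card', Finset.card_eq_sum_card_fiberwise (f := f)
    (t := Finset.univ.filter fun e : Fin m ↪o Fin n => (e 0 : ℕ) = 0)
    (fun r hr => by simpa using hf0 r (by simpa using hr))]
  refine Finset.sum_congr rfl fun e _ => ?_
  rw [Set.ncard_eq_toFinset_card']
  congr 1
  ext r
  simp only [Finset.mem_filter, Set.mem_toFinset, Set.mem_ofPred_eq]
  exact and_congr_right fun hr => huniq r hr e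

end Fibering

/-! ### The recursion for noncrossing partitions -/

theorem nc_zero (S : Set ℕ) : nc S 0 = 1 := by
  have : ncSetoids S (Fin 0) = {⊤} := by
    ext r
    simp only [Set.mem_singleton_iff]
    exact ⟨fun _ => Setoid.ext fun a => a.elim0, fun _ => ⟨fun a => a.elim0, fun a => a.elim0⟩⟩
  rw [nc, ncCount, this, Set.ncard_singleton]

/-- Treating the block of `0` as the old relation makes the decomposition of noncrossing partitions
an instance of the insertion into regions. -/
theorem extensions_top_eq {m n : ℕ} [NeZero m] [NeZero n] {S : Set ℕ} (hm : m ∈ S)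
    {e : Fin m ↪o Fin n} (he : (e 0 : ℕ) = 0) :
    {r ∈ {r ∈ ncSetoids S (Fin n) | {y | r 0 y}.ncard = m} | {y | r 0 y} = Set.range e} =
      extensions S e ⊤ := by
  have he0 : e 0 = 0 := Fin.ext (by rw [he]; rfl)
  ext r
  constructor
  · rintro ⟨⟨⟨hnc, hS⟩, -⟩, hr⟩
    have h0 : ∀ u, r 0 (e u) := fun u => by
      have : e u ∈ {y | r 0 y} := hr ▸ ⟨u, rfl⟩
      exact this
    refine ⟨Setoid.ext fun u v => ?_, fun u x hx h => hx ?_, fun a b c d h => (hnc a b c d h).elim,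
      fun x _ => hS x⟩
    · rw [Setoid.comap_rel, Setoid.top_def]
      exact iff_of_true (r.trans (r.symm (h0 u)) (h0 v)) trivial
    · rw [← hr]; exact r.trans (h0 u) h
  · intro hr
    have h0 : {y | r 0 y} = Set.range e := by
      ext y
      constructor
      · intro h
        by_contra hy
        exact hr.2.1 0 y hy (by rw [he0]; exact h)
      · rintro ⟨u, rfl⟩
        have : Setoid.comap e r 0 u := by rw [hr.1]; trivial
        rw [Setoid.comap_rel, he0] at this
        exact this
    have hK : SizesIn S (⊤ : Setoid (Fin m)) := by
      intro x
      have : {y | (⊤ : Setoid (Fin m)) x y} = Set.univ :=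
        Set.eq_univ_of_forall fun y => trivial
      rw [this, Set.ncard_univ, Nat.card_fin]
      exact hm
    refine ⟨⟨⟨fun a b c d h => ?_, sizesIn_of_mem_extensions hr hK⟩, ?_⟩, h0⟩
    · obtain ⟨_, _, _, _, -, -, -, -, h'⟩ := exists_of_crossAt_of_mem_extensions hr h
      exact h'.2.2.2 trivial
    · rw [h0, ← Set.image_univ, Set.ncard_image_of_injective _ e.injective, Set.ncard_univ,
        Nat.card_fin]

theorem gapSetoid_top {m : ℕ} [NeZero m] : gapSetoid (⊤ : Setoid (Fin m)) = ⊥ := by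
  refine Setoid.ext fun i j => ⟨fun h => ?_, fun h => ?_⟩
  · have h' : ∀ u v : Fin m, ((u ≤ i ↔ v ≤ i) ↔ (u ≤ j ↔ v ≤ j)) := fun u v => h u v trivial
    have h1 := h' i 0
    have h2 := h' j 0
    simp only [Fin.zero_le, le_refl, iff_true, true_iff] at h1 h2
    exact le_antisymm h1 h2
  · have : i = j := h
    subst this
    exact (gapSetoid _).refl i

theorem regionSeries_one (S : Set ℕ) : regionSeries S 1 = PowerSeries.mk fun N => (nc S N : ℝ) := by
  ext N
  simp [regionSeries]

theorem fillSeries_top {m : ℕ} [NeZero m] (S : Set ℕ) :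
    fillSeries S (⊤ : Setoid (Fin m)) = regionSeries S 1 ^ m := by
  classical
  have hinj : Function.Injective (Quotient.mk (gapSetoid (⊤ : Setoid (Fin m)))) := by
    intro i j h
    have h' : gapSetoid (⊤ : Setoid (Fin m)) i j := Quotient.exact h
    rw [gapSetoid_top] at h'
    exact h'
  have hcard : ∀ R : Quotient (gapSetoid (⊤ : Setoid (Fin m))),
      (Finset.univ.filter fun j => Quotient.mk (gapSetoid ⊤) j = R).card = 1 := by
    intro R
    obtain ⟨j, rfl⟩ := Quotient.exists_rep R
    rw [Finset.card_eq_one]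
    refine ⟨j, ?_⟩
    ext i
    simp only [Finset.mem_filter, Finset.mem_univ, true_and, Finset.mem_singleton]
    exact hinj.eq_iff
  unfold fillSeries
  have : ∀ R ∈ (Finset.univ : Finset (Quotient (gapSetoid (⊤ : Setoid (Fin m))))),
      regionSeries S (Finset.univ.filter fun j => Quotient.mk (gapSetoid ⊤) j = R).card =
      regionSeries S 1 := fun R _ => by rw [hcard R]
  rw [Finset.prod_congr rfl fun R hR => by convert! this R hR, Finset.prod_const]
  congr 1
  rw [Finset.card_univ, ← Nat.card_eq_fintype_card]
  rw [Nat.card_congr (Equiv.ofBijective _ ⟨hinj, Quotient.mk_surjective⟩).symm, Nat.card_fin]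

open Classical in
/-- The generating function `1 + ∑_{s ∈ S} w ^ s`. -/
def blockSeries (S : Set ℕ) : PowerSeries ℝ :=
  PowerSeries.mk fun s => if s = 0 ∨ s ∈ S then 1 else 0

/-- The equation `B = f(X * B)`: if the block of `0` has `s` points, its `s` gaps are distinct
regions and carry independent noncrossing partitions. -/
theorem coeff_regionSeries_one {S : Set ℕ} (h0 : 0 ∉ S) (n : ℕ) :
    PowerSeries.coeff n (regionSeries S 1) = ∑ s ∈ Finset.range (n + 1),
      PowerSeries.coeff s (blockSeries S) *
        PowerSeries.coeff n ((PowerSeries.X * regionSeries S 1) ^ s) := by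
  classical
  rcases Nat.eq_zero_or_pos n with rfl | hn
  · simp [regionSeries_one, blockSeries, nc_zero]
  have : NeZero n := ⟨hn.ne'⟩
  have h1 : nc S n = ∑ s ∈ Finset.range (n + 1),
      {r ∈ ncSetoids S (Fin n) | {y | r 0 y}.ncard = s}.ncard := by
    have := Fintype.ofFinite (Setoid (Fin n))
    rw [nc, ncCount, Set.ncard_eq_toFinset_card', Finset.card_eq_sum_card_fiberwise
      (f := fun r : Setoid (Fin n) => {y | r 0 y}.ncard) (t := Finset.range (n + 1))]
    · refine Finset.sum_congr rfl fun s _ => ?_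
      rw [Set.ncard_eq_toFinset_card']
      congr 1
      ext r
      simp
    · intro r _
      have := Set.ncard_le_card ({y | r 0 y})
      rw [Nat.card_fin] at this
      simpa [Nat.lt_succ_iff] using this
  rw [regionSeries_one, PowerSeries.coeff_mk, h1, Nat.cast_sum]
  refine Finset.sum_congr rfl fun s hs => ?_
  rw [← regionSeries_one]
  rcases Nat.eq_zero_or_pos s with rfl | hs0
  -- The constant term of `blockSeries` only accounts for the empty partition.
  · rw [pow_zero, PowerSeries.coeff_one, if_neg hn.ne', mul_zero]
    have : {r ∈ ncSetoids S (Fin n) | {y | r 0 y}.ncard = 0} = ∅ := by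
      rw [Set.eq_empty_iff_forall_notMem]
      rintro r ⟨hr, h⟩
      have := hr.2 0
      rw [h] at this
      exact h0 this
    rw [this, Set.ncard_empty, Nat.cast_zero]
  have : NeZero s := ⟨hs0.ne'⟩
  rw [blockSeries, PowerSeries.coeff_mk]
  by_cases hsS : s ∈ S
  · rw [if_pos (Or.inr hsS), one_mul, ncard_eq_sum_orderEmbedding (m := s)
      {r ∈ ncSetoids S (Fin n) | {y | r 0 y}.ncard = s} (fun r => {y | r 0 y})
      (fun r hr => hr.2) (fun r _ => ⟨0, r.refl 0, rfl⟩)]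
    have hsn : s ≤ n := by simpa [Nat.lt_succ_iff] using hs
    have h2 := sum_ncard_extensions (N := n - s) (by omega) S (⊤ : Setoid (Fin s)) (n := n)
    rw [fillSeries_top] at h2
    rw [mul_pow, PowerSeries.coeff_X_pow_mul', if_pos hsn, ← h2]
    congr 1
    refine Finset.sum_congr (by congr!) fun e he => ?_
    rw [extensions_top_eq hsS (Finset.mem_filter.1 he).2]
  · rw [if_neg fun h => h.elim hs0.ne' hsS, zero_mul]
    have : {r ∈ ncSetoids S (Fin n) | {y | r 0 y}.ncard = s} = ∅ := by
      rw [Set.eq_empty_iff_forall_notMem]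
      rintro r ⟨hr, h⟩
      have := hr.2 0
      rw [h] at this
      exact hsS this
    rw [this, Set.ncard_empty, Nat.cast_zero]


/-! ### Counting by cores -/

/-- The equivalence relations with `k` crossings, class sizes in `S`, and all points in crossings. -/
def coreSetoids (S : Set ℕ) (k m : ℕ) : Set (Setoid (Fin m)) :=
  {K | SizesIn S K ∧ crossNum K = k ∧ coreSet K = Set.univ}

/-- The finite set of the core relations on `m` points. -/
def coreFinset (S : Set ℕ) (k m : ℕ) : Finset (Setoid (Fin m)) :=
  (Set.toFinite (coreSetoids S k m)).toFinset

/-- The equivalence relations with `k` crossings, class sizes in `S`, and `m` points in crossings. -/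
def withCoreSize (S : Set ℕ) (k n m : ℕ) : Set (Setoid (Fin n)) :=
  {r | SizesIn S r ∧ crossNum r = k ∧ (coreSet r).ncard = m}

variable {S : Set ℕ} {k m n : ℕ}

/-- Sort by the induced relation on the core. It keeps all crossings, so it is a core itself;
conversely an extension of a core creates no crossing and keeps the image of the core as its
`coreSet`. -/
theorem ncard_fiber_coreSet [NeZero m] {e : Fin m ↪o Fin n} (he : (e 0 : ℕ) = 0) :
    {r ∈ {r ∈ withCoreSize S k n m | ∃ x ∈ coreSet r, (x : ℕ) = 0} |
      coreSet r = Set.range e}.ncard =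
    ∑ K ∈ coreFinset S k m, (extensions S e K).ncard := by
  classical
  have := Fintype.ofFinite (Setoid (Fin n))
  have hsat : ∀ r : Setoid (Fin n), coreSet r = Set.range e →
      ∀ u, ∀ x ∉ Set.range e, ¬ r (e u) x := by
    intro r hr u x hx h
    rw [← hr] at hx
    exact hx (mem_coreSet_of_rel h (by rw [hr]; exact ⟨u, rfl⟩))
  have hext : ∀ r : Setoid (Fin n), SizesIn S r → coreSet r = Set.range e →
      r ∈ extensions S e (Setoid.comap e r) := fun r hS hr =>
    ⟨rfl, hsat r hr, fun a b c d h => by rw [← hr]; exact ⟨b, c, d, h⟩, fun x _ => hS x⟩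
  rw [Set.ncard_eq_toFinset_card', Finset.card_eq_sum_card_fiberwise
    (f := fun r => Setoid.comap e r) (t := coreFinset S k m)]
  · refine Finset.sum_congr rfl fun K hK => ?_
    rw [coreFinset, Set.Finite.mem_toFinset] at hK
    rw [Set.ncard_eq_toFinset_card']
    congr 1
    ext r
    simp only [Finset.mem_filter, Set.mem_toFinset]
    constructor
    · rintro ⟨⟨⟨⟨hS, -⟩, -⟩, hr⟩, rfl⟩
      exact hext r hS hr
    · intro hr
      have hc : coreSet r = Set.range e := by
        rw [coreSet_of_mem_extensions hr, hK.2.2, Set.image_univ]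
      refine ⟨⟨⟨⟨sizesIn_of_mem_extensions hr hK.1, ?_, ?_⟩, ⟨e 0, ?_, he⟩⟩, hc⟩, hr.1⟩
      · rw [crossNum_of_mem_extensions hr, hK.2.1]
      · rw [hc, ← Set.image_univ, Set.ncard_image_of_injective _ e.injective, Set.ncard_univ,
          Nat.card_fin]
      · rw [hc]; exact ⟨0, rfl⟩
  · intro r hr
    rw [Set.coe_toFinset] at hr
    obtain ⟨⟨⟨hS, hk, hm⟩, -⟩, hr⟩ := hr
    rw [coreFinset, Set.Finite.coe_toFinset]
    have h := hext r hS hr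
    refine ⟨sizesIn_comap hS (hsat r hr), ?_, ?_⟩
    · rw [← crossNum_of_mem_extensions h, hk]
    · have := coreSet_of_mem_extensions h
      rw [hr, ← Set.image_univ] at this
      exact (e.injective.image_injective this).symm

theorem ncard_rooted [NeZero m] : (({r ∈ withCoreSize S k n m |
      ∃ x ∈ coreSet r, (x : ℕ) = 0}.ncard : ℕ) : ℝ) =
    ∑ K ∈ coreFinset S k m,
      if m ≤ n then PowerSeries.coeff (n - m) (fillSeries S K) else 0 := by
  classical
  rw [ncard_eq_sum_orderEmbedding (m := m) _ coreSet (fun r hr => hr.1.2.2) (fun r hr => hr.2),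
    Finset.sum_congr rfl fun e he => ncard_fiber_coreSet (Finset.mem_filter.1 he).2,
    Finset.sum_comm, Nat.cast_sum]
  refine Finset.sum_congr rfl fun K _ => ?_
  split_ifs with h
  · rw [← sum_ncard_extensions (n := n) (by omega) S K]
  · have : IsEmpty (Fin m ↪o Fin n) :=
      ⟨fun e => h (by simpa using Fintype.card_le_of_injective e e.injective)⟩
    simp

/-! ### Rotation -/

theorem cyc_add_iff [NeZero n] (x : Fin n) {a b c d : Fin n} :
    Cyc (a + x) (b + x) (c + x) (d + x) ↔ Cyc a b c d := by
  simp only [Cyc, Fin.lt_def, Fin.val_add_eq_ite]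
  split_ifs <;> omega

/-- The rotation of an equivalence relation. -/
def rotate [NeZero n] (x : Fin n) (r : Setoid (Fin n)) : Setoid (Fin n) :=
  Setoid.comap (fun y => y + x) r

theorem rotate_apply [NeZero n] (x : Fin n) (r : Setoid (Fin n)) (a b : Fin n) :
    rotate x r a b ↔ r (a + x) (b + x) := Iff.rfl

theorem crossAt_rotate [NeZero n] {x : Fin n} {r : Setoid (Fin n)} {a b c d : Fin n} :
    CrossAt (rotate x r) a b c d ↔ CrossAt r (a + x) (b + x) (c + x) (d + x) := by
  rw [CrossAt, CrossAt, cyc_add_iff]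
  rfl

theorem mem_coreSet_rotate [NeZero n] {x y : Fin n} {r : Setoid (Fin n)} :
    y ∈ coreSet (rotate x r) ↔ y + x ∈ coreSet r := by
  constructor
  · rintro ⟨b, c, d, h⟩
    exact ⟨_, _, _, crossAt_rotate.1 h⟩
  · rintro ⟨b, c, d, h⟩
    refine ⟨b - x, c - x, d - x, crossAt_rotate.2 ?_⟩
    simpa using h

theorem rotate_mem_withCoreSize [NeZero n] {x : Fin n} {r : Setoid (Fin n)}
    (h : r ∈ withCoreSize S k n m) : rotate x r ∈ withCoreSize S k n m := by
  have hinj : Function.Injective fun y : Fin n => y + x := add_left_injective x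
  obtain ⟨hS, hk, hm⟩ := h
  refine ⟨fun y => ?_, ?_, ?_⟩
  · rw [← Set.ncard_image_of_injective _ hinj]
    have : (fun y : Fin n => y + x) '' {z | rotate x r y z} = {z | r (y + x) z} := by
      ext z
      constructor
      · rintro ⟨w, hw, rfl⟩; exact hw
      · intro hz
        exact ⟨z - x, by
          rw [Set.mem_ofPred_eq, rotate_apply, sub_add_cancel]; exact hz, by simp⟩
    rw [this]
    exact hS _
  · have h2 : (cycSet (rotate x r)).ncard = (cycSet r).ncard := by
      rw [← Set.ncard_image_of_injective (cycSet (rotate x r))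
        (hinj.prodMap (hinj.prodMap (hinj.prodMap hinj)))]
      congr 1
      ext ⟨a, b, c, d⟩
      constructor
      · rintro ⟨⟨a', b', c', d'⟩, h, h'⟩
        rw [← h']
        exact crossAt_rotate.1 h
      · intro h
        refine ⟨(a - x, b - x, c - x, d - x), crossAt_rotate.2 ?_, by simp⟩
        have h : CrossAt r a b c d := h
        simpa using h
    rw [ncard_cycSet, ncard_cycSet, hk] at h2
    omega
  · rw [← hm, ← Set.ncard_image_of_injective (coreSet (rotate x r)) hinj]
    congr 1
    ext z
    constructor
    · rintro ⟨w, hw, rfl⟩; exact mem_coreSet_rotate.1 hw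
    · intro hz
      exact ⟨z - x, mem_coreSet_rotate.2 (by simpa using hz), by simp⟩

theorem rotate_injective [NeZero n] (x : Fin n) : Function.Injective (rotate x) := by
  intro r s h
  refine Setoid.ext fun a b => ?_
  have := Setoid.ext_iff.1 h (a - x) (b - x)
  rwa [rotate_apply, rotate_apply, sub_add_cancel, sub_add_cancel] at this

theorem ncard_mem_coreSet_le [NeZero n] (y x : Fin n) :
    {r ∈ withCoreSize S k n m | y + x ∈ coreSet r}.ncard ≤
      {r ∈ withCoreSize S k n m | y ∈ coreSet r}.ncard :=
  Set.ncard_le_ncard_of_injOn (rotate x)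
    (fun _ hr => ⟨rotate_mem_withCoreSize hr.1, mem_coreSet_rotate.2 hr.2⟩)
    (rotate_injective x).injOn (Set.toFinite _)

theorem ncard_mem_coreSet [NeZero n] (x : Fin n) :
    {r ∈ withCoreSize S k n m | x ∈ coreSet r}.ncard =
      {r ∈ withCoreSize S k n m | ∃ x ∈ coreSet r, (x : ℕ) = 0}.ncard := by
  have h0 : {r ∈ withCoreSize S k n m | ∃ x ∈ coreSet r, (x : ℕ) = 0} =
      {r ∈ withCoreSize S k n m | 0 ∈ coreSet r} := by
    ext r
    refine and_congr_right fun _ => ⟨?_, fun h => ⟨0, h, rfl⟩⟩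
    rintro ⟨x, hx, hx0⟩
    rwa [show x = 0 from Fin.ext hx0] at hx
  rw [h0]
  apply le_antisymm
  · simpa using ncard_mem_coreSet_le (S := S) (k := k) (m := m) 0 x
  · simpa using ncard_mem_coreSet_le (S := S) (k := k) (m := m) x (-x)

/-- Double counting of pairs of a relation and a point of its core: by rotation, each of the `n`
points belongs to the core of equally many relations. -/
theorem mul_ncard_withCoreSize :
    m * (withCoreSize S k n m).ncard =
      n * {r ∈ withCoreSize S k n m | ∃ x ∈ coreSet r, (x : ℕ) = 0}.ncard := by
  classical
  rcases Nat.eq_zero_or_pos n with rfl | hn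
  · rw [zero_mul, mul_eq_zero]
    by_contra! h
    obtain ⟨r, hr⟩ := Set.nonempty_of_ncard_ne_zero h.2
    refine h.1 ?_
    rw [← hr.2.2, Set.ncard_eq_zero, Set.eq_empty_iff_forall_notMem]
    exact fun x => x.elim0
  have : NeZero n := ⟨hn.ne'⟩
  have := Fintype.ofFinite (Setoid (Fin n))
  have h := Finset.sum_card_bipartiteAbove_eq_sum_card_bipartiteBelow
    (s := (withCoreSize S k n m).toFinset) (t := (Finset.univ : Finset (Fin n)))
    (fun r x => x ∈ coreSet r)
  have h1 : ∀ r ∈ (withCoreSize S k n m).toFinset,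
      (Finset.univ.bipartiteAbove (fun (r : Setoid (Fin n)) x => x ∈ coreSet r) r).card = m := by
    intro r hr
    rw [Set.mem_toFinset] at hr
    rw [← hr.2.2, Set.ncard_eq_toFinset_card']
    congr 1
    ext x
    simp [Finset.mem_bipartiteAbove]
  have h2 : ∀ x ∈ (Finset.univ : Finset (Fin n)),
      ((withCoreSize S k n m).toFinset.bipartiteBelow
        (fun (r : Setoid (Fin n)) x => x ∈ coreSet r) x).card =
      {r ∈ withCoreSize S k n m | ∃ x ∈ coreSet r, (x : ℕ) = 0}.ncard := by
    intro x _
    rw [← ncard_mem_coreSet x, Set.ncard_eq_toFinset_card']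
    congr 1
    ext r
    simp [Finset.mem_bipartiteBelow]
  rw [Finset.sum_congr rfl h1, Finset.sum_congr rfl h2, Finset.sum_const, Finset.sum_const,
    Finset.card_univ, Fintype.card_fin, smul_eq_mul, smul_eq_mul,
    ← Set.ncard_eq_toFinset_card'] at h
  rw [mul_comm, h]

theorem ncard_setoids_eq (hk : 1 ≤ k) (n : ℕ) :
    (({r : Setoid (Fin n) | SizesIn S r ∧ crossNum r = k}.ncard : ℕ) : ℝ) =
      ∑ m ∈ Finset.Icc 1 (4 * k), (n : ℝ) / m * ∑ K ∈ coreFinset S k m,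
        if m ≤ n then PowerSeries.coeff (n - m) (fillSeries S K) else 0 := by
  classical
  have := Fintype.ofFinite (Setoid (Fin n))
  rw [Set.ncard_eq_toFinset_card', Finset.card_eq_sum_card_fiberwise
    (f := fun r : Setoid (Fin n) => (coreSet r).ncard) (t := Finset.Icc 1 (4 * k)), Nat.cast_sum]
  · refine Finset.sum_congr rfl fun m hm => ?_
    have hm1 := (Finset.mem_Icc.1 hm).1
    have : NeZero m := ⟨by omega⟩
    have hm' : (m : ℝ) ≠ 0 := by positivity
    rw [← ncard_rooted, div_mul_eq_mul_div, eq_div_iff hm', mul_comm]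
    have h := mul_ncard_withCoreSize (S := S) (k := k) (n := n) (m := m)
    have h2 : (Finset.filter (fun r : Setoid (Fin n) => (coreSet r).ncard = m)
        {r : Setoid (Fin n) | SizesIn S r ∧ crossNum r = k}.toFinset).card =
        (withCoreSize S k n m).ncard := by
      rw [Set.ncard_eq_toFinset_card']
      congr 1
      ext r
      rw [Set.mem_toFinset, Finset.mem_filter, Set.mem_toFinset]
      exact and_assoc
    rw [h2]
    exact_mod_cast h
  · intro r hr
    rw [Set.coe_toFinset] at hr
    rw [Finset.coe_Icc, Set.mem_Icc, ← hr.2]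
    refine ⟨?_, ncard_coreSet_le r⟩
    have h := coreSet_nonempty (r := r) (by rw [hr.2]; omega)
    exact (Set.ncard_pos (Set.toFinite _)).2 h


/-! ### Chords of the unit circle -/

/-- The point of the unit circle with parameter `t`, the vertices having parameters `0, …, m - 1`. -/
def circlePt (m : ℕ) (t : ℝ) : ℂ := Complex.exp (((2 * Real.pi * t / m : ℝ) : ℂ) * Complex.I)

/-- An affine function that vanishes on the line through the points with parameters `a` and `b`. -/
def side (m : ℕ) (a b : ℝ) (z : ℂ) : ℝ :=
  (z * Complex.exp (((-(Real.pi * (a + b) / m) : ℝ) : ℂ) * Complex.I)).re -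
    Real.cos (Real.pi * (b - a) / m)

variable {m : ℕ} {a b t : ℝ}

theorem vertex_eq_circlePt (j : Fin m) : vertex m j = circlePt m (j : ℕ) := by
  rw [vertex, circlePt]
  congr 1
  push_cast; ring

theorem norm_circlePt (t : ℝ) : ‖circlePt m t‖ = 1 := Complex.norm_exp_ofReal_mul_I _

theorem continuous_circlePt : Continuous (circlePt m) := by
  unfold circlePt; fun_prop

theorem continuous_side : Continuous (side m a b) := by
  unfold side; fun_prop

/-- In this product the sign on the circle can be read off from the positions of `t` relative to `a`
and `b`. -/
theorem side_circlePt : side m a b (circlePt m t) =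
    -2 * Real.sin (Real.pi * (t - a) / m) * Real.sin (Real.pi * (t - b) / m) := by
  rw [side, circlePt, ← Complex.exp_add, ← add_mul, ← Complex.ofReal_add,
    Complex.exp_ofReal_mul_I_re, Real.cos_sub_cos]
  have e1 : (2 * Real.pi * t / m + -(Real.pi * (a + b) / m) + Real.pi * (b - a) / m) / 2 =
      Real.pi * (t - a) / m := by ring
  have e2 : (2 * Real.pi * t / m + -(Real.pi * (a + b) / m) - Real.pi * (b - a) / m) / 2 =
      Real.pi * (t - b) / m := by ring
  rw [e1, e2]

theorem side_combo {x y : ℝ} (h : x + y = 1) (p q : ℂ) :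
    side m a b (x • p + y • q) = x * side m a b p + y * side m a b q := by
  simp only [side, Complex.real_smul, add_mul, mul_assoc, Complex.add_re, Complex.re_ofReal_mul]
  linear_combination (Real.cos (Real.pi * (b - a) / m)) * h

theorem sin_pos_of_lt {x : ℝ} (h0 : 0 < x) (h : x < m) : 0 < Real.sin (Real.pi * x / m) := by
  have hm : (0 : ℝ) < m := h0.trans h
  refine Real.sin_pos_of_pos_of_lt_pi (div_pos (mul_pos Real.pi_pos h0) hm) ?_
  rw [div_lt_iff₀ hm]
  exact mul_lt_mul_of_pos_left h Real.pi_pos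

theorem sin_neg_of_lt {x : ℝ} (h0 : x < 0) (h : -x < m) : Real.sin (Real.pi * x / m) < 0 := by
  have := sin_pos_of_lt (neg_pos.2 h0) h
  rw [mul_neg, neg_div, Real.sin_neg] at this
  linarith

theorem side_pos (h1 : a < t) (h2 : t < b) (h3 : t - a < m) (h4 : b - t < m) :
    0 < side m a b (circlePt m t) := by
  rw [side_circlePt]
  have := sin_pos_of_lt (sub_pos.2 h1) h3
  have := sin_neg_of_lt (sub_neg.2 h2) (by linarith)
  nlinarith

theorem side_neg_of_lt (h1 : t < a) (h2 : t < b) (h3 : a - t < m) (h4 : b - t < m) :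
    side m a b (circlePt m t) < 0 := by
  rw [side_circlePt]
  have := sin_neg_of_lt (sub_neg.2 h1) (by linarith)
  have := sin_neg_of_lt (sub_neg.2 h2) (by linarith)
  nlinarith

theorem side_neg_of_gt (h1 : a < t) (h2 : b < t) (h3 : t - a < m) (h4 : t - b < m) :
    side m a b (circlePt m t) < 0 := by
  rw [side_circlePt]
  have := sin_pos_of_lt (sub_pos.2 h1) h3
  have := sin_pos_of_lt (sub_pos.2 h2) h4
  nlinarith

theorem side_left : side m a b (circlePt m a) = 0 := by rw [side_circlePt]; simp

theorem side_right : side m a b (circlePt m b) = 0 := by rw [side_circlePt]; simp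

theorem side_eq_zero_of_mem_segment {z : ℂ} (hz : z ∈ segment ℝ (circlePt m a) (circlePt m b)) :
    side m a b z = 0 := by
  obtain ⟨x, y, -, -, hxy, rfl⟩ := hz
  rw [side_combo hxy, side_left, side_right]; ring

theorem convex_side_pos : Convex ℝ {z | 0 < side m a b z} := by
  intro p hp q hq x y hx hy hxy
  rw [Set.mem_ofPred_eq] at hp hq ⊢
  rw [side_combo hxy]
  rcases hx.eq_or_lt with rfl | hx
  · rw [zero_add] at hxy; subst hxy; linarith
  · nlinarith [mul_pos hx hp, mul_nonneg hy hq.le]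

theorem convex_side_neg : Convex ℝ {z | side m a b z < 0} := by
  intro p hp q hq x y hx hy hxy
  rw [Set.mem_ofPred_eq] at hp hq ⊢
  rw [side_combo hxy]
  rcases hx.eq_or_lt with rfl | hx
  · rw [zero_add] at hxy; subst hxy; linarith
  · nlinarith [mul_pos hx (neg_pos.2 hp), mul_nonneg hy (neg_pos.2 hq).le]

theorem convex_side_nonpos : Convex ℝ {z | side m a b z ≤ 0} := by
  intro p hp q hq x y hx hy hxy
  rw [Set.mem_ofPred_eq] at hp hq ⊢
  rw [side_combo hxy]
  nlinarith [mul_nonneg hx (neg_nonneg.2 hp), mul_nonneg hy (neg_nonneg.2 hq)]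

/-- Rotated so that the chord is vertical, `z` has real part `cos δ` and, being in the disk,
imaginary part between `-sin δ` and `sin δ`. This gives its barycentric weights. -/
theorem mem_segment_of_side_eq_zero (hab : a < b) (hba : b - a < m) {z : ℂ}
    (hz : side m a b z = 0) (hn : ‖z‖ ≤ 1) : z ∈ segment ℝ (circlePt m a) (circlePt m b) := by
  set δ := Real.pi * (b - a) / m with hδ
  set γ := Real.pi * (a + b) / m with hγ
  have hs : 0 < Real.sin δ := sin_pos_of_lt (sub_pos.2 hab) hba
  set c := Complex.exp ((γ : ℂ) * Complex.I) with hc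
  set w := z * Complex.exp (((-γ : ℝ) : ℂ) * Complex.I) with hw
  have hzw : z = c * w := by
    rw [hw, hc, mul_left_comm, ← Complex.exp_add, ← add_mul, ← Complex.ofReal_add, add_neg_cancel]
    simp
  have hre : w.re = Real.cos δ := by
    rw [side, sub_eq_zero] at hz; exact hz
  have hwn : ‖w‖ ≤ 1 := by
    rw [hw, norm_mul, Complex.norm_exp_ofReal_mul_I, mul_one]; exact hn
  have him : w.im ^ 2 ≤ Real.sin δ ^ 2 := by
    have h1 : ‖w‖ ^ 2 ≤ 1 := pow_le_one₀ (norm_nonneg _) hwn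
    rw [← Complex.normSq_eq_norm_sq, Complex.normSq_apply, hre] at h1
    nlinarith [Real.sin_sq_add_cos_sq δ]
  have him' := abs_le_of_sq_le_sq' him hs.le
  have ha : circlePt m a = c * Complex.exp (((-δ : ℝ) : ℂ) * Complex.I) := by
    rw [hc, ← Complex.exp_add, ← add_mul, ← Complex.ofReal_add, circlePt]
    congr 3
    rw [hδ, hγ]; ring
  have hb : circlePt m b = c * Complex.exp ((δ : ℂ) * Complex.I) := by
    rw [hc, ← Complex.exp_add, ← add_mul, ← Complex.ofReal_add, circlePt]
    congr 3
    rw [hδ, hγ]; ring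
  refine ⟨(Real.sin δ - w.im) / (2 * Real.sin δ), (Real.sin δ + w.im) / (2 * Real.sin δ),
    div_nonneg (by linarith [him'.2]) (by linarith), div_nonneg (by linarith [him'.1])
    (by linarith), by field_simp; ring, ?_⟩
  rw [ha, hb, hzw, Complex.real_smul, Complex.real_smul, mul_left_comm, mul_left_comm _ c,
    ← mul_add]
  congr 1
  apply Complex.ext
  · rw [Complex.add_re, Complex.re_ofReal_mul, Complex.re_ofReal_mul, Complex.exp_ofReal_mul_I_re,
      Complex.exp_ofReal_mul_I_re, Real.cos_neg, hre]
    field_simp; ring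
  · rw [Complex.add_im, Complex.im_ofReal_mul, Complex.im_ofReal_mul, Complex.exp_ofReal_mul_I_im,
      Complex.exp_ofReal_mul_I_im, Real.sin_neg]
    field_simp; ring

theorem natCast_sub_lt (i j : Fin m) : ((i : ℕ) : ℝ) - (j : ℕ) < m := by
  have h1 : ((i : ℕ) : ℝ) < m := by exact_mod_cast i.2
  have h2 : (0 : ℝ) ≤ ((j : ℕ) : ℝ) := Nat.cast_nonneg _
  linarith

theorem chordsCross_iff {u₁ u₂ v₁ v₂ : Fin m} (hu : u₁ < u₂) (hv : v₁ < v₂) (huv : u₁ < v₁)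
    (h1 : u₂ ≠ v₁) (h2 : u₂ ≠ v₂) : ChordsCross u₁ u₂ v₁ v₂ ↔ v₁ < u₂ ∧ u₂ < v₂ := by
  have cast : ∀ {i j : Fin m}, i < j → ((i : ℕ) : ℝ) < (j : ℕ) := fun h => by exact_mod_cast h
  have hd := natCast_sub_lt (m := m)
  constructor
  · rintro ⟨z, hzu, hzv⟩
    rw [vertex_eq_circlePt, vertex_eq_circlePt] at hzu hzv
    have hz := side_eq_zero_of_mem_segment (openSegment_subset_segment ℝ _ _ hzu)
    have hzv' := openSegment_subset_segment ℝ _ _ hzv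
    by_contra hcon
    rcases lt_or_gt_of_ne h1 with h | h
    · have := convex_side_neg.segment_subset
        (x := circlePt m (v₁ : ℕ)) (y := circlePt m (v₂ : ℕ))
        (side_neg_of_gt (cast huv) (cast h) (hd _ _) (hd _ _))
        (side_neg_of_gt (cast (huv.trans hv)) (cast (h.trans hv)) (hd _ _) (hd _ _)) hzv'
      exact absurd hz (ne_of_lt this)
    · have h' : v₂ < u₂ := lt_of_le_of_ne (not_lt.1 fun h'' => hcon ⟨h, h''⟩) h2.symm
      have := convex_side_pos.segment_subset
        (x := circlePt m (v₁ : ℕ)) (y := circlePt m (v₂ : ℕ))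
        (side_pos (cast huv) (cast h) (hd _ _) (hd _ _))
        (side_pos (cast (huv.trans hv)) (cast h') (hd _ _) (hd _ _)) hzv'
      exact absurd hz (ne_of_gt this)
  · rintro ⟨h, h'⟩
    set s := side m (u₁ : ℕ) (u₂ : ℕ) (circlePt m (v₁ : ℕ)) with hs
    set s' := side m (u₁ : ℕ) (u₂ : ℕ) (circlePt m (v₂ : ℕ)) with hs'
    have hpos : 0 < s := side_pos (cast huv) (cast h) (hd _ _) (hd _ _)
    have hneg : s' < 0 := side_neg_of_gt (cast (huv.trans hv)) (cast h') (hd _ _) (hd _ _)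
    have hne : s - s' ≠ 0 := by linarith
    have hsum : -s' / (s - s') + s / (s - s') = 1 := by field_simp; ring
    -- The weights make the affine function `side` of the line `u₁u₂` vanish at `z`.
    set z := (-s' / (s - s')) • circlePt m (v₁ : ℕ) + (s / (s - s')) • circlePt m (v₂ : ℕ)
      with hz
    have hzv : z ∈ openSegment ℝ (circlePt m (v₁ : ℕ)) (circlePt m (v₂ : ℕ)) :=
      ⟨_, _, div_pos (by linarith) (by linarith), div_pos hpos (by linarith), hsum, rfl⟩
    have hz0 : side m (u₁ : ℕ) (u₂ : ℕ) z = 0 := by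
      rw [hz, side_combo hsum, ← hs, ← hs']; ring
    have hzn : ‖z‖ ≤ 1 := by
      have := (convex_closedBall (0 : ℂ) 1).segment_subset
        (x := circlePt m (v₁ : ℕ)) (y := circlePt m (v₂ : ℕ))
        (by simp [norm_circlePt]) (by simp [norm_circlePt]) (openSegment_subset_segment ℝ _ _ hzv)
      simpa using this
    have hzu := mem_segment_of_side_eq_zero (cast hu) (hd _ _) hz0 hzn
    have hzv0 := side_eq_zero_of_mem_segment (openSegment_subset_segment ℝ _ _ hzv)
    refine ⟨z, ?_, ?_⟩
    · rw [vertex_eq_circlePt, vertex_eq_circlePt]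
      -- The point `z` lies on the line `v₁v₂`, whereas `u₁` and `u₂` lie strictly on its two sides.
      refine mem_openSegment_of_ne_left_right ?_ ?_ hzu
      · intro heq
        rw [← heq] at hzv0
        exact absurd hzv0 (ne_of_lt
          (side_neg_of_lt (cast huv) (cast (huv.trans hv)) (hd _ _) (hd _ _)))
      · intro heq
        rw [← heq] at hzv0
        exact absurd hzv0 (ne_of_gt (side_pos (cast h) (cast h') (hd _ _) (hd _ _)))
    · rw [vertex_eq_circlePt, vertex_eq_circlePt]
      exact hzv

/-! ### Partitions as equivalence relations -/

/-- The equivalence relation of a partition. -/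
def toSetoid (P : Partition m) : Setoid (Fin m) := Setoid.ker P.part

theorem toSetoid_iff {P : Partition m} {x y : Fin m} :
    toSetoid P x y ↔ ∃ B ∈ P.parts, x ∈ B ∧ y ∈ B := by
  rw [toSetoid, Setoid.ker_def]
  constructor
  · intro h
    exact ⟨P.part x, P.part_mem.2 (Finset.mem_univ x), P.mem_part (Finset.mem_univ x),
      h ▸ P.mem_part (Finset.mem_univ y)⟩
  · rintro ⟨B, hB, hx, hy⟩
    rw [P.part_eq_of_mem hB hx, P.part_eq_of_mem hB hy]

theorem toSetoid_iff_mem {P : Partition m} {B : Finset (Fin m)} (hB : B ∈ P.parts) {x y : Fin m}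
    (hx : x ∈ B) : toSetoid P x y ↔ y ∈ B := by
  rw [toSetoid_iff]
  constructor
  · rintro ⟨B', hB', hx', hy⟩
    rwa [P.eq_of_mem_parts hB hB' hx hx']
  · exact fun hy => ⟨B, hB, hx, hy⟩

theorem toSetoid_bijective : Function.Bijective (toSetoid : Partition m → Setoid (Fin m)) := by
  classical
  constructor
  · intro P Q h
    have hpart : ∀ x, P.part x = Q.part x := by
      intro x
      ext y
      rw [← toSetoid_iff_mem (P.part_mem.2 (Finset.mem_univ x)) (P.mem_part (Finset.mem_univ x)), h,
        toSetoid_iff_mem (Q.part_mem.2 (Finset.mem_univ x)) (Q.mem_part (Finset.mem_univ x))]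
    have key : ∀ P Q : Partition m, (∀ x, P.part x = Q.part x) → P.parts ⊆ Q.parts := by
      intro P Q h B hB
      obtain ⟨x, hx⟩ := P.nonempty_of_mem_parts hB
      rw [← P.part_eq_of_mem hB hx, h x]
      exact Q.part_mem.2 (Finset.mem_univ x)
    exact Finpartition.ext (Finset.Subset.antisymm (key P Q hpart) (key Q P fun x => (hpart x).symm))
  · intro r
    refine ⟨Finpartition.ofSetoid r, Setoid.ext fun x y => ?_⟩
    rw [toSetoid_iff_mem (Finpartition.part_mem _ |>.2 (Finset.mem_univ x))
      (Finpartition.mem_part _ (Finset.mem_univ x)), Finpartition.mem_part_ofSetoid_iff_rel]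

theorem hasBlockSizesIn_iff {S : Set ℕ} {P : Partition m} :
    HasBlockSizesIn S P ↔ SizesIn S (toSetoid P) := by
  have h : ∀ B ∈ P.parts, ∀ x ∈ B, {y | toSetoid P x y}.ncard = B.card := by
    intro B hB x hx
    rw [← Set.ncard_coe_finset]
    congr 1
    ext y
    exact toSetoid_iff_mem hB hx
  constructor
  · intro hP x
    rw [h _ (P.part_mem.2 (Finset.mem_univ x)) x (P.mem_part (Finset.mem_univ x))]
    exact hP _ (P.part_mem.2 (Finset.mem_univ x))
  · intro hP B hB
    obtain ⟨x, hx⟩ := P.nonempty_of_mem_parts hB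
    rw [← h B hB x hx]
    exact hP x

theorem crossings_eq (P : Partition m) : crossings P = crossSet (toSetoid P) := by
  ext ⟨⟨u₁, u₂⟩, v₁, v₂⟩
  constructor
  · rintro ⟨hu, hv, huv, hc, U, hU, V, hV, hUV, h1, h2, h3, h4⟩
    have hne : ∀ x ∈ U, ∀ y ∈ V, x ≠ y := by
      rintro x hx _ hy rfl
      exact hUV (P.eq_of_mem_parts hU hV hx hy)
    have h := (chordsCross_iff hu hv huv (hne _ h2 _ h3) (hne _ h2 _ h4)).1 hc
    refine ⟨huv, h.1, h.2, toSetoid_iff.2 ⟨U, hU, h1, h2⟩, toSetoid_iff.2 ⟨V, hV, h3, h4⟩, ?_⟩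
    rw [toSetoid_iff_mem hU h1]
    exact fun h5 => hne _ h5 _ h3 rfl
  · rintro ⟨h1, h2, h3, h4, h5, h6⟩
    simp only at h1 h2 h3 h4 h5 h6
    refine ⟨h1.trans h2, h2.trans h3, h1, (chordsCross_iff (h1.trans h2) (h2.trans h3) h1
      h2.ne' h3.ne).2 ⟨h2, h3⟩, ?_⟩
    obtain ⟨U, hU, hu1, hu2⟩ := toSetoid_iff.1 h4
    obtain ⟨V, hV, hv1, hv2⟩ := toSetoid_iff.1 h5
    refine ⟨U, hU, V, hV, ?_, hu1, hu2, hv1, hv2⟩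
    rintro rfl
    exact h6 (toSetoid_iff.2 ⟨U, hU, hu1, hv1⟩)

theorem crossingNumber_eq (P : Partition m) : crossingNumber P = crossNum (toSetoid P) := by
  rw [crossingNumber, crossings_eq, crossNum]

theorem isCore_iff {P : Partition m} : IsCore P ↔ coreSet (toSetoid P) = Set.univ := by
  have hc : ∀ c ∈ crossSet (toSetoid P),
      CrossAt (toSetoid P) c.1.1 c.2.1 c.1.2 c.2.2 := fun c hc =>
    ⟨Or.inl ⟨hc.1, hc.2.1, hc.2.2.1⟩, hc.2.2.2.1, hc.2.2.2.2.1, hc.2.2.2.2.2⟩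
  rw [Set.eq_univ_iff_forall]
  constructor
  · intro h x
    obtain ⟨c, hcP, h'⟩ := h _ (P.part_mem.2 (Finset.mem_univ x))
    rw [crossings_eq] at hcP
    have hx := P.mem_part (Finset.mem_univ x)
    rcases h' with h' | h'
    · exact (hc c hcP).mem_coreSet ((toSetoid_iff_mem (P.part_mem.2 (Finset.mem_univ x)) hx).2 h')
    · exact (hc c hcP).rotate.mem_coreSet
        ((toSetoid_iff_mem (P.part_mem.2 (Finset.mem_univ x)) hx).2 h')
  · intro h B hB
    obtain ⟨x, hx⟩ := P.nonempty_of_mem_parts hB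
    obtain ⟨b, c, d, hcr⟩ := h x
    rw [crossings_eq]
    obtain ⟨hcyc, hr⟩ := id hcr
    have hrel : toSetoid P x c := hr.1
    have hcB : c ∈ B := (toSetoid_iff_mem hB hx).1 hrel
    rcases hcyc with h' | h' | h' | h'
    · exact ⟨((x, c), (b, d)), ⟨h'.1, h'.2.1, h'.2.2, hr⟩, Or.inl hx⟩
    · exact ⟨((b, d), (c, x)), ⟨h'.1, h'.2.1, h'.2.2, hcr.rotate.2⟩, Or.inr hcB⟩
    · exact ⟨((c, x), (d, b)), ⟨h'.1, h'.2.1, h'.2.2, hcr.rotate.rotate.2⟩, Or.inl hcB⟩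
    · exact ⟨((d, b), (x, c)), ⟨h'.1, h'.2.1, h'.2.2, hcr.rotate.rotate.rotate.2⟩, Or.inr hx⟩

theorem partitionCount_eq (S : Set ℕ) (k n : ℕ) :
    partitionCount S k n = {r : Setoid (Fin n) | SizesIn S r ∧ crossNum r = k}.ncard := by
  rw [partitionCount, ← Set.ncard_image_of_injective _ toSetoid_bijective.1]
  congr 1
  ext r
  constructor
  · rintro ⟨P, ⟨h1, h2⟩, rfl⟩
    exact ⟨hasBlockSizesIn_iff.1 h1, by rw [← crossingNumber_eq, h2]⟩
  · rintro ⟨h1, h2⟩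
    obtain ⟨P, rfl⟩ := toSetoid_bijective.2 r
    exact ⟨P, ⟨hasBlockSizesIn_iff.2 h1, by rw [crossingNumber_eq, h2]⟩, rfl⟩

theorem mem_cores_iff {S : Set ℕ} {k : ℕ} {P : Partition m} :
    (⟨m, P⟩ : Σ n : ℕ, Partition n) ∈ cores S k ↔ toSetoid P ∈ coreSetoids S k m := by
  change IsCore P ∧ crossingNumber P = k ∧ HasBlockSizesIn S P ↔
    SizesIn S (toSetoid P) ∧ crossNum (toSetoid P) = k ∧ coreSet (toSetoid P) = Set.univ
  rw [isCore_iff, crossingNumber_eq, hasBlockSizesIn_iff]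
  tauto


/-! ### Regions and boundary arcs -/

variable {m : ℕ}

/-- The open arc between the vertices `j` and `j + 1`. -/
def arc (m : ℕ) (j : Fin m) : Set ℂ := circlePt m '' Set.Ioo ((j : ℕ) : ℝ) ((j : ℕ) + 1)

/-- The midpoint of the arc between the vertices `j` and `j + 1`. -/
def midPt (m : ℕ) (j : Fin m) : ℂ := circlePt m ((j : ℕ) + 1 / 2)

theorem midPt_mem_arc (j : Fin m) : midPt m j ∈ arc m j :=
  ⟨(j : ℕ) + 1 / 2, ⟨by linarith, by linarith⟩, rfl⟩

theorem isPreconnected_arc (j : Fin m) : IsPreconnected (arc m j) :=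
  isPreconnected_Ioo.image _ continuous_circlePt.continuousOn

theorem natCast_add_one_le (j : Fin m) : ((j : ℕ) : ℝ) + 1 ≤ m := by exact_mod_cast j.2

theorem cast_cases {i j : Fin m} (h : i ≠ j) :
    ((i : ℕ) : ℝ) + 1 ≤ (j : ℕ) ∨ ((j : ℕ) : ℝ) + 1 ≤ (i : ℕ) := by
  rcases lt_or_gt_of_ne h with h | h
  · left; exact_mod_cast h
  · right; exact_mod_cast h

theorem side_arc_self (hm : 2 ≤ m) (j : Fin m) {z : ℂ} (hz : z ∈ arc m j) :
    0 < side m (j : ℕ) ((j : ℕ) + 1) z := by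
  obtain ⟨t, ht, rfl⟩ := hz
  have : (2 : ℝ) ≤ m := by exact_mod_cast hm
  exact side_pos ht.1 ht.2 (by linarith [ht.2]) (by linarith [ht.1])

theorem side_arc_ne {i j : Fin m} (h : i ≠ j) {z : ℂ} (hz : z ∈ arc m i) :
    side m (j : ℕ) ((j : ℕ) + 1) z < 0 := by
  obtain ⟨t, ht, rfl⟩ := hz
  have hi := natCast_add_one_le i
  have hj := natCast_add_one_le j
  have hi0 : (0 : ℝ) ≤ ((i : ℕ) : ℝ) := Nat.cast_nonneg _
  have hj0 : (0 : ℝ) ≤ ((j : ℕ) : ℝ) := Nat.cast_nonneg _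
  rcases cast_cases h with h' | h'
  · exact side_neg_of_lt (by linarith [ht.2]) (by linarith [ht.2]) (by linarith [ht.1])
      (by linarith [ht.1])
  · exact side_neg_of_gt (by linarith [ht.1]) (by linarith [ht.1]) (by linarith [ht.2])
      (by linarith [ht.2])

theorem side_vertex_nonpos (hm : 2 ≤ m) (i j : Fin m) :
    side m (j : ℕ) ((j : ℕ) + 1) (vertex m i) ≤ 0 := by
  rw [vertex_eq_circlePt]
  have hi := natCast_add_one_le i
  have hj := natCast_add_one_le j
  have hi0 : (0 : ℝ) ≤ ((i : ℕ) : ℝ) := Nat.cast_nonneg _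
  have hj0 : (0 : ℝ) ≤ ((j : ℕ) : ℝ) := Nat.cast_nonneg _
  rw [side_circlePt]
  rcases eq_or_ne i j with rfl | h
  · simp
  rcases cast_cases h with h' | h'
  · have h1 := sin_neg_of_lt (m := m) (x := (i : ℕ) - (j : ℕ)) (by linarith) (by linarith)
    have h2 : Real.sin (Real.pi * ((i : ℕ) - ((j : ℕ) + 1)) / m) ≤ 0 := by
      -- Equality is the wrap-around `i = 0`, `j + 1 = m`: the vertex is then an end of the chord.
      rcases (show (-m : ℝ) ≤ (i : ℕ) - ((j : ℕ) + 1) by linarith).eq_or_lt with h3 | h3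
      · have hm0 : (m : ℝ) ≠ 0 := by
          have : (2 : ℝ) ≤ m := by exact_mod_cast hm
          linarith
        rw [← h3, mul_neg, neg_div, mul_div_cancel_right₀ _ hm0]
        simp
      · exact (sin_neg_of_lt (by linarith) (by linarith)).le
    nlinarith
  · have h1 := sin_pos_of_lt (m := m) (x := (i : ℕ) - (j : ℕ)) (by linarith) (by linarith)
    have h2 : 0 ≤ Real.sin (Real.pi * ((i : ℕ) - ((j : ℕ) + 1)) / m) := by
      rcases h'.eq_or_lt with h3 | h3
      · rw [h3]; simp
      · exact (sin_pos_of_lt (by linarith) (by linarith)).le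
    nlinarith

/-- The line through consecutive vertices has the open arc strictly on one side and every vertex,
hence every block, on the other closed side. -/
theorem arc_subset_diskComplement (hm : 2 ≤ m) (P : Partition m) (j : Fin m) :
    arc m j ⊆ diskComplement P := by
  intro z hz
  refine ⟨?_, ?_⟩
  · obtain ⟨t, -, rfl⟩ := hz
    simp [norm_circlePt]
  · intro h
    simp only [Set.mem_iUnion] at h
    obtain ⟨B, -, hB⟩ := h
    have h1 : convexHull ℝ (vertex m '' (B : Set (Fin m))) ⊆
        {z | side m (j : ℕ) ((j : ℕ) + 1) z ≤ 0} := by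
      refine convexHull_min ?_ convex_side_nonpos
      rintro _ ⟨i, -, rfl⟩
      exact side_vertex_nonpos hm i j
    exact absurd (side_arc_self hm j hz) (not_lt.2 (h1 hB))

theorem exists_circlePt_eq (hm : 2 ≤ m) {z : ℂ} (hz : ‖z‖ = 1) :
    ∃ t : ℝ, 0 ≤ t ∧ t < m ∧ z = circlePt m t := by
  have hm0 : (0 : ℝ) < m := by
    have : (2 : ℝ) ≤ m := by exact_mod_cast hm
    linarith
  have hpi := Real.pi_pos
  have h1 := Complex.norm_mul_exp_arg_mul_I z
  rw [hz, Complex.ofReal_one, one_mul] at h1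
  have h2 := Complex.neg_pi_lt_arg z
  have h3 := Complex.arg_le_pi z
  rcases le_or_gt 0 z.arg with h | h
  · refine ⟨z.arg * m / (2 * Real.pi), by positivity, ?_, ?_⟩
    · rw [div_lt_iff₀ (by positivity)]; nlinarith
    · rw [circlePt]
      have : 2 * Real.pi * (z.arg * m / (2 * Real.pi)) / m = z.arg := by field_simp
      rw [this, h1]
  · refine ⟨(z.arg + 2 * Real.pi) * m / (2 * Real.pi), ?_, ?_, ?_⟩
    · have : 0 ≤ z.arg + 2 * Real.pi := by linarith
      positivity
    · rw [div_lt_iff₀ (by positivity)]; nlinarith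
    · rw [circlePt]
      have : 2 * Real.pi * ((z.arg + 2 * Real.pi) * m / (2 * Real.pi)) / m =
          z.arg + 2 * Real.pi := by field_simp
      rw [this, Complex.ofReal_add, add_mul, Complex.exp_add, h1]
      push_cast
      rw [Complex.exp_two_pi_mul_I, mul_one]

theorem exists_mem_arc (hm : 2 ≤ m) {P : Partition m} {z : ℂ} (hz : z ∈ diskComplement P)
    (hn : ‖z‖ = 1) : ∃ j, z ∈ arc m j := by
  obtain ⟨t, ht0, htm, rfl⟩ := exists_circlePt_eq hm hn
  have hfl : ⌊t⌋₊ < m := (Nat.floor_lt ht0).2 htm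
  refine ⟨⟨⌊t⌋₊, hfl⟩, t, ⟨?_, Nat.lt_floor_add_one t⟩, rfl⟩
  -- An integer parameter is a vertex, which is covered by the hull of its block.
  refine lt_of_le_of_ne (Nat.floor_le ht0) fun h => hz.2 ?_
  simp only [Set.mem_iUnion]
  refine ⟨P.part ⟨⌊t⌋₊, hfl⟩, P.part_mem.2 (Finset.mem_univ _), subset_convexHull _ _
    ⟨⟨⌊t⌋₊, hfl⟩, P.mem_part (Finset.mem_univ _), ?_⟩⟩
  rw [vertex_eq_circlePt]
  exact congrArg _ h

/-- A chord of a block separates the complement of the partition. -/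
theorem side_ne_zero (P : Partition m) {u v : Fin m} (huv : u < v) (hr : toSetoid P u v) {z : ℂ}
    (hz : z ∈ diskComplement P) : side m (u : ℕ) (v : ℕ) z ≠ 0 := by
  intro h
  obtain ⟨B, hB, hu, hv⟩ := toSetoid_iff.1 hr
  have h1 := mem_segment_of_side_eq_zero (a := (u : ℕ)) (b := (v : ℕ)) (by exact_mod_cast huv)
    (natCast_sub_lt v u) h (by simpa using hz.1)
  rw [← vertex_eq_circlePt, ← vertex_eq_circlePt] at h1
  refine hz.2 ?_
  simp only [Set.mem_iUnion]
  have hmem : ∀ w ∈ B, vertex m w ∈ convexHull ℝ (vertex m '' (B : Set (Fin m))) :=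
    fun w hw => subset_convexHull ℝ _ ⟨w, hw, rfl⟩
  exact ⟨B, hB, (convex_convexHull ℝ _).segment_subset (hmem u hu) (hmem v hv) h1⟩

theorem side_pos_iff_of_isPreconnected {a b : ℝ} {T : Set ℂ} (hT : IsPreconnected T)
    (h : ∀ z ∈ T, side m a b z ≠ 0) {x y : ℂ} (hx : x ∈ T) (hy : y ∈ T) :
    0 < side m a b x ↔ 0 < side m a b y := by
  have key : ∀ x ∈ T, ∀ y ∈ T, 0 < side m a b x → 0 < side m a b y := by
    intro x hx y hy hpos
    by_contra hcon
    obtain ⟨z, hz, h0⟩ := hT.intermediate_value hy hx continuous_side.continuousOn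
      (show (0 : ℝ) ∈ Set.Icc _ _ from ⟨not_lt.1 hcon, hpos.le⟩)
    exact h z hz h0
  exact ⟨key x hx y hy, key y hy x hx⟩

theorem side_midPt_pos_iff {u v : Fin m} (huv : u < v) (i : Fin m) :
    0 < side m (u : ℕ) (v : ℕ) (midPt m i) ↔ u ≤ i ∧ i < v := by
  have hi := natCast_add_one_le i
  have hi0 : (0 : ℝ) ≤ ((i : ℕ) : ℝ) := Nat.cast_nonneg _
  have hu0 : (0 : ℝ) ≤ ((u : ℕ) : ℝ) := Nat.cast_nonneg _
  have hu := natCast_add_one_le u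
  have hv := natCast_add_one_le v
  have hv0 : (0 : ℝ) ≤ ((v : ℕ) : ℝ) := Nat.cast_nonneg _
  have huv' : ((u : ℕ) : ℝ) < (v : ℕ) := by exact_mod_cast huv
  constructor
  · intro h
    by_contra hcon
    rw [not_and_or, not_le, not_lt] at hcon
    rcases hcon with h' | h'
    · have h'' : ((i : ℕ) : ℝ) + 1 ≤ (u : ℕ) := by exact_mod_cast h'
      exact absurd h (not_lt.2 (side_neg_of_lt (by linarith) (by linarith) (by linarith)
        (by linarith)).le)
    · have h'' : ((v : ℕ) : ℝ) ≤ (i : ℕ) := by exact_mod_cast h'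
      exact absurd h (not_lt.2 (side_neg_of_gt (by linarith) (by linarith) (by linarith)
        (by linarith)).le)
  · rintro ⟨h1, h2⟩
    have h1' : ((u : ℕ) : ℝ) ≤ (i : ℕ) := by exact_mod_cast h1
    have h2' : ((i : ℕ) : ℝ) + 1 ≤ (v : ℕ) := by exact_mod_cast h2
    exact side_pos (by linarith) (by linarith) (by linarith) (by linarith)

theorem side_vertex_pos {i j u : Fin m} (h : i < u ∧ u ≤ j) :
    0 < side m ((i : ℕ) + 1 / 2) ((j : ℕ) + 1 / 2) (vertex m u) := by
  rw [vertex_eq_circlePt]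
  have hi0 : (0 : ℝ) ≤ ((i : ℕ) : ℝ) := Nat.cast_nonneg _
  have hu0 : (0 : ℝ) ≤ ((u : ℕ) : ℝ) := Nat.cast_nonneg _
  have hu := natCast_add_one_le u
  have hj := natCast_add_one_le j
  have h1 : ((i : ℕ) : ℝ) + 1 ≤ (u : ℕ) := by exact_mod_cast h.1
  have h2 : ((u : ℕ) : ℝ) ≤ (j : ℕ) := by exact_mod_cast h.2
  exact side_pos (by linarith) (by linarith) (by linarith) (by linarith)

theorem side_vertex_neg {i j u : Fin m} (hij : i < j) (h : ¬ (i < u ∧ u ≤ j)) :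
    side m ((i : ℕ) + 1 / 2) ((j : ℕ) + 1 / 2) (vertex m u) < 0 := by
  rw [vertex_eq_circlePt]
  have hi0 : (0 : ℝ) ≤ ((i : ℕ) : ℝ) := Nat.cast_nonneg _
  have hu0 : (0 : ℝ) ≤ ((u : ℕ) : ℝ) := Nat.cast_nonneg _
  have hu := natCast_add_one_le u
  have hj := natCast_add_one_le j
  have hij' : ((i : ℕ) : ℝ) < (j : ℕ) := by exact_mod_cast hij
  rw [not_and_or, not_lt, not_le] at h
  rcases h with h | h
  · have h1 : ((u : ℕ) : ℝ) ≤ (i : ℕ) := by exact_mod_cast h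
    exact side_neg_of_lt (by linarith) (by linarith) (by linarith) (by linarith)
  · have h1 : ((j : ℕ) : ℝ) + 1 ≤ (u : ℕ) := by exact_mod_cast h
    exact side_neg_of_gt (by linarith) (by linarith) (by linarith) (by linarith)

/-- The region that contains the arc after `j`. -/
def regionOf (P : Partition m) (j : Fin m) : Set ℂ :=
  connectedComponentIn (diskComplement P) (midPt m j)

theorem midPt_mem_diskComplement (hm : 2 ≤ m) (P : Partition m) (j : Fin m) :
    midPt m j ∈ diskComplement P := arc_subset_diskComplement hm P j (midPt_mem_arc j)

theorem arc_subset_regionOf (hm : 2 ≤ m) (P : Partition m) (j : Fin m) :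
    arc m j ⊆ regionOf P j :=
  (isPreconnected_arc j).subset_connectedComponentIn (midPt_mem_arc j)
    (arc_subset_diskComplement hm P j)

/-- The roles are exchanged: no block having points on both sides of the line through the two
midpoints, each hull lies strictly on one side of it. -/
theorem segment_midPt_subset {P : Partition m} {i j : Fin m} (hij : i < j)
    (h : gapSetoid (toSetoid P) i j) :
    segment ℝ (midPt m i) (midPt m j) ⊆ diskComplement P := by
  intro z hz
  refine ⟨?_, fun hmem => ?_⟩
  · exact (convex_closedBall (0 : ℂ) 1).segment_subset (by simp [midPt, norm_circlePt])
      (by simp [midPt, norm_circlePt]) hz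
  · simp only [Set.mem_iUnion] at hmem
    obtain ⟨B, hB, hzB⟩ := hmem
    have hz0 := side_eq_zero_of_mem_segment hz
    obtain ⟨u, hu⟩ := P.nonempty_of_mem_parts hB
    have hall : ∀ v ∈ B, ((i < u ∧ u ≤ j) ↔ (i < v ∧ v ≤ j)) := by
      intro v hv
      have := h u v (toSetoid_iff.2 ⟨B, hB, hu, hv⟩)
      grind
    by_cases hc : i < u ∧ u ≤ j
    · have h1 : convexHull ℝ (vertex m '' (B : Set (Fin m))) ⊆
          {z | 0 < side m ((i : ℕ) + 1 / 2) ((j : ℕ) + 1 / 2) z} := by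
        refine convexHull_min ?_ convex_side_pos
        rintro _ ⟨v, hv, rfl⟩
        exact side_vertex_pos ((hall v hv).1 hc)
      exact absurd hz0 (ne_of_gt (h1 hzB))
    · have h1 : convexHull ℝ (vertex m '' (B : Set (Fin m))) ⊆
          {z | side m ((i : ℕ) + 1 / 2) ((j : ℕ) + 1 / 2) z < 0} := by
        refine convexHull_min ?_ convex_side_neg
        rintro _ ⟨v, hv, rfl⟩
        exact side_vertex_neg hij fun h' => hc ((hall v hv).2 h')
      exact absurd hz0 (ne_of_lt (h1 hzB))

/-- `side` of a chord of a block has constant sign on a region, so a separating chord forces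
distinct regions. Without one, the segment between the midpoints joins the two arcs. -/
theorem regionOf_eq_iff (hm : 2 ≤ m) (P : Partition m) (i j : Fin m) :
    regionOf P i = regionOf P j ↔ gapSetoid (toSetoid P) i j := by
  constructor
  · intro h u v huv
    have hi : midPt m i ∈ regionOf P i :=
      mem_connectedComponentIn (midPt_mem_diskComplement hm P i)
    have hj : midPt m j ∈ regionOf P i :=
      h ▸ mem_connectedComponentIn (midPt_mem_diskComplement hm P j)
    have hpre : IsPreconnected (regionOf P i) := isPreconnected_connectedComponentIn
    have hsub : regionOf P i ⊆ diskComplement P := connectedComponentIn_subset _ _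
    have key : ∀ u v : Fin m, u < v → toSetoid P u v →
        ((u ≤ i ↔ v ≤ i) ↔ (u ≤ j ↔ v ≤ j)) := by
      intro u v huv hr
      have h1 := side_pos_iff_of_isPreconnected hpre
        (fun z hz => side_ne_zero P huv hr (hsub hz)) hi hj
      rw [side_midPt_pos_iff huv, side_midPt_pos_iff huv] at h1
      grind
    rcases lt_trichotomy u v with h' | rfl | h'
    · exact key u v h' huv
    · simp
    · have := key v u h' ((toSetoid P).symm huv)
      tauto
  · intro h
    have key : ∀ i j : Fin m, i < j → gapSetoid (toSetoid P) i j →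
        regionOf P i = regionOf P j := by
      intro i j hij h
      refine connectedComponentIn_eq ?_
      exact (convex_segment _ _).isPreconnected.subset_connectedComponentIn
        (left_mem_segment ℝ _ _) (segment_midPt_subset hij h) (right_mem_segment ℝ _ _)
    rcases lt_trichotomy i j with h' | rfl | h'
    · exact key i j h' h
    · rfl
    · exact (key j i h' ((gapSetoid _).symm h)).symm

theorem eq_regionOf_of_mem (hm : 2 ≤ m) {P : Partition m} {R : Set ℂ} (hR : R ∈ regions P) {z : ℂ}
    (hz : z ∈ R) {j : Fin m} (hj : z ∈ arc m j) : R = regionOf P j := by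
  obtain ⟨x, -, rfl⟩ := hR
  rw [connectedComponentIn_eq hz]
  exact (connectedComponentIn_eq (arc_subset_regionOf hm P j hj)).symm

theorem regionOf_mem_regions (hm : 2 ≤ m) (P : Partition m) (j : Fin m) :
    regionOf P j ∈ regions P := ⟨_, midPt_mem_diskComplement hm P j, rfl⟩

theorem regions_subset_diskComplement {P : Partition m} {R : Set ℂ} (hR : R ∈ regions P) :
    R ⊆ diskComplement P := by
  obtain ⟨x, -, rfl⟩ := hR
  exact connectedComponentIn_subset _ _

theorem arc_subset_sphere (j : Fin m) : arc m j ⊆ Metric.sphere 0 1 := by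
  rintro _ ⟨t, -, rfl⟩
  simp [norm_circlePt]

/-- `side` of the chord from `j` to `j + 1` is nonzero on all open arcs and positive only on the
`j`-th, so a connected set of boundary points cannot leave that arc. -/
theorem connectedComponentIn_arc (hm : 2 ≤ m) {P : Partition m} {R : Set ℂ} (hR : R ∈ regions P)
    {z : ℂ} (hz : z ∈ R) {j : Fin m} (hj : z ∈ arc m j) :
    connectedComponentIn (R ∩ Metric.sphere 0 1) z = arc m j := by
  have hRj := eq_regionOf_of_mem hm hR hz hj
  have hz' : z ∈ R ∩ Metric.sphere 0 1 := ⟨hz, arc_subset_sphere j hj⟩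
  apply Set.Subset.antisymm
  · intro y hy
    have hsub := connectedComponentIn_subset (R ∩ Metric.sphere 0 1) z
    have harc : ∀ w ∈ connectedComponentIn (R ∩ Metric.sphere 0 1) z, ∃ l, w ∈ arc m l :=
      fun w hw => exists_mem_arc hm (regions_subset_diskComplement hR (hsub hw).1)
        (by simpa using (hsub hw).2)
    obtain ⟨l, hl⟩ := harc y hy
    rcases eq_or_ne l j with rfl | hlj
    · exact hl
    · have h := (side_pos_iff_of_isPreconnected (m := m) (a := (j : ℕ)) (b := (j : ℕ) + 1)
        isPreconnected_connectedComponentIn (fun w hw => ?_)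
        (mem_connectedComponentIn hz') hy).1 (side_arc_self hm j hj)
      · exact absurd h (not_lt.2 (side_arc_ne hlj hl).le)
      · obtain ⟨l', hl'⟩ := harc w hw
        rcases eq_or_ne l' j with rfl | hlj'
        · exact (side_arc_self hm _ hl').ne'
        · exact (side_arc_ne hlj' hl').ne
  · refine (isPreconnected_arc j).subset_connectedComponentIn hj fun y hy =>
      ⟨?_, arc_subset_sphere j hy⟩
    rw [hRj]
    exact arc_subset_regionOf hm P j hy

theorem arc_injective (hm : 2 ≤ m) : Function.Injective (arc m) := by
  intro i j h
  by_contra hij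
  have h2 : midPt m j ∈ arc m i := by rw [h]; exact midPt_mem_arc j
  exact absurd (side_arc_self hm j (midPt_mem_arc j)) (not_lt.2 (side_arc_ne hij h2).le)

theorem boundaryArcs_regionOf (hm : 2 ≤ m) (P : Partition m) (j : Fin m) :
    boundaryArcs (regionOf P j) = arc m '' {l | gapSetoid (toSetoid P) l j} := by
  have hR := regionOf_mem_regions hm P j
  ext A
  constructor
  · rintro ⟨x, hx, rfl⟩
    obtain ⟨l, hl⟩ := exists_mem_arc hm (regions_subset_diskComplement hR hx.1)
      (by simpa using hx.2)
    refine ⟨l, ?_, (connectedComponentIn_arc hm hR hx.1 hl).symm⟩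
    exact (regionOf_eq_iff hm P l j).1 (eq_regionOf_of_mem hm hR hx.1 hl).symm
  · rintro ⟨l, hl, rfl⟩
    have h1 : midPt m l ∈ regionOf P j := by
      rw [← (regionOf_eq_iff hm P l j).2 hl]
      exact arc_subset_regionOf hm P l (midPt_mem_arc l)
    exact ⟨midPt m l, ⟨h1, arc_subset_sphere l (midPt_mem_arc l)⟩,
      (connectedComponentIn_arc hm hR h1 (midPt_mem_arc l)).symm⟩

open Classical in
theorem regionCount_eq (hm : 2 ≤ m) (P : Partition m) {i : ℕ} (hi : 1 ≤ i) :
    regionCount i P = (Finset.univ.filter fun R : Quotient (gapSetoid (toSetoid P)) =>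
      (Finset.univ.filter fun j => Quotient.mk (gapSetoid (toSetoid P)) j = R).card = i).card := by
  set f : Quotient (gapSetoid (toSetoid P)) → Set ℂ := fun R => regionOf P R.out with hf
  have hfmk : ∀ j, f (Quotient.mk _ j) = regionOf P j := fun j => by
    rw [hf]
    exact (regionOf_eq_iff hm P _ _).2 (Quotient.mk_out j)
  have hinj : Function.Injective f := by
    intro R R' h
    rw [← Quotient.out_eq R, ← Quotient.out_eq R']
    exact Quotient.sound ((regionOf_eq_iff hm P _ _).1 h)
  have hcard : ∀ j, (boundaryArcs (regionOf P j)).ncard = (Finset.univ.filter fun l =>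
      Quotient.mk (gapSetoid (toSetoid P)) l = Quotient.mk _ j).card := by
    intro j
    rw [boundaryArcs_regionOf hm, Set.ncard_image_of_injective _ (arc_injective hm),
      ← Set.ncard_coe_finset]
    congr 1
    ext l
    rw [Finset.coe_filter, Set.mem_ofPred_eq, Set.mem_ofPred_eq, Quotient.eq]
    simp
  rw [regionCount, ← Set.ncard_coe_finset, ← Set.ncard_image_of_injective _ hinj]
  congr 1
  ext R
  constructor
  · rintro ⟨hR, hRi⟩
    -- Regions that do not touch the circle correspond to no class of gaps; `1 ≤ i` rules them out.
    obtain ⟨A, x, hx, -⟩ := Set.nonempty_of_ncard_ne_zero (s := boundaryArcs R) (by omega)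
    obtain ⟨j, hj⟩ := exists_mem_arc hm (regions_subset_diskComplement hR hx.1)
      (by simpa using hx.2)
    have hRj := eq_regionOf_of_mem hm hR hx.1 hj
    refine ⟨Quotient.mk _ j, ?_, by rw [hfmk, hRj]⟩
    rw [Finset.coe_filter, Set.mem_ofPred_eq, ← hcard, ← hRj]
    exact ⟨Finset.mem_univ _, hRi⟩
  · rintro ⟨Q, hQ, rfl⟩
    obtain ⟨j, rfl⟩ := Quotient.exists_rep Q
    rw [Finset.coe_filter, Set.mem_ofPred_eq, ← hcard] at hQ
    rw [hfmk]
    exact ⟨regionOf_mem_regions hm P j, hQ.2⟩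


/-! ### The weights of the blocks -/

section BlockWeights

/-- The sum `∑_{s ∈ S} s τ_S ^ s`. -/
def blockSum (S : Set ℕ) : ℝ := ∑' s : S, ((s : ℕ) : ℝ) * tau S ^ (s : ℕ)

/-- The weight `τ_S ^ s` of the sizes `s ∈ S ∪ {0}`. -/
def blockWeight (S : Set ℕ) (s : ℕ) : ℝ := PowerSeries.coeff s (blockSeries S) * tau S ^ s

variable {S : Set ℕ}

theorem exists_two_le_mem (h0 : 0 ∉ S) (hne : S.Nonempty) (h1 : S ≠ {1}) : ∃ a ∈ S, 2 ≤ a := by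
  by_contra! hcon
  refine h1 (Set.eq_singleton_iff_nonempty_unique_mem.2 ⟨hne, fun s hs => ?_⟩)
  have h2 := hcon s hs
  have h3 : s ≠ 0 := fun h => h0 (h ▸ hs)
  omega

theorem blockWeight_zero (S : Set ℕ) : blockWeight S 0 = 1 := by
  simp [blockWeight, blockSeries]

theorem blockWeight_of_mem {s : ℕ} (hs : s ∈ S) : blockWeight S s = tau S ^ s := by
  simp [blockWeight, blockSeries, hs]

theorem blockWeight_of_notMem {s : ℕ} (h : s ≠ 0) (hs : s ∉ S) : blockWeight S s = 0 := by
  simp [blockWeight, blockSeries, hs, h]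

theorem blockWeight_nonneg (hτ : IsTau S (tau S)) (s : ℕ) : 0 ≤ blockWeight S s := by
  rw [blockWeight, blockSeries, PowerSeries.coeff_mk]
  have := pow_nonneg hτ.1.le s
  split_ifs <;> simp [this]

theorem blockWeight_le (hτ : IsTau S (tau S)) (s : ℕ) : blockWeight S s ≤ tau S ^ s := by
  rw [blockWeight, blockSeries, PowerSeries.coeff_mk]
  have := pow_nonneg hτ.1.le s
  split_ifs <;> simp [this]

/-- If `τ ≥ 1`, infinitely many terms of the defining series would be at least `1`. So `τ` is
strictly inside the unit disk, and the weights have all moments. -/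
theorem tau_lt_one_of_infinite (hτ : IsTau S (tau S)) (hS : S.Infinite) : tau S < 1 := by
  by_contra! hcon
  have := hS.to_subtype
  have h := hτ.2.summable.tendsto_cofinite_zero.eventually (gt_mem_nhds zero_lt_one)
  have hfin : {s : S | (s : ℕ) ≤ 1}.Finite :=
    Set.Finite.preimage Subtype.val_injective.injOn (Set.finite_Iic 1)
  obtain ⟨s, hs, hs'⟩ := (h.and hfin.compl_mem_cofinite).exists
  have h2 : (2 : ℝ) ≤ ((s : ℕ) : ℝ) := by
    have : ¬ (s : ℕ) ≤ 1 := hs'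
    exact_mod_cast (by omega : 2 ≤ (s : ℕ))
  have h3 : 1 ≤ tau S ^ (s : ℕ) := one_le_pow₀ hcon
  nlinarith

theorem summable_pow_mul_blockWeight (hτ : IsTau S (tau S)) (j : ℕ) :
    Summable fun s : ℕ => (s : ℝ) ^ j * blockWeight S s := by
  rcases S.finite_or_infinite with hf | hf
  · refine summable_of_ne_finset_zero (s := insert 0 hf.toFinset) fun s hs => ?_
    rw [Finset.mem_insert, Set.Finite.mem_toFinset, not_or] at hs
    rw [blockWeight_of_notMem hs.1 hs.2, mul_zero]
  · have hn : ‖tau S‖ < 1 := by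
      rw [Real.norm_of_nonneg hτ.1.le]
      exact tau_lt_one_of_infinite hτ hf
    refine Summable.of_nonneg_of_le (fun s => mul_nonneg (by positivity) (blockWeight_nonneg hτ s))
      (fun s => ?_) (summable_pow_mul_geometric_of_norm_lt_one j hn)
    exact mul_le_mul_of_nonneg_left (blockWeight_le hτ s) (by positivity)

theorem summable_blockWeight (hτ : IsTau S (tau S)) : Summable (blockWeight S) := by
  simpa using summable_pow_mul_blockWeight hτ 0

theorem summable_mul_blockWeight (hτ : IsTau S (tau S)) :
    Summable fun s : ℕ => (s : ℝ) * blockWeight S s := by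
  simpa using summable_pow_mul_blockWeight hτ 1

/-- Sums over `S` as sums over `ℕ`, for summands that vanish at `0`. -/
theorem tsum_mul_blockWeight {g : ℕ → ℝ} (hg : g 0 = 0) :
    ∑' s : S, g s * tau S ^ (s : ℕ) = ∑' s : ℕ, g s * blockWeight S s := by
  rw [tsum_subtype S fun s => g s * tau S ^ s]
  refine tsum_congr fun s => ?_
  by_cases hs : s ∈ S
  · rw [Set.indicator_of_mem hs, blockWeight_of_mem hs]
  · rw [Set.indicator_of_notMem hs]
    rcases eq_or_ne s 0 with rfl | h
    · rw [hg, zero_mul]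
    · rw [blockWeight_of_notMem h hs, mul_zero]

theorem blockSum_eq (S : Set ℕ) : blockSum S = ∑' s : ℕ, (s : ℝ) * blockWeight S s :=
  tsum_mul_blockWeight (g := fun s => (s : ℝ)) Nat.cast_zero

theorem hasSum_mul_blockWeight (hτ : IsTau S (tau S)) :
    HasSum (fun s : ℕ => (s : ℝ) * blockWeight S s) (blockSum S) := by
  rw [blockSum_eq]
  exact (summable_mul_blockWeight hτ).hasSum

/-- The size `0` contributes `-1` and cancels the defining sum of `τ`: the normalized weights have
mean `1`. -/
theorem hasSum_sub_one_mul_blockWeight (h0 : 0 ∉ S) (hτ : IsTau S (tau S)) :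
    HasSum (fun s : ℕ => ((s : ℝ) - 1) * blockWeight S s) 0 := by
  have h := (hasSum_subtype_iff_indicator (f := fun s : ℕ => ((s : ℝ) - 1) * tau S ^ s)).1 hτ.2
  have h2 := h.add (hasSum_ite_eq 0 (-1 : ℝ))
  rw [add_neg_cancel] at h2
  refine h2.congr_fun fun s => ?_
  by_cases hs : s ∈ S
  · have : s ≠ 0 := fun h => h0 (h ▸ hs)
    rw [Set.indicator_of_mem hs, blockWeight_of_mem hs, if_neg this, add_zero]
  · rw [Set.indicator_of_notMem hs]
    rcases eq_or_ne s 0 with rfl | h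
    · rw [if_pos rfl, blockWeight_zero]; simp
    · rw [blockWeight_of_notMem h hs, if_neg h, mul_zero, add_zero]

theorem hasSum_blockWeight (h0 : 0 ∉ S) (hτ : IsTau S (tau S)) :
    HasSum (blockWeight S) (blockSum S) := by
  have h := (hasSum_mul_blockWeight hτ).sub (hasSum_sub_one_mul_blockWeight h0 hτ)
  rw [sub_zero] at h
  exact h.congr_fun fun s => by ring

theorem blockSum_pos (h0 : 0 ∉ S) (hτ : IsTau S (tau S)) : 0 < blockSum S := by
  have h := le_hasSum (hasSum_blockWeight h0 hτ) 0 fun s _ => blockWeight_nonneg hτ s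
  rw [blockWeight_zero] at h
  linarith

theorem rho_pos (h0 : 0 ∉ S) (hτ : IsTau S (tau S)) : 0 < rho S :=
  div_pos hτ.1 (blockSum_pos h0 hτ)

theorem rho_mul_blockSum (h0 : 0 ∉ S) (hτ : IsTau S (tau S)) : rho S * blockSum S = tau S :=
  div_mul_cancel₀ _ (blockSum_pos h0 hτ).ne'

/-- The variance of the normalized weights of the blocks. -/
def blockVar (S : Set ℕ) : ℝ := (∑' s : ℕ, ((s : ℝ) - 1) ^ 2 * blockWeight S s) / blockSum S

theorem summable_sq_mul_blockWeight (hτ : IsTau S (tau S)) :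
    Summable fun s : ℕ => ((s : ℝ) - 1) ^ 2 * blockWeight S s := by
  have h := ((summable_pow_mul_blockWeight hτ 2).sub
    ((summable_mul_blockWeight hτ).mul_left 2)).add (summable_blockWeight hτ)
  exact h.congr fun s => by ring

theorem blockVar_pos (h0 : 0 ∉ S) (hτ : IsTau S (tau S)) (ha : ∃ a ∈ S, 2 ≤ a) :
    0 < blockVar S := by
  obtain ⟨a, haS, ha⟩ := ha
  refine div_pos ((summable_sq_mul_blockWeight hτ).tsum_pos
    (fun s => mul_nonneg (sq_nonneg _) (blockWeight_nonneg hτ s)) a ?_) (blockSum_pos h0 hτ)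
  have : (2 : ℝ) ≤ a := by exact_mod_cast ha
  rw [blockWeight_of_mem haS]
  have := pow_pos hτ.1 a
  have : 0 < (a : ℝ) - 1 := by linarith
  positivity

/-- Since `s (s - 1) = (s - 1) + (s - 1) ^ 2` and the first part sums to `0`, the factorial moment
in `beta` is the variance times `blockSum`. -/
theorem beta_eq (h0 : 0 ∉ S) (hτ : IsTau S (tau S)) :
    beta S = blockSum S * √2 / √(blockVar S) := by
  have hF := blockSum_pos h0 hτ
  have h : ∑' s : S, ((s : ℕ) : ℝ) * (((s : ℕ) : ℝ) - 1) * tau S ^ (s : ℕ) =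
      blockSum S * blockVar S := by
    rw [tsum_mul_blockWeight (g := fun s => (s : ℝ) * ((s : ℝ) - 1)) (by simp), blockVar,
      mul_div_cancel₀ _ hF.ne']
    have h2 := (hasSum_sub_one_mul_blockWeight h0 hτ).add (summable_sq_mul_blockWeight hτ).hasSum
    rw [zero_add] at h2
    rw [← h2.tsum_eq]
    exact tsum_congr fun s => by ring
  rw [beta, h, ← blockSum]
  have : 2 * blockSum S ^ 3 / (blockSum S * blockVar S) =
      blockSum S ^ 2 * 2 / blockVar S := by
    field_simp
  rw [this, Real.sqrt_div (by positivity), Real.sqrt_mul (by positivity), Real.sqrt_sq hF.le]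

theorem beta_pos (h0 : 0 ∉ S) (hτ : IsTau S (tau S)) (ha : ∃ a ∈ S, 2 ≤ a) : 0 < beta S := by
  rw [beta_eq h0 hτ]
  have := blockSum_pos h0 hτ
  have := blockVar_pos h0 hτ ha
  positivity

theorem setGcd_pos (ha : ∃ a ∈ S, 2 ≤ a) : 0 < Nat.setGcd S := by
  obtain ⟨a, haS, ha⟩ := ha
  exact Nat.pos_of_dvd_of_pos (Nat.setGcd_dvd_of_mem haS) (by omega)

theorem blockWeight_of_not_dvd {s : ℕ} (h : ¬ Nat.setGcd S ∣ s) : blockWeight S s = 0 :=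
  blockWeight_of_notMem (fun hs => h (hs ▸ dvd_zero _)) fun hs => h (Nat.setGcd_dvd_of_mem hs)

/-- The normalized weights of the multiples of `gcd(S)`. -/
def latticeLaw (S : Set ℕ) (t : ℕ) : ℝ := blockWeight S (Nat.setGcd S * t) / blockSum S

theorem hasSum_setGcd_mul (hd : 0 < Nat.setGcd S) {g : ℕ → ℝ} {a : ℝ}
    (h : HasSum (fun s : ℕ => g s * blockWeight S s) a) :
    HasSum (fun t : ℕ => g (Nat.setGcd S * t) * blockWeight S (Nat.setGcd S * t)) a := by
  refine (Function.Injective.hasSum_iff (mul_right_injective₀ hd.ne') fun s hs => ?_).2 h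
  rw [blockWeight_of_not_dvd, mul_zero]
  rintro ⟨t, rfl⟩
  exact hs ⟨t, rfl⟩

/-- The gcd is an integer combination of finitely many elements of `S`; divide it by the gcd,
keeping the coefficient of `s` at the index `s / gcd(S)`. -/
theorem exists_sum_mul_eq_one (hτ : IsTau S (tau S)) (hF : 0 < blockSum S)
    (hd : 0 < Nat.setGcd S) :
    ∃ (s : Finset ℕ) (a : ℕ → ℤ), ∑ t ∈ s, a t * (t : ℤ) = 1 ∧ ∀ t ∈ s, 0 < latticeLaw S t := by
  classical
  have h : ((Nat.setGcd S : ℕ) : ℤ) ∈ Ideal.span (((↑) : ℕ → ℤ) '' S) := by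
    rw [← Nat.span_singleton_setGcd]
    exact Ideal.mem_span_singleton_self _
  obtain ⟨t, hts, a, ha⟩ := (Submodule.mem_span_image_iff_exists_fun _).1 h
  have hdiv : ∀ n ∈ S, Nat.setGcd S * (n / Nat.setGcd S) = n := fun n hn =>
    Nat.mul_div_cancel' (Nat.setGcd_dvd_of_mem hn)
  refine ⟨t.image fun n => n / Nat.setGcd S,
    fun r => if h : Nat.setGcd S * r ∈ t then a ⟨_, h⟩ else 0, ?_, fun r hr => ?_⟩
  · rw [Finset.sum_image fun x hx y hy (hxy : x / _ = y / _) => by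
      rw [← hdiv x (hts hx), ← hdiv y (hts hy), hxy]]
    have hd' : ((Nat.setGcd S : ℕ) : ℤ) ≠ 0 := by exact_mod_cast hd.ne'
    refine mul_left_cancel₀ hd' ?_
    rw [mul_one, Finset.mul_sum, ← Finset.sum_coe_sort]
    refine Eq.trans (Finset.sum_congr rfl fun n _ => ?_) ha
    have h1 := hdiv n (hts n.2)
    have h3 : Nat.setGcd S * ((n : ℕ) / Nat.setGcd S) ∈ t := by rw [h1]; exact n.2
    simp only [dif_pos h3]
    have h2 : (⟨Nat.setGcd S * ((n : ℕ) / Nat.setGcd S), h3⟩ : t) = n :=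
      Subtype.ext h1
    rw [h2, smul_eq_mul, mul_left_comm, ← Nat.cast_mul, h1]
  · obtain ⟨n, hn, rfl⟩ := Finset.mem_image.1 hr
    rw [latticeLaw, hdiv n (hts hn), blockWeight_of_mem (hts hn)]
    exact div_pos (pow_pos hτ.1 _) hF

theorem isLatticeLaw (h0 : 0 ∉ S) (hτ : IsTau S (tau S)) (ha : ∃ a ∈ S, 2 ≤ a) :
    IsLatticeLaw (latticeLaw S) (Nat.setGcd S) (blockVar S / (Nat.setGcd S : ℝ) ^ 2) := by
  have hF := blockSum_pos h0 hτ
  have hd := setGcd_pos ha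
  have hd' : (0 : ℝ) < Nat.setGcd S := by exact_mod_cast hd
  refine ⟨fun t => div_nonneg (blockWeight_nonneg hτ _) hF.le, ?_, ?_, hd, ?_, ?_,
    div_pos (blockVar_pos h0 hτ ha) (by positivity), exists_sum_mul_eq_one hτ hF hd⟩
  · have h := (hasSum_setGcd_mul hd (g := fun _ => 1)
      (by simpa using hasSum_blockWeight h0 hτ)).div_const (blockSum S)
    rw [div_self hF.ne'] at h
    exact h.congr_fun fun t => by rw [latticeLaw, one_mul]
  · rw [latticeLaw, mul_zero, blockWeight_zero]
    positivity
  · have h := (hasSum_setGcd_mul hd (hasSum_sub_one_mul_blockWeight h0 hτ)).div_const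
      (blockSum S * Nat.setGcd S)
    rw [zero_div] at h
    refine h.congr_fun fun t => ?_
    rw [latticeLaw]
    push_cast
    field_simp
  · have h := (hasSum_setGcd_mul hd (summable_sq_mul_blockWeight hτ).hasSum).div_const
      (blockSum S * (Nat.setGcd S : ℝ) ^ 2)
    rw [← div_div, ← blockVar] at h
    refine h.congr_fun fun t => ?_
    rw [latticeLaw]
    push_cast
    field_simp

end BlockWeights

/-! ### Series supported on an arithmetic progression -/

section Multisection

/-- The coefficients of `U` at the multiples of `d`, rescaled by `x`. -/
def multisection (d : ℕ) (x : ℝ) (U : PowerSeries ℝ) : PowerSeries ℝ :=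
  PowerSeries.mk fun M => PowerSeries.coeff (d * M) U * x ^ (d * M)

/-- The coefficients of `U` vanish outside the multiples of `d`. -/
def SupportedOn (d : ℕ) (U : PowerSeries ℝ) : Prop := ∀ n, ¬ d ∣ n → PowerSeries.coeff n U = 0

variable {d : ℕ} {x : ℝ} {U V : PowerSeries ℝ}

theorem supportedOn_one (d : ℕ) : SupportedOn d 1 := fun n hn => by
  rw [PowerSeries.coeff_one, if_neg fun h : n = 0 => hn (h ▸ dvd_zero d)]

theorem SupportedOn.mul (hU : SupportedOn d U) (hV : SupportedOn d V) : SupportedOn d (U * V) := by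
  intro n hn
  rw [PowerSeries.coeff_mul]
  refine Finset.sum_eq_zero fun p hp => ?_
  rw [Finset.HasAntidiagonal.mem_antidiagonal] at hp
  by_cases h : d ∣ p.1
  · rw [hV p.2 fun h' => hn (hp ▸ dvd_add h h'), mul_zero]
  · rw [hU p.1 h, zero_mul]

theorem SupportedOn.pow (hU : SupportedOn d U) (L : ℕ) : SupportedOn d (U ^ L) := by
  induction L with
  | zero => rw [pow_zero]; exact supportedOn_one d
  | succ L ih => rw [pow_succ]; exact ih.mul hU

theorem multisection_one (hd : 0 < d) (x : ℝ) : multisection d x 1 = 1 := by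
  ext M
  rw [multisection, PowerSeries.coeff_mk, PowerSeries.coeff_one, PowerSeries.coeff_one]
  rcases eq_or_ne M 0 with rfl | h
  · simp
  · simp [h, hd.ne']

/-- A support condition on one factor suffices: two indices with sum `d * M`, one a multiple of `d`,
are both multiples of `d`. -/
theorem multisection_mul (hd : 0 < d) (hU : SupportedOn d U) (x : ℝ) (V : PowerSeries ℝ) :
    multisection d x (U * V) = multisection d x U * multisection d x V := by
  ext M
  rw [multisection, PowerSeries.coeff_mk, PowerSeries.coeff_mul, PowerSeries.coeff_mul,
    Finset.sum_mul]
  symm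
  refine Finset.sum_of_injOn (fun p => (d * p.1, d * p.2)) ?_ ?_ ?_ ?_
  · rintro ⟨a, b⟩ - ⟨a', b'⟩ - h
    simp only [Prod.mk.injEq, Nat.mul_right_inj hd.ne'] at h
    exact Prod.ext h.1 h.2
  · rintro ⟨a, b⟩ h
    simp only [Finset.mem_coe, Finset.HasAntidiagonal.mem_antidiagonal] at h ⊢
    rw [← h, mul_add]
  · rintro ⟨a, b⟩ h h'
    rw [Finset.HasAntidiagonal.mem_antidiagonal] at h
    rw [hU a, zero_mul, zero_mul]
    rintro ⟨a, rfl⟩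
    obtain ⟨b, rfl⟩ := (Nat.dvd_add_right (dvd_mul_right d a)).1 (h ▸ dvd_mul_right d M)
    refine h' ⟨(a, b), ?_, rfl⟩
    simp only [Finset.mem_coe, Finset.HasAntidiagonal.mem_antidiagonal]
    rw [← mul_add] at h
    exact Nat.eq_of_mul_eq_mul_left hd h
  · rintro ⟨a, b⟩ h
    rw [Finset.HasAntidiagonal.mem_antidiagonal] at h
    rw [multisection, multisection, PowerSeries.coeff_mk, PowerSeries.coeff_mk, ← h, mul_add,
      pow_add]
    ring

theorem multisection_pow (hd : 0 < d) (hU : SupportedOn d U) (x : ℝ) (L : ℕ) :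
    multisection d x (U ^ L) = multisection d x U ^ L := by
  induction L with
  | zero => rw [pow_zero, pow_zero, multisection_one hd]
  | succ L ih => rw [pow_succ', pow_succ', multisection_mul hd hU, ih]

theorem multisection_prod (hd : 0 < d) (x : ℝ) {ι : Type*} (s : Finset ι) {U : ι → PowerSeries ℝ}
    (hU : ∀ i ∈ s, SupportedOn d (U i)) :
    multisection d x (∏ i ∈ s, U i) = ∏ i ∈ s, multisection d x (U i) := by
  classical
  induction s using Finset.induction_on with
  | empty => rw [Finset.prod_empty, Finset.prod_empty, multisection_one hd]
  | insert a s ha ih =>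
    rw [Finset.prod_insert ha, Finset.prod_insert ha,
      multisection_mul hd (hU a (Finset.mem_insert_self a s)),
      ih fun i hi => hU i (Finset.mem_insert_of_mem hi)]

end Multisection


/-! ### The asymptotics of the noncrossing partitions -/

section Noncrossing

variable {S : Set ℕ}

theorem supportedOn_blockSeries (S : Set ℕ) : SupportedOn (Nat.setGcd S) (blockSeries S) := by
  intro n hn
  rw [blockSeries, PowerSeries.coeff_mk, if_neg]
  rintro (rfl | h)
  · exact hn (dvd_zero _)
  · exact hn (Nat.setGcd_dvd_of_mem h)

theorem multisection_blockSeries (hF : 0 < blockSum S) :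
    multisection (Nat.setGcd S) (tau S) (blockSeries S) =
      PowerSeries.C (blockSum S) * PowerSeries.mk (latticeLaw S) := by
  ext M
  rw [multisection, PowerSeries.coeff_mk, PowerSeries.coeff_C_mul, PowerSeries.coeff_mk,
    latticeLaw, mul_div_cancel₀ _ hF.ne', blockWeight]

theorem succ_mul_nc (h0 : 0 ∉ S) (N : ℕ) :
    ((N : ℝ) + 1) * nc S N = PowerSeries.coeff N (blockSeries S ^ (N + 1)) := by
  have h := lagrange_inversion (coeff_regionSeries_one h0) (N + 1) 1
  rw [pow_one, PowerSeries.coeff_succ_X_mul, regionSeries_one, PowerSeries.coeff_mk,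
    if_pos (by omega), Nat.add_sub_cancel, Nat.cast_one, one_mul] at h
  exact_mod_cast h

theorem nc_of_not_dvd (h0 : 0 ∉ S) {N : ℕ} (h : ¬ Nat.setGcd S ∣ N) : (nc S N : ℝ) = 0 := by
  have h1 := succ_mul_nc h0 N
  rw [(supportedOn_blockSeries S).pow _ N h] at h1
  exact (mul_eq_zero.1 h1).resolve_left (by positivity)

theorem supportedOn_regionSeries (h0 : 0 ∉ S) (i : ℕ) :
    SupportedOn (Nat.setGcd S) (regionSeries S i) := fun n hn => by
  rw [regionSeries, PowerSeries.coeff_mk, nc_of_not_dvd h0 hn, mul_zero]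

/-- The coefficients of `regionSeries` at the multiples of `gcd(S)`, rescaled by `ρ_S`. -/
def scaledRegionSeries (S : Set ℕ) (i : ℕ) : PowerSeries ℝ :=
  multisection (Nat.setGcd S) (rho S) (regionSeries S i)

theorem coeff_scaledRegionSeries (S : Set ℕ) (i M : ℕ) :
    PowerSeries.coeff M (scaledRegionSeries S i) =
      ((i + Nat.setGcd S * M - 1).choose (Nat.setGcd S * M) : ℝ) *
        PowerSeries.coeff M (scaledRegionSeries S 1) := by
  simp [scaledRegionSeries, multisection, regionSeries, mul_assoc]

/-- Exponential tilting: at scale `τ` the block series is `F = blockSum S` times a probability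
series. As `τ = ρ F`, the powers of `F` cancel except one. -/
theorem coeff_scaledRegionSeries_one (h0 : 0 ∉ S) (hτ : IsTau S (tau S))
    (hd : 0 < Nat.setGcd S) (M : ℕ) :
    PowerSeries.coeff M (scaledRegionSeries S 1) = blockSum S / ((Nat.setGcd S : ℝ) * M + 1) *
      PowerSeries.coeff M (PowerSeries.mk (latticeLaw S) ^ (Nat.setGcd S * M + 1)) := by
  have hF := blockSum_pos h0 hτ
  have h1 := succ_mul_nc h0 (Nat.setGcd S * M)
  have h2 := congrArg (PowerSeries.coeff M)
    (multisection_pow hd (supportedOn_blockSeries S) (tau S) (Nat.setGcd S * M + 1))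
  rw [multisection, PowerSeries.coeff_mk, ← h1, multisection_blockSeries hF, mul_pow, ← map_pow,
    PowerSeries.coeff_C_mul, ← rho_mul_blockSum h0 hτ, mul_pow, pow_succ] at h2
  rw [scaledRegionSeries, regionSeries_one, multisection, PowerSeries.coeff_mk,
    PowerSeries.coeff_mk]
  have h3 : (0 : ℝ) < (Nat.setGcd S : ℝ) * M + 1 := by positivity
  have h4 : 0 < blockSum S ^ (Nat.setGcd S * M) := by positivity
  push_cast at h2
  rw [div_mul_eq_mul_div, eq_div_iff h3.ne']
  refine mul_left_cancel₀ h4.ne' ?_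
  linear_combination h2

theorem tendsto_scaledRegionSeries_one (h0 : 0 ∉ S) (hτ : IsTau S (tau S))
    (ha : ∃ a ∈ S, 2 ≤ a) :
    Tendsto (fun M : ℕ => (M : ℝ) * √M * PowerSeries.coeff M (scaledRegionSeries S 1)) atTop
      (𝓝 (beta S / (2 * √(Real.pi * Nat.setGcd S)))) := by
  have hF := blockSum_pos h0 hτ
  have hd := setGcd_pos ha
  have hd' : (0 : ℝ) < Nat.setGcd S := by exact_mod_cast hd
  have hv := blockVar_pos h0 hτ ha
  have h1 : Tendsto (fun M : ℕ => (M : ℝ) / ((Nat.setGcd S : ℝ) * M + 1)) atTop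
      (𝓝 (1 / (Nat.setGcd S : ℝ))) := by
    have h : Tendsto (fun M : ℕ => 1 / ((Nat.setGcd S : ℝ) + 1 / (M : ℝ))) atTop
        (𝓝 (1 / ((Nat.setGcd S : ℝ) + 0))) :=
      tendsto_const_nhds.div (tendsto_const_nhds.add tendsto_one_div_atTop_nhds_zero_nat)
        (by rw [add_zero]; exact hd'.ne')
    rw [add_zero] at h
    refine h.congr' ?_
    filter_upwards [eventually_ne_atTop 0] with M hM
    have : (M : ℝ) ≠ 0 := by exact_mod_cast hM
    field_simp
  have h2 := (h1.mul (isLatticeLaw h0 hτ ha).tendsto_sqrt_mul_coeff).const_mul (blockSum S)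
  have heq : blockSum S * (1 / (Nat.setGcd S : ℝ) * (1 / √(2 * Real.pi * (Nat.setGcd S : ℝ) *
      (blockVar S / (Nat.setGcd S : ℝ) ^ 2)))) =
      beta S / (2 * √(Real.pi * Nat.setGcd S)) := by
    rw [beta_eq h0 hτ]
    have h3 : √(2 * Real.pi * (Nat.setGcd S : ℝ) * (blockVar S / (Nat.setGcd S : ℝ) ^ 2)) =
        √2 * √(Real.pi * Nat.setGcd S) * √(blockVar S) / Nat.setGcd S := by
      rw [← Real.sqrt_mul (by norm_num), ← Real.sqrt_mul (by positivity), eq_div_iff hd'.ne',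
        ← Real.sqrt_sq hd'.le, ← Real.sqrt_mul (by positivity), Real.sqrt_sq hd'.le]
      congr 1
      field_simp
    rw [h3]
    have h4 : √2 * √2 = 2 := Real.mul_self_sqrt (by norm_num)
    have h5 : 0 < √(Real.pi * Nat.setGcd S) := Real.sqrt_pos.2 (by positivity)
    have h6 : 0 < √(blockVar S) := Real.sqrt_pos.2 hv
    have h7 : 0 < √(2 : ℝ) := by positivity
    field_simp
    linear_combination -h4
  rw [heq] at h2
  refine h2.congr fun M => ?_
  rw [coeff_scaledRegionSeries_one h0 hτ hd]
  ring

theorem coeff_scaledRegionSeries_nonneg (h0 : 0 ∉ S) (hτ : IsTau S (tau S)) (i M : ℕ) :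
    0 ≤ PowerSeries.coeff M (scaledRegionSeries S i) := by
  rw [scaledRegionSeries, multisection, regionSeries, PowerSeries.coeff_mk, PowerSeries.coeff_mk]
  have := rho_pos h0 hτ
  positivity

theorem isSmall_scaledRegionSeries_one (h0 : 0 ∉ S) (hτ : IsTau S (tau S))
    (ha : ∃ a ∈ S, 2 ≤ a) : IsSmall (scaledRegionSeries S 1) := by
  have h := tendsto_scaledRegionSeries_one h0 hτ ha
  refine ⟨coeff_scaledRegionSeries_nonneg h0 hτ 1, ?_, ?_⟩
  · have hs : Summable fun M : ℕ => ((M : ℝ) ^ (3 / 2 : ℝ))⁻¹ :=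
      Real.summable_nat_rpow_inv.2 (by norm_num)
    refine summable_of_isBigO_nat hs ?_
    have h1 := (h.isBigO_one ℝ).mul
      (Asymptotics.isBigO_refl (fun M : ℕ => ((M : ℝ) ^ (3 / 2 : ℝ))⁻¹) atTop)
    refine (h1.congr' ?_ ?_)
    · filter_upwards [eventually_ne_atTop 0] with M hM
      have hM' : (0 : ℝ) < M := by exact_mod_cast Nat.pos_of_ne_zero hM
      have h2 : (M : ℝ) ^ (3 / 2 : ℝ) = M * √M := by
        rw [Real.sqrt_eq_rpow, ← Real.rpow_one_add' hM'.le (by norm_num)]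
        norm_num
      have h3 : (M : ℝ) * √M ≠ 0 := by positivity
      rw [h2, mul_comm, ← mul_assoc, inv_mul_cancel₀ h3, one_mul]
    · exact Eventually.of_forall fun M => one_mul _
  · have h1 : Tendsto (fun M : ℕ => (√(M : ℝ))⁻¹) atTop (𝓝 0) :=
      (Real.tendsto_sqrt_atTop.comp tendsto_natCast_atTop_atTop).inv_tendsto_atTop
    have h2 := h.mul h1
    rw [mul_zero] at h2
    refine h2.congr' ?_
    filter_upwards [eventually_ne_atTop 0] with M hM
    have hM' : 0 < √(M : ℝ) := Real.sqrt_pos.2 (by exact_mod_cast Nat.pos_of_ne_zero hM)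
    field_simp

/-- A nonnegative fixed point of a generating function with mean `1` is equal to `1`. -/
theorem eq_one_of_hasSum {p : ℕ → ℝ} {y : ℝ} (hp : ∀ s, 0 ≤ p s) (h1 : HasSum p 1)
    (hm : HasSum (fun s : ℕ => (s : ℝ) * p s) 1) (hy : 0 ≤ y)
    (h : HasSum (fun s => p s * y ^ s) y) {a : ℕ} (ha : 2 ≤ a) (hpa : 0 < p a) : y = 1 := by
  have hb : ∀ s : ℕ, 0 ≤ y ^ s - 1 - s * (y - 1) := fun s => by
    have := one_add_mul_le_pow (a := y - 1) (by linarith) s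
    rw [add_sub_cancel] at this
    linarith
  -- The Bernoulli defects are nonnegative with weighted sum `0`, so the one at `a ≥ 2` vanishes,
  -- which forces `y = 1`.
  have h2 : HasSum (fun s : ℕ => p s * (y ^ s - 1 - s * (y - 1))) 0 := by
    have := (h.sub h1).sub (hm.mul_right (y - 1))
    rw [one_mul, sub_self] at this
    exact this.congr_fun fun s => by ring
  have h3 := (hasSum_zero_iff_of_nonneg fun s => mul_nonneg (hp s) (hb s)).1 h2
  have h4 := (mul_eq_zero.1 (congrFun h3 a)).resolve_left hpa.ne'
  obtain ⟨b, rfl⟩ : ∃ b, a = b + 1 := ⟨a - 1, by omega⟩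
  have h5 := hb b
  have hb1 : (1 : ℝ) ≤ b := by exact_mod_cast (by omega : 1 ≤ b)
  rw [pow_succ] at h4
  push_cast at h4
  have h6 : (b : ℝ) * (y - 1) ^ 2 ≤ 0 := by nlinarith
  have h7 : (y - 1) ^ 2 = 0 := le_antisymm (by nlinarith [sq_nonneg (y - 1)]) (sq_nonneg _)
  nlinarith [pow_eq_zero_iff (two_ne_zero) |>.1 h7]

/-- The sum of the coefficients of a power of a series with nonnegative coefficients. -/
theorem hasSum_coeff_mk_pow_one {y : ℕ → ℝ} {Z : ℝ} (hy : ∀ n, 0 ≤ y n) (h : HasSum y Z) (L : ℕ) :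
    HasSum (fun n => PowerSeries.coeff n (PowerSeries.mk y ^ L)) (Z ^ L) := by
  have h1 := (hasSum_coeff_mk_pow hy h.summable L).2.2 1 norm_one
  have h2 : ∑' t, (y t : ℂ) * 1 ^ t = Z := by
    simp only [one_pow, mul_one]
    exact (Complex.hasSum_ofReal.2 h).tsum_eq
  rw [h2] at h1
  simp only [one_pow, mul_one] at h1
  exact_mod_cast h1

/-- The value `Y = B(ρ)` satisfies `Y = f(ρ Y)`. Hence `Y / F`, with `F = blockSum S`, is a fixed
point of the generating function of a law of mean `1`, and `eq_one_of_hasSum` identifies it. -/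
theorem hasSum_scaledRegionSeries_one (h0 : 0 ∉ S) (hτ : IsTau S (tau S))
    (ha : ∃ a ∈ S, 2 ≤ a) :
    HasSum (fun M => PowerSeries.coeff M (scaledRegionSeries S 1)) (blockSum S) := by
  have hF := blockSum_pos h0 hτ
  have hρ := rho_pos h0 hτ
  have hd := setGcd_pos ha
  have hs := (isSmall_scaledRegionSeries_one h0 hτ ha).summable.hasSum
  set Y := ∑' M, PowerSeries.coeff M (scaledRegionSeries S 1) with hY
  have hB : HasSum (fun n => (nc S n : ℝ) * rho S ^ n) Y := by
    refine (Function.Injective.hasSum_iff (mul_right_injective₀ hd.ne') fun s hs => ?_).1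
      (hs.congr_fun fun M => ?_)
    · rw [nc_of_not_dvd h0, zero_mul]
      rintro ⟨t, rfl⟩
      exact hs ⟨t, rfl⟩
    · simp [scaledRegionSeries, multisection, regionSeries]
  set T : PowerSeries ℝ := PowerSeries.rescale (rho S) (PowerSeries.X * regionSeries S 1) with hT
  have hT0 : ∀ n, 0 ≤ PowerSeries.coeff n T := fun n => by
    rw [hT, PowerSeries.coeff_rescale]
    rcases n with _ | n
    · simp
    · rw [PowerSeries.coeff_succ_X_mul, regionSeries_one, PowerSeries.coeff_mk]
      positivity
  have hTsum : HasSum (fun n => PowerSeries.coeff n T) (rho S * Y) := by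
    refine (hasSum_nat_add_iff' 1).1 ?_
    simp only [Finset.sum_range_one, hT, PowerSeries.coeff_rescale,
      PowerSeries.coeff_zero_X_mul, mul_zero, sub_zero, PowerSeries.coeff_succ_X_mul]
    refine (hB.mul_left (rho S)).congr_fun fun n => ?_
    rw [regionSeries_one, PowerSeries.coeff_mk, pow_succ]
    ring
  have hmk : PowerSeries.mk (fun n => PowerSeries.coeff n T) = T := by
    ext n
    rw [PowerSeries.coeff_mk]
  have hpow : ∀ s, HasSum (fun n => PowerSeries.coeff n (T ^ s)) ((rho S * Y) ^ s) := fun s => by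
    have := hasSum_coeff_mk_pow_one hT0 hTsum s
    rwa [hmk] at this
  have hpow0 : ∀ s n, 0 ≤ PowerSeries.coeff n (T ^ s) := fun s => by
    have := (hasSum_coeff_mk_pow hT0 hTsum.summable s).1
    rwa [hmk] at this
  have hf0 : ∀ s, 0 ≤ PowerSeries.coeff s (blockSeries S) := fun s => by
    rw [blockSeries, PowerSeries.coeff_mk]; split_ifs <;> norm_num
  have hrow : ∀ n, HasSum (fun s => PowerSeries.coeff s (blockSeries S) *
      PowerSeries.coeff n (T ^ s)) ((nc S n : ℝ) * rho S ^ n) := by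
    intro n
    have h1 : (nc S n : ℝ) * rho S ^ n = ∑ s ∈ Finset.range (n + 1),
        PowerSeries.coeff s (blockSeries S) * PowerSeries.coeff n (T ^ s) := by
      have := coeff_regionSeries_one h0 n
      rw [regionSeries_one, PowerSeries.coeff_mk, ← regionSeries_one] at this
      rw [this, Finset.sum_mul]
      refine Finset.sum_congr rfl fun s _ => ?_
      rw [hT, ← map_pow, PowerSeries.coeff_rescale]
      ring
    rw [h1]
    refine hasSum_sum_of_ne_finset_zero fun s hs => ?_
    rw [hT, ← map_pow, PowerSeries.coeff_rescale, coeff_X_mul_pow_of_lt (by simpa using hs),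
      mul_zero, mul_zero]
  have hsum : Summable (Function.uncurry fun n s => PowerSeries.coeff s (blockSeries S) *
      PowerSeries.coeff n (T ^ s)) := by
    refine (summable_prod_of_nonneg fun p => mul_nonneg (hf0 _) (hpow0 _ _)).2
      ⟨fun n => (hrow n).summable, ?_⟩
    refine hB.summable.congr fun n => ?_
    exact (hrow n).tsum_eq.symm
  -- The order of summation is exchanged: rows sum to the terms of `B(ρ)`, columns to the terms of
  -- `f(ρ Y)`.
  have hcol : HasSum (fun s => PowerSeries.coeff s (blockSeries S) * (rho S * Y) ^ s) Y := by
    have h1 : ∀ s, HasSum (fun n => PowerSeries.coeff s (blockSeries S) *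
        PowerSeries.coeff n (T ^ s)) (PowerSeries.coeff s (blockSeries S) * (rho S * Y) ^ s) :=
      fun s => (hpow s).mul_left _
    have h2 := hsum.prod_symm.hasSum.prod_fiberwise h1
    have h3 := hsum.hasSum.prod_fiberwise hrow
    have h4 : ∑' p : ℕ × ℕ, (Function.uncurry fun n s => PowerSeries.coeff s (blockSeries S) *
      PowerSeries.coeff n (T ^ s)) p.swap = Y := by
      rw [← h3.unique hB]
      exact (Equiv.prodComm ℕ ℕ).tsum_eq _
    rw [h4] at h2
    exact h2
  have hY0 : 0 ≤ Y := tsum_nonneg fun M => coeff_scaledRegionSeries_nonneg h0 hτ 1 M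
  obtain ⟨a, haS, ha2⟩ := ha
  have hone := eq_one_of_hasSum (p := fun s => blockWeight S s / blockSum S) (y := Y / blockSum S)
    (fun s => div_nonneg (blockWeight_nonneg hτ s) hF.le)
    (by have := (hasSum_blockWeight h0 hτ).div_const (blockSum S); rwa [div_self hF.ne'] at this)
    (by
      have := (hasSum_mul_blockWeight hτ).div_const (blockSum S)
      rw [div_self hF.ne'] at this
      exact this.congr_fun fun s => (mul_div_assoc _ _ _).symm)
    (div_nonneg hY0 hF.le)
    (by
      refine (hcol.div_const (blockSum S)).congr_fun fun s => ?_
      rw [blockWeight, show rho S * Y = tau S * (Y / blockSum S) by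
        rw [← rho_mul_blockSum h0 hτ]; field_simp, mul_pow]
      ring)
    ha2 (by rw [blockWeight_of_mem haS]; have := hτ.1; positivity)
  rw [div_eq_one_iff_eq hF.ne'] at hone
  rw [← hone]
  exact hs

theorem cast_choose_eq_risingCoeff {i : ℕ} (hi : 1 ≤ i) (N : ℕ) :
    ((i + N - 1).choose N : ℝ) = risingCoeff i N := by
  obtain ⟨i, rfl⟩ : ∃ j, i = j + 1 := ⟨i - 1, by omega⟩
  rw [show i + 1 + N - 1 = i + N by omega]
  induction N with
  | zero => simp [risingCoeff_zero]
  | succ N ih =>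
    have h := Nat.add_one_mul_choose_eq (i + N) N
    have h' : ((i : ℝ) + N + 1) * ((i + N).choose N : ℝ) =
        ((i + (N + 1)).choose (N + 1) : ℝ) * (N + 1) := by exact_mod_cast h
    have hN : (N : ℝ) + 1 ≠ 0 := by positivity
    rw [ih] at h'
    rw [risingCoeff, Finset.prod_range_succ, ← risingCoeff, ← mul_div_assoc, eq_div_iff hN, ← h']
    push_cast
    ring

/-- The binomial factor has order `(d M) ^ (i - 1) / Γ(i)` and the noncrossing part `M ^ (-3/2)`,
which leaves the exponent `i - 3/2 - 1` of `risingCoeff (i - 3/2)`. -/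
theorem tendsto_scaledRegionSeries (h0 : 0 ∉ S) (hτ : IsTau S (tau S))
    (ha : ∃ a ∈ S, 2 ≤ a) {i : ℕ} (hi : 2 ≤ i) :
    Tendsto (fun M : ℕ => PowerSeries.coeff M (scaledRegionSeries S i) /
        risingCoeff ((i : ℝ) - 3 / 2) M) atTop
      (𝓝 ((Nat.setGcd S : ℝ) ^ ((i : ℝ) - 3 / 2) * (beta S *
        (Nat.doubleFactorial (2 * i - 5) : ℝ) /
          (2 ^ (i - 1) * (Nat.factorial (i - 1) : ℝ))))) := by
  have hd := setGcd_pos ha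
  have hd' : (0 : ℝ) < Nat.setGcd S := by exact_mod_cast hd
  have hi' : (2 : ℝ) ≤ i := by exact_mod_cast hi
  have hα : 0 < (i : ℝ) - 3 / 2 := by linarith
  have hG := Real.Gamma_pos_of_pos hα
  have h1 := tendsto_scaledRegionSeries_one h0 hτ ha
  have h2 := (tendsto_risingCoeff_div_rpow hα).inv₀ (inv_ne_zero hG.ne')
  have h3 := (tendsto_risingCoeff_div_rpow (α := (i : ℝ)) (by linarith)).comp
    (tendsto_id.const_mul_atTop' hd)
  have h4 := ((h3.mul h1).mul h2).const_mul ((Nat.setGcd S : ℝ) ^ ((i : ℝ) - 1))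
  rw [inv_inv] at h4
  have hval : (Nat.setGcd S : ℝ) ^ ((i : ℝ) - 1) * ((Real.Gamma i)⁻¹ *
      (beta S / (2 * √(Real.pi * Nat.setGcd S))) * Real.Gamma ((i : ℝ) - 3 / 2)) =
      (Nat.setGcd S : ℝ) ^ ((i : ℝ) - 3 / 2) * (beta S *
        (Nat.doubleFactorial (2 * i - 5) : ℝ) /
          (2 ^ (i - 1) * (Nat.factorial (i - 1) : ℝ))) := by
    -- This makes `Γ(i - 3/2)` equal to `Γ(j + 1/2)`, the source of the double factorial. For `j =
    -- 0` the truncated index gives `0‼ = 1`, as wanted.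
    obtain ⟨j, rfl⟩ : ∃ j, i = j + 2 := ⟨i - 2, by omega⟩
    have e1 : ((j + 2 : ℕ) : ℝ) - 3 / 2 = (j : ℝ) + 1 / 2 := by push_cast; ring
    have e2 : ((j + 2 : ℕ) : ℝ) = ((j + 1 : ℕ) : ℝ) + 1 := by push_cast; ring
    have e3 : ((j + 2 : ℕ) : ℝ) - 1 = ((j : ℝ) + 1 / 2) + 1 / 2 := by push_cast; ring
    have e4 : 2 * (j + 2) - 5 = 2 * j - 1 := by omega
    rw [e1, e3, Real.Gamma_nat_add_half, e4, show j + 2 - 1 = j + 1 by omega, e2,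
      Real.Gamma_nat_eq_factorial, Real.rpow_add hd', ← Real.sqrt_eq_rpow,
      Real.sqrt_mul Real.pi_pos.le]
    have hp : 0 < √Real.pi := Real.sqrt_pos.2 Real.pi_pos
    have hq : 0 < √(Nat.setGcd S : ℝ) := Real.sqrt_pos.2 hd'
    have hf : (0 : ℝ) < (j + 1).factorial := by exact_mod_cast Nat.factorial_pos _
    field_simp
    ring
  rw [hval] at h4
  refine h4.congr' ?_
  filter_upwards [eventually_ne_atTop 0] with M hM
  have hM' : (0 : ℝ) < M := by exact_mod_cast Nat.pos_of_ne_zero hM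
  rw [coeff_scaledRegionSeries S i, cast_choose_eq_risingCoeff (by omega)]
  have e5 : (M : ℝ) ^ ((i : ℝ) - 1) = (M : ℝ) ^ ((i : ℝ) - 3 / 2 - 1) * (M * √M) := by
    rw [Real.sqrt_eq_rpow, ← Real.rpow_one_add' hM'.le (by norm_num), ← Real.rpow_add hM']
    congr 1; ring
  have hr := risingCoeff_pos hα M
  have hx : 0 < (M : ℝ) ^ ((i : ℝ) - 3 / 2 - 1) := Real.rpow_pos_of_pos hM' _
  have hy : 0 < (Nat.setGcd S : ℝ) ^ ((i : ℝ) - 1) := Real.rpow_pos_of_pos hd' _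
  have hs : 0 < √(M : ℝ) := Real.sqrt_pos.2 hM'
  simp only [Function.comp_apply, id]
  rw [Nat.cast_mul, Real.mul_rpow hd'.le hM'.le, e5]
  field_simp

end Noncrossing


/-! ### The contribution of a core -/

section Contribution

variable {S : Set ℕ}

/-- The constants in the asymptotics of `regionSeries`, up to the power of `gcd(S)`. -/
def regionConst (S : Set ℕ) (i : ℕ) : ℝ :=
  if i = 1 then blockSum S else
    beta S * (Nat.doubleFactorial (2 * i - 5) : ℝ) / (2 ^ (i - 1) * (Nat.factorial (i - 1) : ℝ))

/-- A one-arc region has truncated exponent `2 * 1 - 3 = 0` and multiplies the limit by a sum; any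
other adds its exponent. A total exponent `0` is kept apart because then the product is only
`o(1/M)`, with no power law to normalize by. -/
theorem tendsto_coeff_prod_scaledRegionSeries (h0 : 0 ∉ S) (hτ : IsTau S (tau S))
    (ha : ∃ a ∈ S, 2 ≤ a) {ι : Type*} (s : Finset ι) (c : ι → ℕ) (hc : ∀ R ∈ s, 1 ≤ c R) :
    (∑ R ∈ s, (2 * c R - 3) = 0 → IsSmall (∏ R ∈ s, scaledRegionSeries S (c R)) ∧
      ∑' M, PowerSeries.coeff M (∏ R ∈ s, scaledRegionSeries S (c R)) =
        ∏ R ∈ s, (Nat.setGcd S : ℝ) ^ (((2 * c R - 3 : ℕ) : ℝ) / 2) * regionConst S (c R)) ∧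
    (0 < ∑ R ∈ s, (2 * c R - 3) →
      Tendsto (fun M => PowerSeries.coeff M (∏ R ∈ s, scaledRegionSeries S (c R)) /
        risingCoeff (((∑ R ∈ s, (2 * c R - 3) : ℕ) : ℝ) / 2) M) atTop
        (𝓝 (∏ R ∈ s, (Nat.setGcd S : ℝ) ^ (((2 * c R - 3 : ℕ) : ℝ) / 2) *
          regionConst S (c R)))) := by
  classical
  induction s using Finset.induction_on with
  | empty => simp [isSmall_one]
  | insert R s hR ih =>
    obtain ⟨ih0, ih1⟩ := ih fun R hR => hc R (Finset.mem_insert_of_mem hR)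
    rw [Finset.prod_insert hR, Finset.prod_insert hR, Finset.sum_insert hR]
    rcases Nat.eq_or_lt_of_le (hc R (Finset.mem_insert_self R s)) with h1 | h2
    · have hsmall := isSmall_scaledRegionSeries_one h0 hτ ha
      have hsum := (hasSum_scaledRegionSeries_one h0 hτ ha).tsum_eq
      rw [← h1]
      simp only [Nat.reduceMul, Nat.reduceSub, zero_add, Nat.cast_zero, zero_div, Real.rpow_zero,
        one_mul, regionConst, if_true]
      refine ⟨fun h => ?_, fun h => ?_⟩
      · refine ⟨hsmall.mul (ih0 h).1, ?_⟩
        rw [hsmall.tsum_mul (ih0 h).1, hsum, (ih0 h).2]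
        rfl
      · have := hsmall.tendsto_coeff_mul_div (by positivity) (ih1 h)
        rw [hsum] at this
        exact this
    · have hlim := tendsto_scaledRegionSeries h0 hτ ha h2
      have hcast : (c R : ℝ) - 3 / 2 = ((2 * c R - 3 : ℕ) : ℝ) / 2 := by
        rw [Nat.cast_sub (by omega)]; push_cast; ring
      have hα : 0 < ((2 * c R - 3 : ℕ) : ℝ) / 2 := by
        have : 0 < 2 * c R - 3 := by omega
        positivity
      rw [hcast] at hlim
      refine ⟨fun h => by omega, fun _ => ?_⟩
      have hconst : regionConst S (c R) = beta S * (Nat.doubleFactorial (2 * c R - 5) : ℝ) /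
          (2 ^ (c R - 1) * (Nat.factorial (c R - 1) : ℝ)) := if_neg (by omega)
      rw [hconst]
      rcases Nat.eq_zero_or_pos (∑ R ∈ s, (2 * c R - 3)) with h | h
      · have := (ih0 h).1.tendsto_coeff_mul_div hα hlim
        rw [h, add_zero, mul_comm (scaledRegionSeries S (c R)), ← (ih0 h).2,
          mul_comm ((Nat.setGcd S : ℝ) ^ _ * _)]
        exact this
      · have hβ : 0 < ((∑ R ∈ s, (2 * c R - 3) : ℕ) : ℝ) / 2 := by positivity
        have := tendsto_coeff_mul_div hα hβ hlim (ih1 h)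
        rw [← add_div, ← Nat.cast_add] at this
        exact this

/-- The first order of the coefficients, in a form that does not single out the exponent `0`. -/
theorem tendsto_rpow_mul_coeff_prod (h0 : 0 ∉ S) (hτ : IsTau S (tau S))
    (ha : ∃ a ∈ S, 2 ≤ a) {ι : Type*} (s : Finset ι) (c : ι → ℕ) (hc : ∀ R ∈ s, 1 ≤ c R)
    {α : ℝ} (hα : α = ((∑ R ∈ s, (2 * c R - 3) : ℕ) : ℝ) / 2) (j : ℕ) :
    Tendsto (fun M : ℕ => (M : ℝ) ^ (1 - α) *
        PowerSeries.coeff (M - j) (∏ R ∈ s, scaledRegionSeries S (c R))) atTop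
      (𝓝 (α / Real.Gamma (α + 1) *
        ((Nat.setGcd S : ℝ) ^ α * ∏ R ∈ s, regionConst S (c R)))) := by
  have hd' : (0 : ℝ) < Nat.setGcd S := by exact_mod_cast setGcd_pos ha
  obtain ⟨h1, h2⟩ := tendsto_coeff_prod_scaledRegionSeries h0 hτ ha s c hc
  have hprod : ∏ R ∈ s, (Nat.setGcd S : ℝ) ^ (((2 * c R - 3 : ℕ) : ℝ) / 2) * regionConst S (c R) =
      (Nat.setGcd S : ℝ) ^ α * ∏ R ∈ s, regionConst S (c R) := by
    rw [Finset.prod_mul_distrib, ← Real.rpow_sum_of_pos hd', ← Finset.sum_div, hα]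
    push_cast
    rfl
  rw [hprod] at h2
  rcases Nat.eq_zero_or_pos (∑ R ∈ s, (2 * c R - 3)) with h | h
  -- With `α = 0` the claimed limit is `0`, which is the `o(1/M)` bound.
  · rw [h, Nat.cast_zero, zero_div] at hα
    rw [hα, zero_div, zero_mul, sub_zero]
    set U := ∏ R ∈ s, scaledRegionSeries S (c R)
    have h3 := (h1 h).1.tendsto.comp (tendsto_sub_atTop_nat j)
    have h4 := ((h1 h).1.summable.tendsto_atTop_zero.comp (tendsto_sub_atTop_nat j)).const_mul
      (j : ℝ)
    have h5 := h3.add h4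
    rw [mul_zero, add_zero] at h5
    refine h5.congr' ?_
    filter_upwards [eventually_ge_atTop j] with M hM
    simp only [Function.comp_apply]
    rw [Nat.cast_sub hM, Real.rpow_one]
    ring
  · have hα0 : 0 < α := by rw [hα]; positivity
    rw [← hα] at h2
    have h3 := (h2 h).comp (tendsto_sub_atTop_nat j)
    have h4 := (h3.mul (tendsto_risingCoeff_sub_div hα0 j)).mul (tendsto_risingCoeff_div_rpow hα0)
    rw [Real.Gamma_add_one hα0.ne', ← div_div, div_self hα0.ne', one_div]
    rw [mul_one, mul_comm] at h4
    refine h4.congr' ?_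
    filter_upwards [eventually_ne_atTop 0] with M hM
    have hM' : (0 : ℝ) < M := by exact_mod_cast Nat.pos_of_ne_zero hM
    have e1 := (risingCoeff_pos hα0 (M - j)).ne'
    have e2 := (risingCoeff_pos hα0 M).ne'
    have e3 : (M : ℝ) ^ (1 - α) = ((M : ℝ) ^ (α - 1))⁻¹ := by
      rw [← Real.rpow_neg hM'.le]; congr 1; ring
    have e4 : (M : ℝ) ^ (α - 1) ≠ 0 := (Real.rpow_pos_of_pos hM' _).ne'
    simp only [Function.comp_apply]
    rw [e3]
    field_simp

open Classical in
/-- The number of gaps in a region. -/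
def gapCount {m : ℕ} (K : Setoid (Fin m)) (R : Quotient (gapSetoid K)) : ℕ :=
  (Finset.univ.filter fun j => Quotient.mk (gapSetoid K) j = R).card

theorem one_le_gapCount {m : ℕ} (K : Setoid (Fin m)) (R : Quotient (gapSetoid K)) :
    1 ≤ gapCount K R := by
  classical
  obtain ⟨j, rfl⟩ := Quotient.exists_rep R
  exact Finset.card_pos.2 ⟨j, by simp⟩

open Classical in
theorem sum_gapCount {m : ℕ} (K : Setoid (Fin m)) : ∑ R, gapCount K R = m := by
  have := Finset.card_eq_sum_card_fiberwise (f := Quotient.mk (gapSetoid K))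
    (s := Finset.univ) (t := Finset.univ) fun _ _ => Finset.mem_coe.2 (Finset.mem_univ _)
  rw [Finset.card_univ, Fintype.card_fin] at this
  exact this.symm

open Classical in
theorem gapCount_le {m : ℕ} (K : Setoid (Fin m)) (R : Quotient (gapSetoid K)) :
    gapCount K R ≤ m := by
  conv_rhs => rw [← sum_gapCount K]
  exact Finset.single_le_sum (f := gapCount K) (fun _ _ => Nat.zero_le _) (Finset.mem_univ R)

-- Regions are grouped by their number of arcs. A general commutative monoid is allowed, so that
-- `Multiplicative` turns the same identity into the sum defining the potential.
open Classical in
theorem prod_gapCount {M : Type*} [CommMonoid M] {m : ℕ} (hm : 2 ≤ m) (P : Partition m)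
    (x : ℕ → M) :
    ∏ R, x (gapCount (toSetoid P) R) =
      x 1 ^ regionCount 1 P * ∏ i ∈ Finset.Icc 2 m, x i ^ regionCount i P := by
  have h1 : ∏ R, x (gapCount (toSetoid P) R) =
      ∏ i ∈ Finset.Icc 1 m, x i ^ regionCount i P := by
    rw [← Finset.prod_fiberwise_of_maps_to (g := gapCount (toSetoid P)) (t := Finset.Icc 1 m)
      fun R _ => Finset.mem_Icc.2 ⟨one_le_gapCount _ R, gapCount_le _ R⟩]
    refine Finset.prod_congr rfl fun i hi => ?_
    rw [regionCount_eq hm P (Finset.mem_Icc.1 hi).1]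
    refine (Finset.prod_congr rfl fun R hR => ?_).trans (Finset.prod_const _)
    rw [(Finset.mem_filter.1 hR).2]
  have h2 : Finset.Icc 1 m = insert 1 (Finset.Icc 2 m) := by
    ext i
    simp only [Finset.mem_Icc, Finset.mem_insert]
    omega
  rw [h1, h2, Finset.prod_insert (by simp)]

open Classical in
theorem potential_eq {m : ℕ} (hm : 2 ≤ m) (P : Partition m) :
    potential P = ∑ R, (2 * gapCount (toSetoid P) R - 3) := by
  have h := prod_gapCount hm P fun i => Multiplicative.ofAdd (2 * i - 3)
  have h2 := congrArg Multiplicative.toAdd h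
  simp only [toAdd_prod, toAdd_mul, toAdd_pow, toAdd_ofAdd, smul_eq_mul] at h2
  rw [h2, potential]
  simp [mul_comm]

theorem setGcd_dvd_of_hasBlockSizesIn {n : ℕ} {P : Partition n} (h : HasBlockSizesIn S P) :
    Nat.setGcd S ∣ n := by
  have h1 := P.sum_card_parts
  rw [Finset.card_univ, Fintype.card_fin] at h1
  conv_rhs => rw [← h1]
  exact Finset.dvd_sum fun B hB => Nat.setGcd_dvd_of_mem (h B hB)

open Classical in
theorem coeff_fillSeries (h0 : 0 ∉ S) (hd : 0 < Nat.setGcd S) {m : ℕ}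
    (K : Setoid (Fin m)) (M : ℕ) :
    PowerSeries.coeff (Nat.setGcd S * M) (fillSeries S K) * rho S ^ (Nat.setGcd S * M) =
      PowerSeries.coeff M (∏ R, scaledRegionSeries S (gapCount K R)) := by
  have h := congrArg (PowerSeries.coeff M) (multisection_prod hd (rho S) Finset.univ
    (U := fun R => regionSeries S (gapCount K R)) fun R _ => supportedOn_regionSeries h0 _)
  rw [multisection, PowerSeries.coeff_mk] at h
  exact h

/-- The contribution of a core to the number of partitions. -/
def contribution (S : Set ℕ) (n : ℕ) (K : Σ m : ℕ, Partition m) : ℝ :=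
  (n : ℝ) / K.1 *
    if K.1 ≤ n then PowerSeries.coeff (n - K.1) (fillSeries S (toSetoid K.2)) else 0

-- The arc counts add up to `m`, so `ρ ^ m` distributes as `ρ ^ i` per region; for `i = 1` this
-- yields `ρ * blockSum = τ`.
open Classical in
theorem weight_eq (h0 : 0 ∉ S) (hτ : IsTau S (tau S)) {m : ℕ} (hm : 2 ≤ m) (P : Partition m) :
    weight S ⟨m, P⟩ =
      rho S ^ m / m * ∏ R, regionConst S (gapCount (toSetoid P) R) := by
  have h1 := prod_gapCount hm P fun i => rho S ^ i * regionConst S i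
  rw [Finset.prod_mul_distrib, Finset.prod_pow_eq_pow_sum, sum_gapCount] at h1
  have h2 : rho S ^ 1 * regionConst S 1 = tau S := by
    rw [pow_one, regionConst, if_pos rfl, rho_mul_blockSum h0 hτ]
  rw [h2] at h1
  have h3 : weight S ⟨m, P⟩ = (rho S ^ m * ∏ R, regionConst S (gapCount (toSetoid P) R)) / m := by
    rw [h1, weight, div_mul_eq_mul_div]
    congr 2
    refine Finset.prod_congr rfl fun i hi => ?_
    have : i ≠ 1 := by have := (Finset.mem_Icc.1 hi).1; omega
    rw [regionConst, if_neg this]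
    congr 1
    ring
  rw [h3]
  ring

theorem tendsto_contribution (h0 : 0 ∉ S) (hτ : IsTau S (tau S)) (ha : ∃ a ∈ S, 2 ≤ a)
    {m : ℕ} (hm : 2 ≤ m) {P : Partition m} (hP : HasBlockSizesIn S P) {Φ : ℕ}
    (hΦ : potential P ≤ Φ) :
    Tendsto (fun M : ℕ => contribution S (Nat.setGcd S * M) ⟨m, P⟩ /
        (((Nat.setGcd S * M : ℕ) : ℝ) ^ ((Φ : ℝ) / 2) * (rho S)⁻¹ ^ (Nat.setGcd S * M))) atTop
      (𝓝 (if potential P = Φ then (Nat.setGcd S : ℝ) * Φ /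
        (2 * Real.Gamma ((Φ : ℝ) / 2 + 1)) * weight S ⟨m, P⟩ else 0)) := by
  classical
  have hρ := rho_pos h0 hτ
  have hd := setGcd_pos ha
  have hd' : (0 : ℝ) < Nat.setGcd S := by exact_mod_cast hd
  have hm' : (0 : ℝ) < m := by positivity
  -- As a sum of block sizes, `m` is `gcd(S) * j`; removing the core just shifts the index `M` by
  -- `j`.
  obtain ⟨j, hj⟩ := setGcd_dvd_of_hasBlockSizesIn hP
  set α : ℝ := (potential P : ℝ) / 2 with hα
  have h1 := tendsto_rpow_mul_coeff_prod h0 hτ ha Finset.univ (gapCount (toSetoid P))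
    (fun R _ => one_le_gapCount _ R) (hα.trans (by rw [potential_eq hm P])) j
  -- This power removes the cores whose potential is below `Φ`.
  have h2 : Tendsto (fun M : ℕ => (M : ℝ) ^ (α - (Φ : ℝ) / 2)) atTop
      (𝓝 (if potential P = Φ then 1 else 0)) := by
    split_ifs with h
    · rw [hα, h, sub_self]
      simp
    · have hlt : (0 : ℝ) < (Φ : ℝ) / 2 - α := by
        have : ((potential P : ℕ) : ℝ) < Φ := by exact_mod_cast lt_of_le_of_ne hΦ h
        rw [hα]; linarith
      have := (tendsto_rpow_neg_atTop hlt).comp tendsto_natCast_atTop_atTop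
      simpa [Function.comp_def] using this
  have h3 := (h1.mul h2).const_mul (rho S ^ m / m * (Nat.setGcd S : ℝ) ^ (1 - (Φ : ℝ) / 2))
  have hlimit : rho S ^ m / m * (Nat.setGcd S : ℝ) ^ (1 - (Φ : ℝ) / 2) *
      (α / Real.Gamma (α + 1) * ((Nat.setGcd S : ℝ) ^ α *
        ∏ R, regionConst S (gapCount (toSetoid P) R)) * if potential P = Φ then 1 else 0) =
      if potential P = Φ then (Nat.setGcd S : ℝ) * Φ /
        (2 * Real.Gamma ((Φ : ℝ) / 2 + 1)) * weight S ⟨m, P⟩ else 0 := by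
    split_ifs with h
    · rw [weight_eq h0 hτ hm P, hα, h, Real.rpow_sub hd', Real.rpow_one]
      have : 0 < (Nat.setGcd S : ℝ) ^ ((Φ : ℝ) / 2) := Real.rpow_pos_of_pos hd' _
      have hG : Real.Gamma ((Φ : ℝ) / 2 + 1) ≠ 0 := (Real.Gamma_pos_of_pos (by positivity)).ne'
      field_simp
    · rw [mul_zero, mul_zero]
  rw [hlimit] at h3
  refine h3.congr' ?_
  filter_upwards [eventually_ge_atTop j, eventually_ne_atTop 0] with M hM hM0
  have hM' : (0 : ℝ) < M := by exact_mod_cast Nat.pos_of_ne_zero hM0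
  have hle : m ≤ Nat.setGcd S * M := by rw [hj]; exact Nat.mul_le_mul_left _ hM
  have hsub : Nat.setGcd S * M - m = Nat.setGcd S * (M - j) := by rw [hj, ← Nat.mul_sub]
  have hadd : Nat.setGcd S * M = m + Nat.setGcd S * (M - j) := by omega
  have hcoeff := coeff_fillSeries h0 hd (toSetoid P) (M - j)
  simp only [contribution]
  rw [if_pos hle, hsub, ← hcoeff]
  have e1 : ((rho S)⁻¹ ^ (Nat.setGcd S * M)) =
      (rho S ^ m)⁻¹ * (rho S ^ (Nat.setGcd S * (M - j)))⁻¹ := by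
    rw [hadd, inv_pow, pow_add, mul_inv]
  have e2 : (M : ℝ) ^ (1 - α) * (M : ℝ) ^ (α - (Φ : ℝ) / 2) = M / (M : ℝ) ^ ((Φ : ℝ) / 2) := by
    rw [← Real.rpow_add hM', show 1 - α + (α - (Φ : ℝ) / 2) = 1 - (Φ : ℝ) / 2 by ring,
      Real.rpow_sub hM', Real.rpow_one]
  have e3 : 0 < (Nat.setGcd S : ℝ) ^ ((Φ : ℝ) / 2) := Real.rpow_pos_of_pos hd' _
  have e4 : 0 < (M : ℝ) ^ ((Φ : ℝ) / 2) := Real.rpow_pos_of_pos hM' _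
  rw [e1, Real.rpow_sub hd', Real.rpow_one]
  calc _ = rho S ^ m / m * ((Nat.setGcd S : ℝ) / (Nat.setGcd S : ℝ) ^ ((Φ : ℝ) / 2)) *
        (((M : ℝ) ^ (1 - α) * (M : ℝ) ^ (α - (Φ : ℝ) / 2)) *
          (PowerSeries.coeff (Nat.setGcd S * (M - j)) (fillSeries S (toSetoid P)) *
            rho S ^ (Nat.setGcd S * (M - j)))) := by ring
    _ = _ := by
      rw [e2]
      push_cast
      rw [Real.mul_rpow hd'.le hM'.le]
      field_simp

end Contribution

/-! ### The sum over the cores -/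

section Cores

variable {S : Set ℕ} {k : ℕ}

/-- The finite set of the cores. -/
def coresFinset (S : Set ℕ) (k : ℕ) : Finset (Σ m : ℕ, Partition m) :=
  (Finset.Icc 1 (4 * k)).sigma fun m =>
    (Set.toFinite {P : Partition m | toSetoid P ∈ coreSetoids S k m}).toFinset

theorem bounds_of_mem_coreSetoids (hk : 1 ≤ k) {m : ℕ} {K : Setoid (Fin m)}
    (h : K ∈ coreSetoids S k m) : 2 ≤ m ∧ m ≤ 4 * k := by
  obtain ⟨-, h2, h3⟩ := h
  have h4 := ncard_coreSet_le K
  rw [h3, h2, Set.ncard_univ, Nat.card_eq_fintype_card, Fintype.card_fin] at h4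
  obtain ⟨x, b, c, d, hx⟩ := coreSet_nonempty (r := K) (by omega)
  refine ⟨?_, h4⟩
  by_contra! hm
  have : Subsingleton (Fin m) := Fin.subsingleton_iff_le_one.2 (by omega)
  refine hx.2.2.2 ?_
  rw [Subsingleton.elim b x]

theorem coe_coresFinset (hk : 1 ≤ k) : (coresFinset S k : Set (Σ m : ℕ, Partition m)) = cores S k := by
  ext ⟨m, P⟩
  rw [mem_cores_iff, Finset.mem_coe, coresFinset, Finset.mem_sigma, Set.Finite.mem_toFinset]
  refine ⟨fun h => h.2, fun h => ⟨?_, h⟩⟩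
  have := bounds_of_mem_coreSetoids hk h
  exact Finset.mem_Icc.2 ⟨one_le_two.trans this.1, this.2⟩

theorem partitionCount_eq_sum (hk : 1 ≤ k) (n : ℕ) :
    (partitionCount S k n : ℝ) = ∑ K ∈ coresFinset S k, contribution S n K := by
  rw [partitionCount_eq, ncard_setoids_eq hk, coresFinset, Finset.sum_sigma]
  refine Finset.sum_congr rfl fun m _ => ?_
  rw [Finset.mul_sum]
  symm
  refine Finset.sum_bij (fun P _ => toSetoid P) (fun P hP => ?_)
    (fun P _ Q _ h => toSetoid_bijective.1 h) (fun K hK => ?_) (fun P _ => rfl)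
  · rw [coreFinset, Set.Finite.mem_toFinset]
    exact (Set.Finite.mem_toFinset (s := {P | toSetoid P ∈ coreSetoids S k m}) _).1 hP
  · rw [coreFinset, Set.Finite.mem_toFinset] at hK
    obtain ⟨P, rfl⟩ := toSetoid_bijective.2 K
    exact ⟨P, (Set.Finite.mem_toFinset _).2 hK, rfl⟩

theorem finite_potential_cores (hk : 1 ≤ k) :
    ((fun K : Σ m : ℕ, Partition m => potential K.2) '' cores S k).Finite := by
  rw [← coe_coresFinset hk]
  exact (Finset.finite_toSet _).image _

theorem potential_le_maxPotential (hk : 1 ≤ k) {K : Σ m : ℕ, Partition m} (hK : K ∈ cores S k) :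
    potential K.2 ≤ maxPotential S k :=
  le_csSup (finite_potential_cores hk).bddAbove ⟨K, hK, rfl⟩

theorem coe_filter_coresFinset (hk : 1 ≤ k) :
    ((coresFinset S k).filter fun K => potential K.2 = maxPotential S k : Set _) =
      maximalCores S k := by
  ext K
  rw [Finset.mem_coe, Finset.mem_filter, ← Finset.mem_coe, coe_coresFinset hk]
  rfl

theorem Lam_eq (hk : 1 ≤ k) :
    Lam S k = ∑ K ∈ coresFinset S k, if potential K.2 = maxPotential S k then
      (Nat.setGcd S : ℝ) * (maxPotential S k : ℝ) /
        (2 * Real.Gamma ((maxPotential S k : ℝ) / 2 + 1)) * weight S K else 0 := by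
  rw [Lam, ← coe_filter_coresFinset hk, finsum_mem_coe_finset, ← Finset.sum_filter,
    Finset.mul_sum]

theorem atTopDvd_le_map (hd : 0 < Nat.setGcd S) :
    atTopDvd S ≤ map (fun M => Nat.setGcd S * M) atTop := by
  intro s hs
  rw [mem_map, mem_atTop_sets] at hs
  obtain ⟨N, hN⟩ := hs
  rw [atTopDvd, mem_inf_principal]
  filter_upwards [eventually_ge_atTop (Nat.setGcd S * N)] with n hn
  rintro ⟨M, rfl⟩
  exact hN M (Nat.le_of_mul_le_mul_left hn hd)

theorem tendsto_partitionCount (hk : 1 ≤ k) (h0 : 0 ∉ S) (hτ : IsTau S (tau S))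
    (ha : ∃ a ∈ S, 2 ≤ a) :
    Tendsto (fun n : ℕ => (partitionCount S k n : ℝ) /
      ((n : ℝ) ^ ((maxPotential S k : ℝ) / 2) * (rho S)⁻¹ ^ n)) (atTopDvd S) (𝓝 (Lam S k)) := by
  refine Tendsto.mono_left (tendsto_map'_iff.2 ?_) (atTopDvd_le_map (setGcd_pos ha))
  rw [Lam_eq hk]
  have h : ∀ K ∈ coresFinset S k, Tendsto (fun M : ℕ => contribution S (Nat.setGcd S * M) K /
      (((Nat.setGcd S * M : ℕ) : ℝ) ^ ((maxPotential S k : ℝ) / 2) *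
        (rho S)⁻¹ ^ (Nat.setGcd S * M))) atTop
      (𝓝 (if potential K.2 = maxPotential S k then (Nat.setGcd S : ℝ) * (maxPotential S k : ℝ) /
        (2 * Real.Gamma ((maxPotential S k : ℝ) / 2 + 1)) * weight S K else 0)) := by
    rintro ⟨m, P⟩ hK
    have hK' : (⟨m, P⟩ : Σ m : ℕ, Partition m) ∈ cores S k := by
      rw [← coe_coresFinset hk]; exact hK
    exact tendsto_contribution h0 hτ ha (bounds_of_mem_coreSetoids hk (mem_cores_iff.1 hK')).1
      hK'.2.2 (potential_le_maxPotential hk hK')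
  refine (tendsto_finsetSum _ h).congr fun M => ?_
  rw [← Finset.sum_div, ← partitionCount_eq_sum hk]
  rfl

theorem weight_pos (hτ : IsTau S (tau S)) (hρ : 0 < rho S) (hβ : 0 < beta S)
    {K : Σ m : ℕ, Partition m} (hK : 2 ≤ K.1) : 0 < weight S K := by
  have h1 : (0 : ℝ) < K.1 := by exact_mod_cast (by omega : 0 < K.1)
  have h2 := hτ.1
  refine mul_pos (by positivity) (Finset.prod_pos fun i _ => ?_)
  have h3 : (0 : ℝ) < Nat.doubleFactorial (2 * i - 5) := by
    exact_mod_cast Nat.doubleFactorial_pos _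
  have h4 : (0 : ℝ) < Nat.factorial (i - 1) := by exact_mod_cast Nat.factorial_pos _
  positivity

theorem Lam_pos (hk : 1 ≤ k) (h0 : 0 ∉ S) (hτ : IsTau S (tau S)) (ha : ∃ a ∈ S, 2 ≤ a)
    (hΦ : 0 < maxPotential S k) : 0 < Lam S k := by
  have hw : ∀ K ∈ maximalCores S k, 0 < weight S K := fun K hK =>
    weight_pos hτ (rho_pos h0 hτ) (beta_pos h0 hτ ha)
      (bounds_of_mem_coreSetoids hk (mem_cores_iff.1 hK.1)).1
  have hd' : (0 : ℝ) < Nat.setGcd S := by exact_mod_cast setGcd_pos ha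
  have hΦ' : (0 : ℝ) < maxPotential S k := by exact_mod_cast hΦ
  have hG := Real.Gamma_pos_of_pos (show 0 < (maxPotential S k : ℝ) / 2 + 1 by positivity)
  -- The supremum of the empty set is `0`, so `hΦ` provides a core, and the finite supremum is
  -- attained.
  have hne : ((fun K : Σ m : ℕ, Partition m => potential K.2) '' cores S k).Nonempty := by
    rw [Set.nonempty_iff_ne_empty]
    intro h
    rw [maxPotential, h, csSup_empty] at hΦ
    exact lt_irrefl _ hΦ
  obtain ⟨K, hK, hKΦ⟩ := Nat.sSup_mem hne (finite_potential_cores hk).bddAbove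
  rw [Lam, ← coe_filter_coresFinset hk, finsum_mem_coe_finset]
  rw [← coe_filter_coresFinset hk] at hw
  refine mul_pos (by positivity) (Finset.sum_pos (fun K hK => hw K hK) ⟨K, ?_⟩)
  rw [← Finset.mem_coe, coe_filter_coresFinset hk]
  exact ⟨hK, hKΦ⟩

theorem partitionCount_of_not_dvd (S : Set ℕ) (k : ℕ) {n : ℕ} (h : ¬ Nat.setGcd S ∣ n) :
    partitionCount S k n = 0 := by
  rw [partitionCount]
  convert Set.ncard_empty (Partition n)
  rw [Set.eq_empty_iff_forall_notMem]
  exact fun P hP => h (setGcd_dvd_of_hasBlockSizesIn hP.1)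

end Cores

end CirclePartition

end

/-! ### The asymptotics of the number of partitions -/

theorem mainTheorem8 (k : ℕ) (hk : 1 ≤ k) (S : Set ℕ) (h0 : 0 ∉ S) (hne : S.Nonempty)
    (h1 : S ≠ {1}) :
    -- there is no such partition unless `gcd(S) ∣ n`
    (∀ n : ℕ, ¬ Nat.setGcd S ∣ n → CirclePartition.partitionCount S k n = 0) ∧
    -- the count is `(Λ_S + o(1)) n ^ (Φ / 2) ρ_S ^ (-n)`, whatever the value of `Φ`
    Filter.Tendsto
      (fun n : ℕ => (CirclePartition.partitionCount S k n : ℝ) /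
        ((n : ℝ) ^ ((CirclePartition.maxPotential S k : ℝ) / 2) *
          (CirclePartition.rho S)⁻¹ ^ n))
      (CirclePartition.atTopDvd S) (nhds (CirclePartition.Lam S k)) ∧
    -- the count is `Λ_S n ^ (Φ / 2) ρ_S ^ (-n) (1 + o(1))` with `Λ_S > 0`, when `Φ > 0`
    (0 < CirclePartition.maxPotential S k →
      0 < CirclePartition.Lam S k ∧
      Asymptotics.IsEquivalent (CirclePartition.atTopDvd S)
        (fun n : ℕ => (CirclePartition.partitionCount S k n : ℝ))
        (fun n : ℕ => CirclePartition.Lam S k *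
          (n : ℝ) ^ ((CirclePartition.maxPotential S k : ℝ) / 2) *
          (CirclePartition.rho S)⁻¹ ^ n)) := by
  have hτ := CirclePartition.isTau_tau h0 hne h1
  have ha := CirclePartition.exists_two_le_mem h0 hne h1
  have hlim := CirclePartition.tendsto_partitionCount hk h0 hτ ha
  refine ⟨fun n => CirclePartition.partitionCount_of_not_dvd S k, hlim, fun hΦ => ?_⟩
  have hpos := CirclePartition.Lam_pos hk h0 hτ ha hΦ
  refine ⟨hpos, Asymptotics.isEquivalent_of_tendsto_one ?_⟩
  have h := hlim.div_const (CirclePartition.Lam S k)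
  rw [div_self hpos.ne'] at h
  refine h.congr fun n => ?_
  rw [Pi.div_apply, div_div]
  congr 1
  ring
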